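/- **Setting.** Functions and distributions live on $\mathbb R$; $\mathcal S(X)$ and $\mathcal S'(X)$ are the $X$-valued Schwartz functions and tempered distributions of a complex Banach space $X$, and $\mathcal F f(\xi)=\int e^{-it\xi}f(t)\,dt$. A Banach function space $\Phi\neq\{0\}$ over $(\mathbb R,dt)$ is a Banach space that is an order ideal of the space of measurable functions ($|f|\le|g|$ a.e., $g\in\Phi$ imply $f\in\Phi$, $\|f\|_\Phi\le\|g\|_\Phi$) and has the Fatou property; $\Phi'$ is its Köthe dual, with norm $\|h\|_{\Phi'}=\sup\{\int|fh|\,dt:\|f\|_\Phi\le1\}$. Call $\Phi$ *admissible* if the Hardy–Littlewood maximal operator is bounded on $\Phi$ and on $\Phi'$. For admissible $\Phi$, $\Phi(X)$ is the space of strongly measurable $f:\mathbb R\to X$ with $\|f\|_{\Phi(X)}:=\||f|_X\|_\Phi<\infty$, regarded as a space of regular tempered distributions. For $1<p<\infty$ and a weight $w$ in the Muckenhoupt class $A_p$, with constant $[w]_{A_p}$, let $L^p_w(X)=L^p(\mathbb R,w\,dt;X)$; the norm of a tempered distribution in $L^p_w(X)$ or $\Phi(X)$ is $\infty$ if it does not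 belong to that space. Let $\psi\in C_c^\infty(\mathbb R;\mathbb C)$ with $\psi=1$ on $[-1,1]$, $\operatorname{supp}\psi\subset[-2,2]$; put $\psi_0=\psi$, $\psi_j=\psi(2^{-j}\cdot)-\psi(2^{-j+1}\cdot)$ for $j\ge1$, and $\psi_j(D)f=\mathcal F^{-1}(\psi_j\mathcal Ff)$. For $s\in\mathbb R$, $q\in[1,\infty]$, $r\in(1,\infty)$ let $B^{s,q}_\Phi(X)$ and $F^{s,r}_\Phi(X)$ be the spaces of $f\in\mathcal S'(X)$ with finite norm $$\|f\|_{B^{s,q}_\Phi(X)}=\Bigl(\sum_{j\ge0}\|2^{sj}\psi_j(D)f\|_{\Phi(X)}^q\Bigr)^{1/q},\qquad \|f\|_{F^{s,r}_\Phi(X)}=\Bigl\|\Bigl(\sum_{j\ge0}|2^{sj}\psi_j(D)f(\cdot)|_X^r\Bigr)^{1/r}\Bigr\|_\Phi$$ (supremum over $j$ if $q=\infty$). **Theorem.** Let $X,Y$ be complex Banach spaces, $p\in(1,\infty)$, and let $T:\mathcal S(X)\to\mathcal S'(Y)$ be linear with $T\psi_j(D)f=\psi_j(D)Tf$ for all $f\in\mathcal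 S(X)$, $j\ge0$. (i) Suppose that for every $\mathcal W\subset A_p$ with $\sup_{w\in\mathcal W}[w]_{A_p}<\infty$ $$\sup\{\|T\psi_j(D)f\|_{L^p_w(Y)}: f\in\mathcal S(X),\ \|f\|_{L^p_w(X)}\le1,\ w\in\mathcal W,\ j\ge0\}<\infty.$$ Then for all $s\in\mathbb R$, $q\in[1,\infty]$ one can choose, for every admissible $\Phi$, an extension of $T$ to a bounded linear operator $\mathcal T_\Phi: B^{s,q}_\Phi(X)\to B^{s,q}_\Phi(Y)$ (in particular $\mathcal S(X)\subset B^{s,q}_\Phi(X)$) such that $\mathcal T_\Phi f=\mathcal T_\Psi f$ for all admissible $\Phi,\Psi$ and all $f\in B^{s,q}_\Phi(X)\cap B^{s,q}_\Psi(X)$. The same holds with $F^{s,r}_\Phi$, $r\in(1,\infty)$, in place of $B^{s,q}_\Phi$. (ii) Suppose that for every $\mathcal W\subset A_p$ with $\sup_{w\in\mathcal W}[w]_{A_p}<\infty$ $$\sup\{\|Tf\|_{L^p_w(Y)}: f\in\mathcal S(X),\ \|f\|_{L^p_w(X)}\le1,\ w\in\mathcal W\}<\infty.$$ Then, for all $\mathbb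 E$ in the class $\{\Phi,\ B^{s,q}_\Phi,\ F^{s,r}_\Phi:\ \Phi \text{ admissible},\ s\in\mathbb R,\ q\in[1,\infty],\ r\in(1,\infty)\}$, one can choose extensions of $T$ to bounded linear operators $\mathcal T_{\mathbb E}:\mathbb E(X)\to\mathbb E(Y)$ (in particular $\mathcal S(X)\subset\mathbb E(X)$) such that $\mathcal T_{\mathbb E}f=\mathcal T_{\widetilde{\mathbb E}}f$ for all $\mathbb E,\widetilde{\mathbb E}$ in this class and all $f\in\mathbb E(X)\cap\widetilde{\mathbb E}(X)$. Moreover, for every admissible $\Phi$, every $f\in\Phi(X)$ is locally integrable and defines a tempered distribution. -/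

import Mathlib

open MeasureTheory Set
open scoped ENNReal NNReal SchwartzMap

noncomputable section

/-! ### Banach function spaces over the real line -/

/-- A Banach function space over `(ℝ, dt)`, given by its extended norm on nonnegative measurable
functions: a definite, positively homogeneous, subadditive, monotone functional with Fatou's
property that is finite on some nonzero function. The space itself consists of the
(classes of) measurable `f` with `norm |f| < ∞`; it is an order ideal of `L⁰`, and it is complete by
Fatou's property. Values of `norm` at non-measurable functions are irrelevant. -/
structure BanachFunctionSpace where
  norm : (ℝ → ℝ≥0∞) → ℝ≥0∞
  norm_eq_zero_iff : ∀ f : ℝ → ℝ≥0∞, AEMeasurable f volume →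
    (norm f = 0 ↔ f =ᵐ[volume] fun _ => 0)
  norm_const_mul : ∀ (c : ℝ≥0) (f : ℝ → ℝ≥0∞), AEMeasurable f volume →
    norm (fun t => c * f t) = c * norm f
  norm_add_le : ∀ f g : ℝ → ℝ≥0∞, AEMeasurable f volume → AEMeasurable g volume →
    norm (fun t => f t + g t) ≤ norm f + norm g
  norm_mono : ∀ f g : ℝ → ℝ≥0∞, AEMeasurable f volume → AEMeasurable g volume →
    (∀ᵐ t ∂volume, f t ≤ g t) → norm f ≤ norm g
  norm_iSup : ∀ f : ℕ → ℝ → ℝ≥0∞, (∀ n, AEMeasurable (f n) volume) → Monotone f →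
    norm (fun t => ⨆ n, f n t) = ⨆ n, norm (f n)
  nontrivial : ∃ f : ℝ → ℝ≥0∞, AEMeasurable f volume ∧ norm f ≠ 0 ∧ norm f ≠ ∞

/-- The norm of the Köthe dual (associate space) `Φ'`. -/
def BanachFunctionSpace.dualNorm (Φ : BanachFunctionSpace) (h : ℝ → ℝ≥0∞) : ℝ≥0∞ :=
  ⨆ (f : ℝ → ℝ≥0∞) (_ : AEMeasurable f volume) (_ : Φ.norm f ≤ 1), ∫⁻ t, f t * h t

/-- The (uncentred) Hardy-Littlewood maximal function. -/
def maximalFn (f : ℝ → ℝ≥0∞) (t : ℝ) : ℝ≥0∞ :=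
  ⨆ (a : ℝ) (b : ℝ) (_ : a < t) (_ : t < b), (∫⁻ x in Ioo a b, f x) / ENNReal.ofReal (b - a)

/-- The Hardy-Littlewood operator is bounded on the space of all measurable `f` with
`ρ |f| < ∞`. -/
def MaximalBounded (ρ : (ℝ → ℝ≥0∞) → ℝ≥0∞) : Prop :=
  ∃ C : ℝ≥0, ∀ f : ℝ → ℝ≥0∞, AEMeasurable f volume → ρ f < ∞ → ρ (maximalFn f) ≤ C * ρ f

/-- The Hardy-Littlewood operator is bounded on `Φ` and on its dual `Φ'`. -/
def BanachFunctionSpace.Admissible (Φ : BanachFunctionSpace) : Prop :=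
  MaximalBounded Φ.norm ∧ MaximalBounded Φ.dualNorm

/-! ### Muckenhoupt weights -/

/-- The `A_p`-constant `[w]_{A_p}`. -/
def apConst (p : ℝ) (w : ℝ → ℝ≥0∞) : ℝ≥0∞ :=
  ⨆ (a : ℝ) (b : ℝ) (_ : a < b),
    ((∫⁻ t in Ioo a b, w t) / ENNReal.ofReal (b - a)) *
      ((∫⁻ t in Ioo a b, w t ^ (-(1 / (p - 1)))) / ENNReal.ofReal (b - a)) ^ (p - 1)

/-- The Muckenhoupt class `A_p` on the real line. -/
def IsMuckenhoupt (p : ℝ) (w : ℝ → ℝ≥0∞) : Prop :=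
  AEMeasurable w volume ∧ (∀ᵐ t ∂volume, 0 < w t ∧ w t < ∞) ∧ apConst p w < ∞

/-- The norm of the weighted Lebesgue space `L^p_w`. -/
def weightedNorm (p : ℝ) (w : ℝ → ℝ≥0∞) (f : ℝ → ℝ≥0∞) : ℝ≥0∞ :=
  (∫⁻ t, f t ^ p * w t) ^ (1 / p)

/-! ### Regular distributions and the dyadic multipliers -/

section Distributions

variable {X : Type*} [NormedAddCommGroup X] [NormedSpace ℂ X]

/-- The tempered distribution `u` is regular and given by the locally integrable function `g`. -/
def Represents (u : 𝓢'(ℝ, X)) (g : ℝ → X) : Prop :=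
  LocallyIntegrable g volume ∧
    ∀ φ : 𝓢(ℝ, ℂ), HasCompactSupport (φ : ℝ → ℂ) → u φ = ∫ t, φ t • g t

/-- `ρ (|u|)` for a regular distribution `u` (the representing function is unique a.e.), and `∞` if
`u` is not regular. For `ρ = Φ.norm` this is the norm of `Φ(X)`, for `ρ = weightedNorm p w` that of
`L^p_w(X)`. -/
def distNorm (ρ : (ℝ → ℝ≥0∞) → ℝ≥0∞) (u : 𝓢'(ℝ, X)) : ℝ≥0∞ :=
  ⨅ (g : ℝ → X) (_ : Represents u g), ρ (fun t => ‖g t‖ₑ)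

/-- `ψ` generates a dyadic resolution of the identity. -/
def IsGenerator (ψ : ℝ → ℂ) : Prop :=
  ContDiff ℝ (⊤ : ℕ∞) ψ ∧ tsupport ψ ⊆ Icc (-2) 2 ∧ ∀ ξ ∈ Icc (-1 : ℝ) 1, ψ ξ = 1

/-- `ψ_0 = ψ` and `ψ_j = ψ(2^{-j} ·) - ψ(2^{-j+1} ·)` for `j ≥ 1`. -/
def dyadic (ψ : ℝ → ℂ) : ℕ → ℝ → ℂ
  | 0 => ψ
  | j + 1 => fun ξ => ψ (ξ / 2 ^ (j + 1)) - ψ (ξ / 2 ^ j)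

/-- The operator `ψ_j(D)` on `𝓢(X)`, for the Fourier transform `∫ e^{-i t ξ} f(t) dt`. Mathlib's
Fourier transform is `∫ e^{-2 π i t ξ} f(t) dt`, hence the factor `2 π`. -/
def dyadicS (ψ : ℝ → ℂ) (j : ℕ) (f : 𝓢(ℝ, X)) : 𝓢(ℝ, X) :=
  SchwartzMap.fourierMultiplierCLM X (fun ξ => dyadic ψ j (2 * Real.pi * ξ)) f

/-- The operator `ψ_j(D)` on `𝓢'(X)`. -/
def dyadicD (ψ : ℝ → ℂ) (j : ℕ) (u : 𝓢'(ℝ, X)) : 𝓢'(ℝ, X) :=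
  TemperedDistribution.fourierMultiplierCLM X (fun ξ => dyadic ψ j (2 * Real.pi * ξ)) u

/-! ### The spaces -/

/-- The `ℓ^q`-norm of a sequence in `[0, ∞]`. -/
def lqNorm (q : ℝ≥0∞) (a : ℕ → ℝ≥0∞) : ℝ≥0∞ :=
  if q = ∞ then ⨆ j, a j else (∑' j, a j ^ q.toReal) ^ (1 / q.toReal)

/-- The norm of `B^{s,q}_Φ(X)`. -/
def besovNorm (ψ : ℝ → ℂ) (Φ : BanachFunctionSpace) (s : ℝ) (q : ℝ≥0∞) (u : 𝓢'(ℝ, X)) : ℝ≥0∞ :=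
  lqNorm q fun j => ENNReal.ofReal ((2 : ℝ) ^ (s * j)) * distNorm Φ.norm (dyadicD ψ j u)

/-- The norm of `F^{s,r}_Φ(X)`; here `g j` is the function that represents `ψ_j(D) u`. -/
def triebelNorm (ψ : ℝ → ℂ) (Φ : BanachFunctionSpace) (s : ℝ) (r : ℝ≥0∞) (u : 𝓢'(ℝ, X)) : ℝ≥0∞ :=
  ⨅ (g : ℕ → ℝ → X) (_ : ∀ j, Represents (dyadicD ψ j u) (g j)),
    Φ.norm fun t => lqNorm r fun j => ENNReal.ofReal ((2 : ℝ) ^ (s * j)) * ‖g j t‖ₑ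

end Distributions

/-- The symbols `Φ`, `B^{s,q}_Φ` with `q ∈ [1, ∞]`, and `F^{s,r}_Φ` with `r ∈ (1, ∞)`. -/
inductive Space where
  | base (Φ : BanachFunctionSpace)
  | besov (Φ : BanachFunctionSpace) (s : ℝ) (q : ℝ≥0∞) (hq : 1 ≤ q)
  | triebel (Φ : BanachFunctionSpace) (s : ℝ) (r : ℝ≥0∞) (hr : 1 < r) (hr' : r < ∞)

/-- The underlying Banach function space `Φ`. -/
def Space.fn : Space → BanachFunctionSpace
  | base Φ => Φ
  | besov Φ _ _ _ => Φ
  | triebel Φ _ _ _ _ => Φ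

/-- The norm of `𝔼(X)`, extended by `∞` to all of `𝓢'(X)`. -/
def Space.norm {X : Type*} [NormedAddCommGroup X] [NormedSpace ℂ X] (ψ : ℝ → ℂ) (E : Space)
    (u : 𝓢'(ℝ, X)) : ℝ≥0∞ :=
  match E with
  | base Φ => distNorm Φ.norm u
  | besov Φ s q _ => besovNorm ψ Φ s q u
  | triebel Φ s r _ _ => triebelNorm ψ Φ s r u

/-! ### These norms are norms: the spaces are linear -/

section Linear

variable {X : Type*} [NormedAddCommGroup X] [NormedSpace ℂ X]

theorem Represents.add {u v : 𝓢'(ℝ, X)} {g h : ℝ → X} (hu : Represents u g)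
    (hv : Represents v h) : Represents (u + v) (fun t => g t + h t) := by
  refine ⟨hu.1.add hv.1, fun φ hφ => ?_⟩
  have e : (u + v) φ = u φ + v φ := rfl
  rw [e, hu.2 φ hφ, hv.2 φ hφ]
  rw [← integral_add (hu.1.integrable_smul_left_of_hasCompactSupport φ.continuous hφ)
    (hv.1.integrable_smul_left_of_hasCompactSupport φ.continuous hφ)]
  simp only [smul_add]

theorem Represents.smul {u : 𝓢'(ℝ, X)} {g : ℝ → X} (c : ℂ) (hu : Represents u g) :
    Represents (c • u) (fun t => c • g t) := by
  refine ⟨hu.1.smul c, fun φ hφ => ?_⟩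
  have e : (c • u) φ = c • u φ := rfl
  rw [e, hu.2 φ hφ, ← integral_smul]
  simp only [smul_comm c]

theorem Represents.zero : Represents (0 : 𝓢'(ℝ, X)) (fun _ => 0) :=
  ⟨locallyIntegrable_const 0, fun φ _ => by simp⟩

theorem Represents.aemeasurable {u : 𝓢'(ℝ, X)} {g : ℝ → X} (hu : Represents u g) :
    AEMeasurable (fun t => ‖g t‖ₑ) volume :=
  hu.1.aestronglyMeasurable.enorm

theorem lqNorm_eq_eLpNorm {q : ℝ≥0∞} (hq : 1 ≤ q) (a : ℕ → ℝ≥0∞) :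
    lqNorm q a = eLpNorm a q Measure.count := by
  unfold lqNorm
  split_ifs with h
  · subst h
    simp [eLpNormEssSup_eq_essSup_enorm]
  · have h0 : q ≠ 0 := (zero_lt_one.trans_le hq).ne'
    rw [eLpNorm_eq_lintegral_rpow_enorm_toReal h0 h, lintegral_count]
    simp

theorem lqNorm_mono {q : ℝ≥0∞} {a b : ℕ → ℝ≥0∞} (h : ∀ j, a j ≤ b j) :
    lqNorm q a ≤ lqNorm q b := by
  unfold lqNorm
  split_ifs
  · exact iSup_mono h
  · gcongr with j
    exact h j

theorem lqNorm_add_le {q : ℝ≥0∞} (hq : 1 ≤ q) (a b : ℕ → ℝ≥0∞) :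
    lqNorm q (fun j => a j + b j) ≤ lqNorm q a + lqNorm q b := by
  simp only [lqNorm_eq_eLpNorm hq]
  exact eLpNorm_add_le (f := a) (g := b) (measurable_of_countable _).aestronglyMeasurable
    (measurable_of_countable _).aestronglyMeasurable hq

theorem lqNorm_const_mul {q : ℝ≥0∞} (hq : 1 ≤ q) (c : ℝ≥0∞) (a : ℕ → ℝ≥0∞) :
    lqNorm q (fun j => c * a j) = c * lqNorm q a := by
  unfold lqNorm
  split_ifs with h
  · rw [ENNReal.mul_iSup]
  · have h0 : 0 < q.toReal := ENNReal.toReal_pos (zero_lt_one.trans_le hq).ne' h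
    simp only [ENNReal.mul_rpow_of_nonneg _ _ h0.le]
    rw [ENNReal.tsum_mul_left, ENNReal.mul_rpow_of_nonneg _ _ (by positivity),
      ← ENNReal.rpow_mul, mul_one_div_cancel h0.ne', ENNReal.rpow_one]

theorem lqNorm_aemeasurable {q : ℝ≥0∞} {a : ℕ → ℝ → ℝ≥0∞}
    (ha : ∀ j, AEMeasurable (a j) volume) :
    AEMeasurable (fun t => lqNorm q fun j => a j t) volume := by
  unfold lqNorm
  split_ifs
  · exact AEMeasurable.iSup ha
  · exact (AEMeasurable.tsum fun j => (ha j).pow_const _).pow_const _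

theorem distNorm_add_le (Φ : BanachFunctionSpace) (u v : 𝓢'(ℝ, X)) :
    distNorm Φ.norm (u + v) ≤ distNorm Φ.norm u + distNorm Φ.norm v := by
  unfold distNorm
  simp only [iInf_subtype']
  refine ENNReal.le_iInf_add_iInf fun g h => ?_
  refine (iInf_le _ ⟨_, g.2.add h.2⟩).trans ?_
  refine (Φ.norm_mono _ _ (g.2.add h.2).aemeasurable
    (g.2.aemeasurable.add h.2.aemeasurable) (.of_forall fun t => enorm_add_le _ _)).trans ?_
  exact Φ.norm_add_le _ _ g.2.aemeasurable h.2.aemeasurable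

theorem distNorm_zero (Φ : BanachFunctionSpace) : distNorm Φ.norm (0 : 𝓢'(ℝ, X)) = 0 := by
  refine le_antisymm ((iInf₂_le _ Represents.zero).trans ?_) zero_le
  simp only [enorm_zero]
  exact ((Φ.norm_eq_zero_iff _ aemeasurable_const).2 Filter.EventuallyEq.rfl).le

theorem distNorm_smul_le (Φ : BanachFunctionSpace) (c : ℂ) (u : 𝓢'(ℝ, X)) :
    distNorm Φ.norm (c • u) ≤ ‖c‖ₑ * distNorm Φ.norm u := by
  rcases eq_or_ne c 0 with rfl | hc
  · simp [distNorm_zero]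
  unfold distNorm
  simp only [iInf_subtype']
  rw [ENNReal.mul_iInf_of_ne (enorm_ne_zero.2 hc) enorm_ne_top]
  refine le_iInf fun g => (iInf_le _ ⟨_, g.2.smul c⟩).trans ?_
  simp only [enorm_smul]
  exact (Φ.norm_const_mul ‖c‖₊ _ g.2.aemeasurable).le

theorem dyadicD_add (ψ : ℝ → ℂ) (j : ℕ) (u v : 𝓢'(ℝ, X)) :
    dyadicD ψ j (u + v) = dyadicD ψ j u + dyadicD ψ j v := map_add _ _ _

theorem dyadicD_smul (ψ : ℝ → ℂ) (j : ℕ) (c : ℂ) (u : 𝓢'(ℝ, X)) :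
    dyadicD ψ j (c • u) = c • dyadicD ψ j u := map_smul _ _ _

theorem dyadicD_zero (ψ : ℝ → ℂ) (j : ℕ) : dyadicD ψ j (0 : 𝓢'(ℝ, X)) = 0 := map_zero _

theorem lqNorm_zero {q : ℝ≥0∞} (hq : 1 ≤ q) : lqNorm q (fun _ => 0) = 0 := by
  simpa using lqNorm_const_mul hq 0 (fun _ => 0)

theorem triebel_aemeasurable {r : ℝ≥0∞} (c : ℕ → ℝ≥0∞) {u : ℕ → 𝓢'(ℝ, X)} {g : ℕ → ℝ → X}
    (h : ∀ j, Represents (u j) (g j)) :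
    AEMeasurable (fun t => lqNorm r fun j => c j * ‖g j t‖ₑ) volume :=
  lqNorm_aemeasurable fun j => (h j).aemeasurable.const_mul (c j)

theorem triebelNorm_zero (ψ : ℝ → ℂ) (Φ : BanachFunctionSpace) (s : ℝ) {r : ℝ≥0∞} (hr : 1 ≤ r) :
    triebelNorm ψ Φ s r (0 : 𝓢'(ℝ, X)) = 0 := by
  refine le_antisymm ((iInf₂_le (fun _ _ => 0) fun j => ?_).trans ?_) zero_le
  · rw [dyadicD_zero]
    exact Represents.zero
  · simp only [enorm_zero, mul_zero, lqNorm_zero hr]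
    exact ((Φ.norm_eq_zero_iff _ aemeasurable_const).2 Filter.EventuallyEq.rfl).le

theorem triebelNorm_add_le (ψ : ℝ → ℂ) (Φ : BanachFunctionSpace) (s : ℝ) {r : ℝ≥0∞} (hr : 1 ≤ r)
    (u v : 𝓢'(ℝ, X)) :
    triebelNorm ψ Φ s r (u + v) ≤ triebelNorm ψ Φ s r u + triebelNorm ψ Φ s r v := by
  unfold triebelNorm
  simp only [iInf_subtype']
  refine ENNReal.le_iInf_add_iInf fun g h => ?_
  have hgh : ∀ j, Represents (dyadicD ψ j (u + v)) (fun t => g.1 j t + h.1 j t) := fun j => by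
    rw [dyadicD_add]
    exact (g.2 j).add (h.2 j)
  refine (iInf_le _ ⟨fun j t => g.1 j t + h.1 j t, hgh⟩).trans ?_
  refine (Φ.norm_mono _ _ (triebel_aemeasurable _ hgh)
    ((triebel_aemeasurable _ g.2).add (triebel_aemeasurable _ h.2)) (.of_forall fun t => ?_)).trans
    (Φ.norm_add_le _ _ (triebel_aemeasurable _ g.2) (triebel_aemeasurable _ h.2))
  refine (lqNorm_mono fun j => ?_).trans (lqNorm_add_le hr _ _)
  rw [← mul_add]
  gcongr
  exact enorm_add_le _ _

theorem triebelNorm_smul_le (ψ : ℝ → ℂ) (Φ : BanachFunctionSpace) (s : ℝ) {r : ℝ≥0∞} (hr : 1 ≤ r)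
    (c : ℂ) (u : 𝓢'(ℝ, X)) :
    triebelNorm ψ Φ s r (c • u) ≤ ‖c‖ₑ * triebelNorm ψ Φ s r u := by
  rcases eq_or_ne c 0 with rfl | hc
  · simp [triebelNorm_zero ψ Φ s hr]
  unfold triebelNorm
  simp only [iInf_subtype']
  rw [ENNReal.mul_iInf_of_ne (enorm_ne_zero.2 hc) enorm_ne_top]
  refine le_iInf fun g => ?_
  have hg : ∀ j, Represents (dyadicD ψ j (c • u)) (fun t => c • g.1 j t) := fun j => by
    rw [dyadicD_smul]
    exact (g.2 j).smul c
  refine (iInf_le _ ⟨fun j t => c • g.1 j t, hg⟩).trans ?_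
  simp only [enorm_smul, mul_left_comm _ ‖c‖ₑ, lqNorm_const_mul hr]
  exact (Φ.norm_const_mul ‖c‖₊ _ (triebel_aemeasurable _ g.2)).le

theorem Space.norm_zero (ψ : ℝ → ℂ) (E : Space) : E.norm ψ (0 : 𝓢'(ℝ, X)) = 0 := by
  cases E with
  | base Φ => exact distNorm_zero Φ
  | besov Φ s q hq =>
    simp only [Space.norm, besovNorm, dyadicD_zero, distNorm_zero, mul_zero, lqNorm_zero hq]
  | triebel Φ s r hr hr' => exact triebelNorm_zero ψ Φ s hr.le

theorem Space.norm_add_le (ψ : ℝ → ℂ) (E : Space) (u v : 𝓢'(ℝ, X)) :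
    E.norm ψ (u + v) ≤ E.norm ψ u + E.norm ψ v := by
  cases E with
  | base Φ => exact distNorm_add_le Φ u v
  | besov Φ s q hq =>
    refine (lqNorm_mono fun j => ?_).trans (lqNorm_add_le hq _ _)
    rw [← mul_add, dyadicD_add]
    gcongr
    exact distNorm_add_le Φ _ _
  | triebel Φ s r hr hr' => exact triebelNorm_add_le ψ Φ s hr.le u v

theorem Space.norm_smul_le (ψ : ℝ → ℂ) (E : Space) (c : ℂ) (u : 𝓢'(ℝ, X)) :
    E.norm ψ (c • u) ≤ ‖c‖ₑ * E.norm ψ u := by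
  cases E with
  | base Φ => exact distNorm_smul_le Φ c u
  | besov Φ s q hq =>
    refine (lqNorm_mono fun j => ?_).trans (lqNorm_const_mul hq ‖c‖ₑ _).le
    rw [mul_left_comm, dyadicD_smul]
    gcongr
    exact distNorm_smul_le Φ c _
  | triebel Φ s r hr hr' => exact triebelNorm_smul_le ψ Φ s hr.le c u

end Linear

/-- The space `𝔼(X)` as a linear subspace of `𝓢'(X)`. -/
def Space.carrier (ψ : ℝ → ℂ) (X : Type*) [NormedAddCommGroup X] [NormedSpace ℂ X] (E : Space) :
    Submodule ℂ 𝓢'(ℝ, X) where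
  carrier := {u | E.norm ψ u < ∞}
  zero_mem' := by simp [E.norm_zero ψ]
  add_mem' {u v} hu hv :=
    (E.norm_add_le ψ u v).trans_lt (ENNReal.add_lt_top.2 ⟨hu, hv⟩)
  smul_mem' c u hu :=
    (E.norm_smul_le ψ c u).trans_lt (ENNReal.mul_lt_top enorm_lt_top hu)

/-! ### Extensions -/

section Extensions

variable {X Y : Type*} [NormedAddCommGroup X] [NormedSpace ℂ X]
  [NormedAddCommGroup Y] [NormedSpace ℂ Y]

/-- `S` belongs to `𝓛(𝔼(X), 𝔼(Y))`. -/
def IsBoundedOp (ψ : ℝ → ℂ) (E : Space) (S : E.carrier ψ X →ₗ[ℂ] E.carrier ψ Y) : Prop :=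
  ∃ C : ℝ≥0, ∀ u, E.norm ψ (S u : 𝓢'(ℝ, Y)) ≤ C * E.norm ψ (u : 𝓢'(ℝ, X))

/-- `S` is an extension of `T`; in particular `𝓢(X) ⊆ 𝔼(X)`. -/
def Extends (ψ : ℝ → ℂ) (T : 𝓢(ℝ, X) →ₗ[ℂ] 𝓢'(ℝ, Y)) (E : Space)
    (S : E.carrier ψ X →ₗ[ℂ] E.carrier ψ Y) : Prop :=
  ∀ f : 𝓢(ℝ, X), ∃ hf : (f : 𝓢'(ℝ, X)) ∈ E.carrier ψ X, (S ⟨f, hf⟩ : 𝓢'(ℝ, Y)) = T f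

/-- `T` extends to an operator `𝒯_𝔼` in `𝓛(𝔼(X), 𝔼(Y))` for every `𝔼` in the class `𝓔`, in such a
way that `𝒯_𝔼 u = 𝒯_𝔽 u` for all `𝔼, 𝔽` in `𝓔` and all `u ∈ 𝔼(X) ∩ 𝔽(X)`. -/
def HasConsistentExtensions (ψ : ℝ → ℂ) (T : 𝓢(ℝ, X) →ₗ[ℂ] 𝓢'(ℝ, Y)) (𝓔 : Set Space) : Prop :=
  ∃ 𝒯 : ∀ E : Space, E.carrier ψ X →ₗ[ℂ] E.carrier ψ Y,
    (∀ E ∈ 𝓔, IsBoundedOp ψ E (𝒯 E) ∧ Extends ψ T E (𝒯 E)) ∧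
    ∀ E ∈ 𝓔, ∀ F ∈ 𝓔, ∀ (u : 𝓢'(ℝ, X)) (hE : u ∈ E.carrier ψ X) (hF : u ∈ F.carrier ψ X),
      (𝒯 E ⟨u, hE⟩ : 𝓢'(ℝ, Y)) = 𝒯 F ⟨u, hF⟩

end Extensions

end

/-! The operator is extended to all spaces at once by a description of its graph that refers to none
of them.

* *Extrapolation.* By the Rubio de Francia algorithm every `g ∈ Φ` lies in some `L^p_w` with a bound
  for `[w]_{A_p}` that depends on the norms of the maximal operator on `Φ` and `Φ'` only, and
  estimates in all these `L^p_w` carry over to `Φ` (`exists_weightedNorm_lt_top`,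
  `norm_le_of_weightedNorm_le`). The passage back from the bilinear form to the norm of `Φ` is the
  Lorentz–Luxemburg theorem (`BanachFunctionSpace.norm_le_of_forall_dualNorm_le`), proved by
  separation in `L²`.
* *Maximal operators.* Muckenhoupt's theorem (`weightedNorm_maximalFn_le`) makes the spaces `L^p_w`
  themselves admissible, with bounds that are uniform in `[w]_{A_p}`. The operators `ψ_j(D)` are
  dominated by the maximal operator, uniformly in `j` (`exists_enorm_dyadicS_le`), hence are bounded
  on these spaces.
* *Gluing.* An operator that is bounded on all `L^p_w` extends to their union by density, and the
  extension is unique because the minimum of two `A_p`-weights is one (`IsExtension.unique`).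
  Distributions in Besov and Triebel–Lizorkin spaces need not be regular, and in the first part only
  `ψ_m(D) T` is bounded. Thus `v` is called the dyadic extension at `u` if `ψ_m(D) ψ_k(D) v` is
  obtained by extending `ψ_m(D) T` to `ψ_k(D) u`, for all `k` and `m` (`IsDyadicExtension`). It is
  unique by the Littlewood–Paley decomposition, so that linearity and consistency of the extensions
  come for free (`hasConsistentExtensions`). It exists (`exists_isDyadicExtension`), as the sum over
  the blocks of `u` converges weakly: at a test function the block of frequency `2^l` only sees
  frequencies near `2^l`, where the test function is smaller than any power of `2^{-l}`.
* *Estimates.* Each block is bounded on every admissible `Φ`, with constants that are uniform over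
  the blocks (`IsDyadicExtension.distNorm_dyadicD_le`), which gives the Besov estimate. Applied to
  `L^r_w`, this is boundedness on `ℓ^r(L^r_w) = L^r_w(ℓ^r)`, and a second extrapolation, now with
  exponent `r`, gives the Triebel–Lizorkin estimate.
-/

noncomputable section

open Filter Topology

/-! ### The maximal operator of a measure on the line -/

/-- The uncentred maximal function on the line with respect to a measure `μ`. On intervals of
measure `0` the average is `0 / 0 = 0`. -/
def intervalMax (μ : Measure ℝ) (f : ℝ → ℝ≥0∞) (t : ℝ) : ℝ≥0∞ :=
  ⨆ (a : ℝ) (b : ℝ) (_ : a < t) (_ : t < b), (∫⁻ x in Ioo a b, f x ∂μ) / μ (Ioo a b)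

theorem maximalFn_eq_intervalMax (f : ℝ → ℝ≥0∞) : maximalFn f = intervalMax volume f := by
  funext t
  simp only [maximalFn, intervalMax, Real.volume_Ioo]

theorem average_le_intervalMax (μ : Measure ℝ) (f : ℝ → ℝ≥0∞) {a b t : ℝ} (h : t ∈ Ioo a b) :
    (∫⁻ x in Ioo a b, f x ∂μ) / μ (Ioo a b) ≤ intervalMax μ f t :=
  le_iSup_of_le a (le_iSup_of_le b (le_iSup₂_of_le h.1 h.2 le_rfl))

theorem average_le_maximalFn (f : ℝ → ℝ≥0∞) {a b t : ℝ} (h : t ∈ Ioo a b) :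
    (∫⁻ x in Ioo a b, f x) / ENNReal.ofReal (b - a) ≤ maximalFn f t :=
  le_iSup_of_le a (le_iSup_of_le b (le_iSup₂_of_le h.1 h.2 le_rfl))

/-- The superlevel sets of a maximal function are unions of open intervals. -/
theorem setOf_lt_intervalMax (μ : Measure ℝ) (f : ℝ → ℝ≥0∞) (c : ℝ≥0∞) :
    {t | c < intervalMax μ f t} =
      ⋃ I ∈ {I : ℝ × ℝ | c < (∫⁻ x in Ioo I.1 I.2, f x ∂μ) / μ (Ioo I.1 I.2)}, Ioo I.1 I.2 := by
  ext t
  simp only [intervalMax, mem_ofPred_eq, lt_iSup_iff, mem_iUnion, exists_prop, Prod.exists, mem_Ioo]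
  constructor
  · rintro ⟨a, b, h1, h2, h⟩
    exact ⟨a, b, h, h1, h2⟩
  · rintro ⟨a, b, h, h1, h2⟩
    exact ⟨a, b, h1, h2, h⟩

theorem measurable_intervalMax (μ : Measure ℝ) (f : ℝ → ℝ≥0∞) : Measurable (intervalMax μ f) := by
  refine measurable_of_Ioi fun c => IsOpen.measurableSet ?_
  change IsOpen {t | c < intervalMax μ f t}
  rw [setOf_lt_intervalMax]
  exact isOpen_biUnion fun _ _ => isOpen_Ioo

theorem measurable_maximalFn (f : ℝ → ℝ≥0∞) : Measurable (maximalFn f) := by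
  rw [maximalFn_eq_intervalMax]
  exact measurable_intervalMax _ _

theorem intervalMax_mono_ae {μ : Measure ℝ} {f g : ℝ → ℝ≥0∞} (h : f ≤ᵐ[μ] g) :
    intervalMax μ f ≤ intervalMax μ g := fun t => by
  unfold intervalMax
  gcongr (⨆ a, ⨆ b, ⨆ _, ⨆ _, ?_ / _)
  exact lintegral_mono_ae (ae_restrict_of_ae h)

theorem maximalFn_const_mul {c : ℝ≥0∞} (hc : c ≠ ∞) (f : ℝ → ℝ≥0∞) (t : ℝ) :
    maximalFn (fun x => c * f x) t = c * maximalFn f t := by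
  simp only [maximalFn, ENNReal.mul_iSup, lintegral_const_mul' _ _ hc, mul_div_assoc]

theorem maximalFn_tsum_le {f : ℕ → ℝ → ℝ≥0∞} (hf : ∀ n, AEMeasurable (f n) volume) (t : ℝ) :
    maximalFn (fun x => ∑' n, f n x) t ≤ ∑' n, maximalFn (f n) t := by
  refine iSup_le fun a => iSup_le fun b => iSup_le fun ha => iSup_le fun hb => ?_
  rw [lintegral_tsum fun n => (hf n).restrict, div_eq_mul_inv, ← ENNReal.tsum_mul_right]
  refine ENNReal.tsum_le_tsum fun n => ?_
  rw [← div_eq_mul_inv]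
  exact average_le_maximalFn _ ⟨ha, hb⟩

/-- A finite family of open intervals has a subfamily with the same union that covers no point more
than twice: in a minimal subfamily, of the intervals that contain a point `x`, the one reaching
furthest to the left and the one reaching furthest to the right cover all others. -/
theorem exists_subfamily_overlap_le_two (s : Finset (ℝ × ℝ)) :
    ∃ u ⊆ s, (⋃ I ∈ s, Ioo I.1 I.2) = (⋃ I ∈ u, Ioo I.1 I.2) ∧
      ∀ x, (u.filter fun I => x ∈ Ioo I.1 I.2).card ≤ 2 := by
  classical
  let P : Finset (Finset (ℝ × ℝ)) :=
    s.powerset.filter fun u => (⋃ I ∈ s, Ioo I.1 I.2) = ⋃ I ∈ u, Ioo I.1 I.2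
  have hP : P.Nonempty := ⟨s, by simp [P]⟩
  obtain ⟨u, huP, hmin⟩ := P.exists_min_image Finset.card hP
  simp only [P, Finset.mem_filter, Finset.mem_powerset] at huP hmin
  refine ⟨u, huP.1, huP.2, fun x => ?_⟩
  by_contra! hx
  set v := u.filter fun I => x ∈ Ioo I.1 I.2 with hv
  have hvne : v.Nonempty := Finset.card_pos.1 (by omega)
  obtain ⟨i, hi, hi'⟩ := v.exists_min_image Prod.fst hvne
  obtain ⟨j, hj, hj'⟩ := v.exists_max_image Prod.snd hvne
  obtain ⟨k, hk, hki⟩ : ∃ k ∈ v, k ∉ ({i, j} : Finset (ℝ × ℝ)) := by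
    by_contra! h
    have := Finset.card_le_card (show v ⊆ {i, j} from h)
    have := Finset.card_le_two (a := i) (b := j)
    omega
  simp only [Finset.mem_insert, Finset.mem_singleton, not_or] at hki
  simp only [hv, Finset.mem_filter, mem_Ioo] at hi hj hk hi' hj'
  have hcard : (u.erase k).card < u.card := Finset.card_erase_lt_of_mem hk.1
  refine absurd (hmin (u.erase k) ⟨(u.erase_subset k).trans huP.1, ?_⟩) (by omega)
  rw [huP.2]
  refine subset_antisymm ?_ (biUnion_subset_biUnion_left (Finset.erase_subset k u))
  intro y hy
  simp only [mem_iUnion, exists_prop, mem_Ioo, Finset.mem_erase] at hy ⊢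
  obtain ⟨l, hl, hly⟩ := hy
  by_cases hlk : l = k
  · subst hlk
    rcases le_or_gt y x with hyx | hyx
    · exact ⟨i, ⟨fun h => hki.1 h.symm, hi.1⟩,
        (hi' l ⟨hk.1, hk.2⟩).trans_lt hly.1, hyx.trans_lt hi.2.2⟩
    · exact ⟨j, ⟨fun h => hki.2 h.symm, hj.1⟩,
        hj.2.1.trans hyx, hly.2.trans_le (hj' l ⟨hk.1, hk.2⟩)⟩
  · exact ⟨l, ⟨hlk, hl⟩, hly⟩

/-- The weak type `(1, 1)` inequality, with a constant that does not depend on the measure. -/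
theorem mul_measure_lt_intervalMax_le (μ : Measure ℝ) {f : ℝ → ℝ≥0∞} (hf : AEMeasurable f μ)
    (c : ℝ≥0∞) : c * μ {t | c < intervalMax μ f t} ≤ 2 * ∫⁻ x, f x ∂μ := by
  classical
  rw [setOf_lt_intervalMax]
  set S := {I : ℝ × ℝ | c < (∫⁻ x in Ioo I.1 I.2, f x ∂μ) / μ (Ioo I.1 I.2)} with hS
  obtain ⟨T, hTS, hTc, hT⟩ := TopologicalSpace.isOpen_biUnion_countable S
    (fun I => Ioo I.1 I.2) fun _ _ => isOpen_Ioo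
  rw [← hT]
  have hfin : ∀ s : Finset (ℝ × ℝ), (s : Set (ℝ × ℝ)) ⊆ S →
      c * μ (⋃ I ∈ s, Ioo I.1 I.2) ≤ 2 * ∫⁻ x, f x ∂μ := by
    intro s hs
    obtain ⟨u, hus, hun, hov⟩ := exists_subfamily_overlap_le_two s
    rw [hun]
    calc c * μ (⋃ I ∈ u, Ioo I.1 I.2)
        ≤ c * ∑ I ∈ u, μ (Ioo I.1 I.2) := by gcongr; exact measure_biUnion_finset_le _ _
      _ = ∑ I ∈ u, c * μ (Ioo I.1 I.2) := Finset.mul_sum _ _ _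
      _ ≤ ∑ I ∈ u, ∫⁻ x in Ioo I.1 I.2, f x ∂μ :=
          Finset.sum_le_sum fun I hI => ENNReal.mul_le_of_le_div (hs (hus hI)).le
      _ = ∑ I ∈ u, ∫⁻ x, (Ioo I.1 I.2).indicator f x ∂μ := by
          simp only [lintegral_indicator measurableSet_Ioo]
      _ = ∫⁻ x, ∑ I ∈ u, (Ioo I.1 I.2).indicator f x ∂μ :=
          (lintegral_finsetSum' _ fun I _ => hf.indicator measurableSet_Ioo).symm
      _ ≤ ∫⁻ x, 2 * f x ∂μ := by
          refine lintegral_mono fun x => ?_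
          simp only [indicator_apply]
          rw [← Finset.sum_filter, Finset.sum_const, nsmul_eq_mul]
          gcongr
          exact_mod_cast hov x
      _ = 2 * ∫⁻ x, f x ∂μ := lintegral_const_mul' _ _ (by simp)
  have hdir : Directed (· ⊆ ·) fun s : Finset T => ⋃ I ∈ s, Ioo (I : ℝ × ℝ).1 (I : ℝ × ℝ).2 :=
    directed_of_isDirected_le fun s s' h => biUnion_subset_biUnion_left h
  have hU : (⋃ I ∈ T, Ioo I.1 I.2) =
      ⋃ s : Finset T, ⋃ I ∈ s, Ioo (I : ℝ × ℝ).1 (I : ℝ × ℝ).2 := by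
    rw [biUnion_eq_iUnion]
    exact iUnion_eq_iUnion_finset _
  have : Countable T := hTc.to_subtype
  rw [hU, hdir.measure_iUnion, ENNReal.mul_iSup]
  refine iSup_le fun s => ?_
  have := hfin (s.map (Function.Embedding.subtype _)) fun I hI => by
    simp only [Finset.coe_map, Function.Embedding.subtype_apply, mem_image] at hI
    obtain ⟨J, -, rfl⟩ := hI
    exact hTS J.2
  simpa using this

/-- Truncating at half the level: only the part of `f` above `c` contributes to the set where its
maximal function exceeds `2 c`. -/
theorem mul_measure_two_mul_lt_intervalMax_le (μ : Measure ℝ) {f : ℝ → ℝ≥0∞}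
    (hf : AEMeasurable f μ) (c : ℝ≥0∞) :
    c * μ {t | 2 * c < intervalMax μ f t} ≤ 2 * ∫⁻ x in {x | c < f x}, f x ∂μ := by
  have hm : NullMeasurableSet {x | c < f x} μ := nullMeasurableSet_lt aemeasurable_const hf
  rw [← lintegral_indicator₀ hm]
  refine le_trans ?_ (mul_measure_lt_intervalMax_le μ (hf.indicator₀ hm) c)
  refine mul_le_mul_right (measure_mono fun t (h : 2 * c < _) => ?_) _
  by_contra h₀
  have h' : intervalMax μ ({x | c < f x}.indicator f) t ≤ c := not_lt.1 h₀
  refine absurd h (not_lt.2 ?_)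
  refine iSup_le fun a => iSup_le fun b => iSup_le fun ha => iSup_le fun hb => ?_
  have h1 : ∫⁻ x in Ioo a b, f x ∂μ ≤
      (∫⁻ x in Ioo a b, {x | c < f x}.indicator f x ∂μ) + c * μ (Ioo a b) := by
    rw [← setLIntegral_const, ← lintegral_add_right _ measurable_const]
    refine lintegral_mono fun x => ?_
    by_cases hx : c < f x
    · simp [indicator, hx]
    · simpa [indicator, hx] using not_lt.1 hx
  calc (∫⁻ x in Ioo a b, f x ∂μ) / μ (Ioo a b)
      ≤ ((∫⁻ x in Ioo a b, {x | c < f x}.indicator f x ∂μ) + c * μ (Ioo a b)) / μ (Ioo a b) := by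
        gcongr
    _ = (∫⁻ x in Ioo a b, {x | c < f x}.indicator f x ∂μ) / μ (Ioo a b) +
        c * μ (Ioo a b) / μ (Ioo a b) := ENNReal.add_div
    _ ≤ c + c := by
        gcongr
        · exact (average_le_intervalMax μ _ ⟨ha, hb⟩).trans h'
        · rw [mul_div_assoc]
          exact mul_le_of_le_one_right' ENNReal.div_self_le_one
    _ = 2 * c := (two_mul c).symm

/-- The layer cake formula for functions with values in `[0, ∞]`, as an upper bound. -/
theorem lintegral_rpow_le_layercake {α : Type*} [MeasurableSpace α] (μ : Measure α)
    {f : α → ℝ≥0∞} (hf : AEMeasurable f μ) {p : ℝ} (hp : 0 < p) :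
    ∫⁻ x, f x ^ p ∂μ ≤
      ENNReal.ofReal p * ∫⁻ t in Ioi (0 : ℝ), μ {x | ENNReal.ofReal t < f x} *
        ENNReal.ofReal (t ^ (p - 1)) := by
  have hsup : ∀ x, f x ^ p = ⨆ n : ℕ, min (f x) n ^ p := fun x => by
    have hmono : Monotone fun n : ℕ => min (f x) (n : ℝ≥0∞) := fun m n h => by
      dsimp only; gcongr
    have h1 : Tendsto (fun n : ℕ => min (f x) (n : ℝ≥0∞) ^ p) atTop (𝓝 (f x ^ p)) := by
      refine (ENNReal.continuous_rpow_const.tendsto _).comp ?_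
      simpa using tendsto_const_nhds.min ENNReal.tendsto_nat_nhds_top
    exact tendsto_nhds_unique h1 (tendsto_atTop_iSup fun m n h =>
      ENNReal.rpow_le_rpow (hmono h) hp.le)
  simp only [hsup]
  rw [lintegral_iSup' (fun n => (hf.min aemeasurable_const).pow_const p)
    (.of_forall fun x m n h => by dsimp only; gcongr)]
  refine iSup_le fun n => ?_
  have hne : ∀ x, min (f x) (n : ℝ≥0∞) ≠ ∞ := fun x =>
    ((min_le_right _ _).trans_lt (ENNReal.natCast_lt_top n)).ne
  have key := lintegral_rpow_eq_lintegral_meas_lt_mul μ (f := fun x => (min (f x) n).toReal)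
    (.of_forall fun x => ENNReal.toReal_nonneg) (hf.min aemeasurable_const).ennreal_toReal hp
  have e : ∀ x, ENNReal.ofReal ((min (f x) (n : ℝ≥0∞)).toReal ^ p) = min (f x) n ^ p := fun x => by
    rw [← ENNReal.ofReal_rpow_of_nonneg ENNReal.toReal_nonneg hp.le, ENNReal.ofReal_toReal (hne x)]
  simp only [e] at key
  rw [key]
  refine mul_le_mul' le_rfl (setLIntegral_mono' measurableSet_Ioi fun t ht => ?_)
  refine mul_le_mul' ?_ le_rfl
  refine measure_mono fun x (h : t < _) => ?_
  have ht' : (0 : ℝ) ≤ t := (mem_Ioi.1 ht).le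
  exact ((ENNReal.ofReal_lt_iff_lt_toReal ht' (hne x)).2 h).trans_le (min_le_left _ _)

/-- Marcinkiewicz interpolation between the weak type `(1, 1)` and the trivial `L^∞` bound: the
layer cake formula is used for the maximal function, and then, backwards, for `f` with respect to
the measure `f μ`. -/
theorem lintegral_intervalMax_rpow_le_of_measurable (μ : Measure ℝ) {f : ℝ → ℝ≥0∞}
    (hf : Measurable f) {p : ℝ} (hp : 1 < p) (hfin : ∫⁻ x, f x ^ p ∂μ ≠ ∞) :
    ∫⁻ t, intervalMax μ f t ^ p ∂μ ≤
      2 ^ p * (2 * ENNReal.ofReal p / ENNReal.ofReal (p - 1)) * ∫⁻ x, f x ^ p ∂μ := by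
  have hp0 : 0 < p := by linarith
  have hp1 : 0 < p - 1 := by linarith
  have hf_top : ∀ᵐ x ∂μ, f x < ∞ := by
    filter_upwards [ae_lt_top' (hf.aemeasurable.pow_const p) hfin] with x hx
    by_contra! h
    simp [top_le_iff.1 h, hp0] at hx
  set ν := μ.withDensity f
  have hν : ∀ᵐ x ∂ν, f x < ∞ := (withDensity_absolutelyContinuous μ f) hf_top
  have hlayer : ENNReal.ofReal (p - 1) * ∫⁻ t in Ioi (0 : ℝ), ν {x | ENNReal.ofReal t < f x} *
      ENNReal.ofReal (t ^ (p - 1 - 1)) = ∫⁻ x, f x ^ p ∂μ := by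
    have key := lintegral_rpow_eq_lintegral_meas_lt_mul ν (f := fun x => (f x).toReal)
      (.of_forall fun x => ENNReal.toReal_nonneg) hf.ennreal_toReal.aemeasurable hp1
    have e1 : ∫⁻ x, ENNReal.ofReal ((f x).toReal ^ (p - 1)) ∂ν = ∫⁻ x, f x ^ p ∂μ := by
      have : ∫⁻ x, ENNReal.ofReal ((f x).toReal ^ (p - 1)) ∂ν = ∫⁻ x, f x ^ (p - 1) ∂ν := by
        refine lintegral_congr_ae ?_
        filter_upwards [hν] with x hx
        rw [← ENNReal.ofReal_rpow_of_nonneg ENNReal.toReal_nonneg hp1.le,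
          ENNReal.ofReal_toReal hx.ne]
      rw [this, lintegral_withDensity_eq_lintegral_mul _ hf (hf.pow_const _)]
      refine lintegral_congr_ae ?_
      filter_upwards [hf_top] with x hx
      rcases eq_or_ne (f x) 0 with h0 | h0
      · simp [h0, hp0]
      · rw [Pi.mul_apply]
        nth_rewrite 1 [← ENNReal.rpow_one (f x)]
        rw [← ENNReal.rpow_add _ _ h0 hx.ne]
        ring_nf
    rw [← e1, key]
    congr 1
    refine setLIntegral_congr_fun measurableSet_Ioi fun t ht => ?_
    congr 1
    refine measure_congr ?_
    filter_upwards [hν] with x hx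
    exact propext (ENNReal.ofReal_lt_iff_lt_toReal (mem_Ioi.1 ht).le hx.ne)
  have hcake := lintegral_rpow_le_layercake μ (f := fun t => 2⁻¹ * intervalMax μ f t)
    ((measurable_intervalMax μ f).const_mul _).aemeasurable hp0
  have e2 : ∫⁻ t, (2⁻¹ * intervalMax μ f t) ^ p ∂μ =
      (2 ^ p)⁻¹ * ∫⁻ t, intervalMax μ f t ^ p ∂μ := by
    simp only [ENNReal.mul_rpow_of_nonneg _ _ hp0.le, ENNReal.inv_rpow]
    exact lintegral_const_mul' _ _ (by simp)
  have h2p : (2 : ℝ≥0∞) ^ p ≠ 0 ∧ (2 : ℝ≥0∞) ^ p ≠ ∞ := by simp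
  have hmain : (2 ^ p)⁻¹ * ∫⁻ t, intervalMax μ f t ^ p ∂μ ≤
      ENNReal.ofReal p * (2 * ∫⁻ t in Ioi (0 : ℝ), ν {x | ENNReal.ofReal t < f x} *
        ENNReal.ofReal (t ^ (p - 1 - 1))) := by
    rw [← e2]
    refine hcake.trans ?_
    rw [← lintegral_const_mul' 2 _ (by simp)]
    refine mul_le_mul' le_rfl (setLIntegral_mono' measurableSet_Ioi fun t ht => ?_)
    have ht' : 0 < t := ht
    have e3 : t ^ (p - 1) = t * t ^ (p - 1 - 1) := by
      rw [← Real.rpow_one_add' ht'.le (by ring_nf; linarith)]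
      ring_nf
    have e4 : {x | ENNReal.ofReal t < 2⁻¹ * intervalMax μ f x} =
        {x | 2 * ENNReal.ofReal t < intervalMax μ f x} := by
      ext x
      simp only [mem_ofPred_eq]
      rw [mul_comm 2⁻¹, ← div_eq_mul_inv, ENNReal.lt_div_iff_mul_lt (by simp) (by simp), mul_comm]
    rw [e3, ENNReal.ofReal_mul ht'.le, e4, ← mul_assoc, ← mul_assoc, mul_comm (μ _)]
    refine mul_le_mul' ?_ le_rfl
    refine (mul_measure_two_mul_lt_intervalMax_le μ hf.aemeasurable _).trans ?_
    rw [withDensity_apply _ (measurableSet_lt measurable_const hf)]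
  have hp1' : ENNReal.ofReal (p - 1) ≠ 0 := (ENNReal.ofReal_pos.2 hp1).ne'
  calc ∫⁻ t, intervalMax μ f t ^ p ∂μ
      = 2 ^ p * ((2 ^ p)⁻¹ * ∫⁻ t, intervalMax μ f t ^ p ∂μ) := by
        rw [← mul_assoc, ENNReal.mul_inv_cancel h2p.1 h2p.2, one_mul]
    _ ≤ 2 ^ p * (ENNReal.ofReal p * (2 * ∫⁻ t in Ioi (0 : ℝ), ν {x | ENNReal.ofReal t < f x} *
        ENNReal.ofReal (t ^ (p - 1 - 1)))) := by gcongr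
    _ = 2 ^ p * (2 * ENNReal.ofReal p / ENNReal.ofReal (p - 1)) * ∫⁻ x, f x ^ p ∂μ := by
        rw [← hlayer, div_eq_mul_inv]
        calc _ = 2 ^ p * (2 * ENNReal.ofReal p) * (((ENNReal.ofReal (p - 1))⁻¹ *
              ENNReal.ofReal (p - 1)) * ∫⁻ t in Ioi (0 : ℝ), ν {x | ENNReal.ofReal t < f x} *
                ENNReal.ofReal (t ^ (p - 1 - 1))) := by
              rw [ENNReal.inv_mul_cancel hp1' (by simp)]; ring
          _ = _ := by ring

/-- The constant in the `L^p`-bound for maximal functions; it does not depend on the measure. -/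
def maxConst (p : ℝ) : ℝ≥0∞ := 2 ^ p * (2 * ENNReal.ofReal p / ENNReal.ofReal (p - 1))

theorem maxConst_lt_top {p : ℝ} (hp : 1 < p) : maxConst p < ∞ := by
  have : 0 < p - 1 := by linarith
  unfold maxConst
  refine ENNReal.mul_lt_top (ENNReal.rpow_lt_top_of_nonneg (by linarith) (by simp))
    (ENNReal.div_lt_top (ENNReal.mul_ne_top (by simp) (by simp)) (ENNReal.ofReal_pos.2 this).ne')

/-- The maximal operator of any measure `μ` on the line is bounded on `L^p(μ)`. -/
theorem lintegral_intervalMax_rpow_le (μ : Measure ℝ) {f : ℝ → ℝ≥0∞}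
    (hf : AEMeasurable f μ) {p : ℝ} (hp : 1 < p) :
    ∫⁻ t, intervalMax μ f t ^ p ∂μ ≤ maxConst p * ∫⁻ x, f x ^ p ∂μ := by
  rcases eq_or_ne (∫⁻ x, f x ^ p ∂μ) ∞ with h | h
  · rw [h, ENNReal.mul_top]
    · exact le_top
    · have : 0 < p - 1 := by linarith
      have : 0 < p := by linarith
      simp [maxConst, ENNReal.div_eq_zero_iff, *]
  · have e : ∫⁻ x, f x ^ p ∂μ = ∫⁻ x, hf.mk f x ^ p ∂μ :=
      lintegral_congr_ae (hf.ae_eq_mk.mono fun x hx => by dsimp only; rw [hx])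
    rw [e] at h ⊢
    refine le_trans ?_ (lintegral_intervalMax_rpow_le_of_measurable μ hf.measurable_mk hp h)
    refine lintegral_mono fun t => ENNReal.rpow_le_rpow ?_ (by linarith)
    exact intervalMax_mono_ae hf.ae_eq_mk.le t

/-! ### Muckenhoupt weights -/

/-- The weight `σ = w^{-1/(p-1)}` dual to `w`. -/
def dualWeight (p : ℝ) (w : ℝ → ℝ≥0∞) (t : ℝ) : ℝ≥0∞ := w t ^ (-(1 / (p - 1)))

theorem one_div_sub_one_eq {p q : ℝ} (hpq : p.HolderConjugate q) : 1 / (p - 1) = q - 1 := by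
  rw [div_eq_iff hpq.sub_one_pos.ne']
  have := hpq.mul_eq_add
  linarith

theorem dualWeight_dualWeight {p q : ℝ} (hpq : p.HolderConjugate q) (w : ℝ → ℝ≥0∞) :
    dualWeight q (dualWeight p w) = w := by
  funext t
  have h := hpq.sub_one_pos.ne'
  rw [dualWeight, dualWeight, ← ENNReal.rpow_mul, one_div_sub_one_eq hpq.symm, neg_mul_neg,
    one_div_mul_cancel h, ENNReal.rpow_one]

theorem average_mul_average_le_apConst (p : ℝ) (w : ℝ → ℝ≥0∞) {a b : ℝ} (h : a < b) :
    ((∫⁻ t in Ioo a b, w t) / ENNReal.ofReal (b - a)) *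
      ((∫⁻ t in Ioo a b, dualWeight p w t) / ENNReal.ofReal (b - a)) ^ (p - 1) ≤ apConst p w :=
  le_iSup_of_le a (le_iSup_of_le b (le_iSup_of_le h le_rfl))

theorem apConst_dualWeight_le {p q : ℝ} (hpq : p.HolderConjugate q) (w : ℝ → ℝ≥0∞) :
    apConst q (dualWeight p w) ≤ apConst p w ^ (q - 1) := by
  refine iSup_le fun a => iSup_le fun b => iSup_le fun hab => ?_
  have h1 : (p - 1) * (q - 1) = 1 := by
    rw [← one_div_sub_one_eq hpq, mul_one_div_cancel hpq.sub_one_pos.ne']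
  have h2 := ENNReal.rpow_le_rpow (average_mul_average_le_apConst p w hab)
    hpq.symm.sub_one_pos.le
  rw [ENNReal.mul_rpow_of_nonneg _ _ hpq.symm.sub_one_pos.le, ← ENNReal.rpow_mul, h1,
    ENNReal.rpow_one] at h2
  refine le_trans (le_of_eq ?_) h2
  rw [mul_comm]
  congr 4
  exact funext fun t => congrFun (dualWeight_dualWeight hpq w) t

theorem lintegral_Ioo_ne_zero {w : ℝ → ℝ≥0∞} (hw : AEMeasurable w volume)
    (h : ∀ᵐ t ∂volume, 0 < w t) {a b : ℝ} (hab : a < b) : ∫⁻ t in Ioo a b, w t ≠ 0 := by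
  intro h0
  rw [lintegral_eq_zero_iff' hw.restrict] at h0
  have h1 : ∀ᵐ t ∂volume.restrict (Ioo a b), False := by
    filter_upwards [h0, ae_restrict_of_ae h] with t h1 h2
    exact h2.ne' h1
  rw [eventually_false_iff_eq_bot, ae_eq_bot, Measure.restrict_eq_zero, Real.volume_Ioo] at h1
  simp only [ENNReal.ofReal_eq_zero, tsub_le_iff_right, zero_add] at h1
  exact absurd hab h1.not_gt

namespace IsMuckenhoupt

variable {p q : ℝ} {w : ℝ → ℝ≥0∞}

theorem aemeasurable_dualWeight (hw : IsMuckenhoupt p w) : AEMeasurable (dualWeight p w) volume :=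
  hw.1.pow_const _

theorem dualWeight_pos (hw : IsMuckenhoupt p w) :
    ∀ᵐ t ∂volume, 0 < dualWeight p w t ∧ dualWeight p w t < ∞ := by
  filter_upwards [hw.2.1] with t ht
  exact ⟨ENNReal.rpow_pos ht.1 ht.2.ne,
    (ENNReal.rpow_ne_top_of_ne_zero ht.1.ne' ht.2.ne).lt_top⟩

theorem dualWeight (hpq : p.HolderConjugate q) (hw : IsMuckenhoupt p w) :
    IsMuckenhoupt q (dualWeight p w) :=
  ⟨hw.aemeasurable_dualWeight, hw.dualWeight_pos, (apConst_dualWeight_le hpq w).trans_lt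
    (ENNReal.rpow_lt_top_of_nonneg hpq.symm.sub_one_pos.le hw.2.2.ne)⟩

theorem setLIntegral_ne_zero (hw : IsMuckenhoupt p w) {a b : ℝ} (hab : a < b) :
    ∫⁻ t in Ioo a b, w t ≠ 0 :=
  lintegral_Ioo_ne_zero hw.1 (hw.2.1.mono fun _ h => h.1) hab

theorem setLIntegral_ne_top (hp : 1 < p) (hw : IsMuckenhoupt p w) {a b : ℝ} (hab : a < b) :
    ∫⁻ t in Ioo a b, w t ≠ ∞ := by
  intro h
  have h0 : ENNReal.ofReal (b - a) ≠ 0 := (ENNReal.ofReal_pos.2 (by linarith)).ne'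
  have h1 := (average_mul_average_le_apConst p w hab).trans_lt hw.2.2
  rw [h, ENNReal.top_div_of_ne_top (by simp), ENNReal.top_mul] at h1
  · exact lt_irrefl _ h1
  · have := lintegral_Ioo_ne_zero hw.aemeasurable_dualWeight
      (hw.dualWeight_pos.mono fun _ h => h.1) hab
    have hp : ¬ p - 1 < 0 := by linarith
    simp [ENNReal.div_eq_zero_iff, this, hp]

theorem isLocallyFinite (hp : 1 < p) (hw : IsMuckenhoupt p w) :
    IsLocallyFiniteMeasure (volume.withDensity w) := by
  refine ⟨fun x => ⟨Ioo (x - 1) (x + 1), Ioo_mem_nhds (by linarith) (by linarith), ?_⟩⟩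
  rw [withDensity_apply _ measurableSet_Ioo]
  exact (hw.setLIntegral_ne_top hp (by linarith)).lt_top

end IsMuckenhoupt

theorem setLIntegral_withDensity {w f : ℝ → ℝ≥0∞} (hw : AEMeasurable w volume)
    (hf : AEMeasurable f volume) (s : Set ℝ) (hs : MeasurableSet s) :
    ∫⁻ x in s, f x ∂(volume.withDensity w) = ∫⁻ x in s, f x * w x := by
  rw [restrict_withDensity hs, lintegral_withDensity_eq_lintegral_mul₀ hw.restrict hf.restrict]
  simp only [Pi.mul_apply, mul_comm]

theorem lintegral_withDensity_eq {w f : ℝ → ℝ≥0∞} (hw : AEMeasurable w volume)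
    (hf : AEMeasurable f volume) :
    ∫⁻ x, f x ∂(volume.withDensity w) = ∫⁻ x, f x * w x := by
  rw [lintegral_withDensity_eq_lintegral_mul₀ hw hf]
  simp only [Pi.mul_apply, mul_comm]

/-- Lerner's pointwise bound: for an `A_p` weight the maximal operator is controlled by the maximal
operators of the measures `σ dt` and `w dt`, one after the other. -/
theorem maximalFn_le_iterate {p : ℝ} (hp : 1 < p) {w : ℝ → ℝ≥0∞} (hw : IsMuckenhoupt p w)
    {f : ℝ → ℝ≥0∞} (hf : AEMeasurable f volume) (t : ℝ) :
    maximalFn f t ≤ (apConst p w * intervalMax (volume.withDensity w) (fun x =>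
      intervalMax (volume.withDensity (dualWeight p w)) (fun y => f y / dualWeight p w y) x
        ^ (p - 1) / w x) t) ^ (1 / (p - 1)) := by
  have hp1 : 0 < p - 1 := by linarith
  refine iSup_le fun a => iSup_le fun b => iSup_le fun ha => iSup_le fun hb => ?_
  rw [one_div, ENNReal.le_rpow_inv_iff hp1]
  set σ := dualWeight p w
  set N := intervalMax (volume.withDensity σ) fun y => f y / σ y
  have hab : a < b := ha.trans hb
  set L := ENNReal.ofReal (b - a)
  have hL0 : L ≠ 0 := (ENNReal.ofReal_pos.2 (by linarith)).ne'
  have hLt : L ≠ ∞ := by simp [L]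
  have hσm : AEMeasurable σ volume := hw.aemeasurable_dualWeight
  set W := ∫⁻ t in Ioo a b, w t
  set S := ∫⁻ t in Ioo a b, σ t
  have hW0 : W ≠ 0 := hw.setLIntegral_ne_zero hab
  have hWt : W ≠ ∞ := hw.setLIntegral_ne_top hp hab
  have hpq := Real.HolderConjugate.conjExponent hp
  have hσ := hw.dualWeight hpq
  have hS0 : S ≠ 0 := hσ.setLIntegral_ne_zero hab
  have hSt : S ≠ ∞ := hσ.setLIntegral_ne_top hpq.symm.lt hab
  have hNm : Measurable N := measurable_intervalMax _ _
  set m := (∫⁻ x in Ioo a b, f x) / S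
  have hm : ∀ x ∈ Ioo a b, m ≤ N x := fun x hx => by
    have := average_le_intervalMax (volume.withDensity σ) (fun y => f y / σ y) hx
    rw [setLIntegral_withDensity (f := fun y => f y / σ y) hσm (hf.div hσm) _ measurableSet_Ioo,
      withDensity_apply _ measurableSet_Ioo] at this
    convert! this using 2
    refine lintegral_congr_ae (ae_restrict_of_ae ?_)
    filter_upwards [hw.dualWeight_pos] with y hy
    exact (ENNReal.div_mul_cancel hy.1.ne' hy.2.ne).symm
  have h1 : (∫⁻ x in Ioo a b, f x) / L = m * (S / L) := by
    rw [← mul_div_assoc, ENNReal.div_mul_cancel hS0 hSt]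
  have h2 : (S / L) ^ (p - 1) ≤ apConst p w * L / W := by
    rw [ENNReal.le_div_iff_mul_le (.inl hW0) (.inl hWt)]
    have := average_mul_average_le_apConst p w hab
    calc (S / L) ^ (p - 1) * W = W / L * (S / L) ^ (p - 1) * L := by
          rw [mul_right_comm, ENNReal.div_mul_cancel hL0 hLt, mul_comm]
      _ ≤ apConst p w * L := by gcongr
  have h3 : m ^ (p - 1) * L ≤ ∫⁻ x in Ioo a b, N x ^ (p - 1) := by
    rw [← show volume (Ioo a b) = L from Real.volume_Ioo, ← setLIntegral_const]
    exact setLIntegral_mono' measurableSet_Ioo fun x hx => ENNReal.rpow_le_rpow (hm x hx) hp1.le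
  have h4 := average_le_intervalMax (volume.withDensity w) (fun x => N x ^ (p - 1) / w x)
    (show t ∈ Ioo a b from ⟨ha, hb⟩)
  rw [setLIntegral_withDensity (f := fun x => N x ^ (p - 1) / w x) hw.1
    ((hNm.pow_const _).aemeasurable.div hw.1) _ measurableSet_Ioo,
    withDensity_apply _ measurableSet_Ioo] at h4
  have h5 : ∫⁻ x in Ioo a b, N x ^ (p - 1) / w x * w x = ∫⁻ x in Ioo a b, N x ^ (p - 1) := by
    refine lintegral_congr_ae (ae_restrict_of_ae ?_)
    filter_upwards [hw.2.1] with y hy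
    exact ENNReal.div_mul_cancel hy.1.ne' hy.2.ne
  rw [h5] at h4
  calc ((∫⁻ x in Ioo a b, f x) / L) ^ (p - 1)
      = m ^ (p - 1) * (S / L) ^ (p - 1) := by rw [h1, ENNReal.mul_rpow_of_nonneg _ _ hp1.le]
    _ ≤ m ^ (p - 1) * (apConst p w * L / W) := by gcongr
    _ = apConst p w * ((m ^ (p - 1) * L) / W) := by simp only [div_eq_mul_inv]; ring
    _ ≤ apConst p w * ((∫⁻ x in Ioo a b, N x ^ (p - 1)) / W) := by gcongr
    _ ≤ _ := by gcongr

/-- The constant in Muckenhoupt's theorem for weights with `[w]_{A_p} ≤ K`. -/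
def muckenhouptConst (p : ℝ) (K : ℝ≥0∞) : ℝ≥0∞ :=
  (K ^ p.conjExponent * maxConst p.conjExponent * maxConst p) ^ (1 / p)

theorem muckenhouptConst_lt_top {p : ℝ} (hp : 1 < p) {K : ℝ≥0∞} (hK : K ≠ ∞) :
    muckenhouptConst p K < ∞ := by
  have hpq := Real.HolderConjugate.conjExponent hp
  refine ENNReal.rpow_lt_top_of_nonneg (by positivity)
    (ENNReal.mul_lt_top (ENNReal.mul_lt_top ?_ ?_) ?_).ne
  · exact ENNReal.rpow_lt_top_of_nonneg hpq.symm.nonneg hK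
  · exact maxConst_lt_top hpq.symm.lt
  · exact maxConst_lt_top hp

/-- **Muckenhoupt's theorem**: the maximal operator is bounded on `L^p_w`, uniformly over weights
with bounded `A_p`-constant. -/
theorem weightedNorm_maximalFn_le {p : ℝ} (hp : 1 < p) {w : ℝ → ℝ≥0∞} (hw : IsMuckenhoupt p w)
    {K : ℝ≥0∞} (hKt : K ≠ ∞) (hK : apConst p w ≤ K) {f : ℝ → ℝ≥0∞} (hf : AEMeasurable f volume) :
    weightedNorm p w (maximalFn f) ≤ muckenhouptConst p K * weightedNorm p w f := by
  have hp1 : 0 < p - 1 := by linarith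
  have hp0 : 0 < p := by linarith
  have hpq := Real.HolderConjugate.conjExponent hp
  set q := p.conjExponent with hq
  have hq0 : 0 < q := hpq.symm.pos
  have hpq' : (p - 1) * q = p := hpq.sub_one_mul_conj
  have hσm : AEMeasurable (dualWeight p w) volume := hw.aemeasurable_dualWeight
  set σ := dualWeight p w with hσ
  set N := intervalMax (volume.withDensity σ) fun y => f y / σ y with hN
  set N' := intervalMax (volume.withDensity w) fun x => N x ^ (p - 1) / w x with hN'
  have hNm : Measurable N := measurable_intervalMax _ _
  have hN'm : Measurable N' := measurable_intervalMax _ _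
  have step1 : ∫⁻ t, maximalFn f t ^ p * w t ≤ K ^ q * ∫⁻ t, N' t ^ q * w t := by
    rw [← lintegral_const_mul' _ _ (ENNReal.rpow_ne_top_of_nonneg hq0.le hKt)]
    refine lintegral_mono fun t => ?_
    rw [← mul_assoc]
    gcongr
    calc maximalFn f t ^ p ≤ ((apConst p w * N' t) ^ (1 / (p - 1))) ^ p := by
          gcongr; exact maximalFn_le_iterate hp hw hf t
      _ = (apConst p w * N' t) ^ q := by
          rw [← ENNReal.rpow_mul, show 1 / (p - 1) * p = q by
            rw [div_mul_eq_mul_div, one_mul, div_eq_iff hp1.ne', mul_comm, hpq']]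
      _ ≤ (K * N' t) ^ q := by gcongr
      _ = K ^ q * N' t ^ q := ENNReal.mul_rpow_of_nonneg _ _ hq0.le
  have step2 : ∫⁻ t, N' t ^ q * w t ≤ maxConst q * ∫⁻ t, N t ^ p * σ t := by
    have hm : AEMeasurable (fun x => N x ^ (p - 1) / w x) volume :=
      (hNm.pow_const _).aemeasurable.div hw.1
    have := lintegral_intervalMax_rpow_le (volume.withDensity w)
      (hm.mono_ac (withDensity_absolutelyContinuous _ _)) hpq.symm.lt
    rw [lintegral_withDensity_eq hw.1 (hN'm.pow_const _).aemeasurable,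
      lintegral_withDensity_eq hw.1 (hm.pow_const _)] at this
    refine this.trans (le_of_eq ?_)
    congr 1
    refine lintegral_congr_ae ?_
    filter_upwards [hw.2.1] with t ht
    rw [ENNReal.div_rpow_of_nonneg _ _ hq0.le, ← ENNReal.rpow_mul, hpq', div_eq_mul_inv, mul_assoc,
      hσ, dualWeight]
    congr 1
    rw [← ENNReal.rpow_neg]
    nth_rewrite 2 [← ENNReal.rpow_one (w t)]
    rw [← ENNReal.rpow_add _ _ ht.1.ne' ht.2.ne, one_div_sub_one_eq hpq]
    ring_nf
  have step3 : ∫⁻ t, N t ^ p * σ t ≤ maxConst p * ∫⁻ t, f t ^ p * w t := by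
    have hm : AEMeasurable (fun x => f x / σ x) volume := hf.div hσm
    have := lintegral_intervalMax_rpow_le (volume.withDensity σ)
      (hm.mono_ac (withDensity_absolutelyContinuous _ _)) hp
    rw [lintegral_withDensity_eq hσm (hNm.pow_const _).aemeasurable,
      lintegral_withDensity_eq hσm (hm.pow_const _)] at this
    refine this.trans (le_of_eq ?_)
    congr 1
    refine lintegral_congr_ae ?_
    filter_upwards [hw.2.1, hw.dualWeight_pos] with t ht ht'
    rw [ENNReal.div_rpow_of_nonneg _ _ hp0.le, div_eq_mul_inv, mul_assoc]
    congr 1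
    rw [← ENNReal.rpow_neg]
    change σ t ^ (-p) * σ t = w t
    nth_rewrite 2 [← ENNReal.rpow_one (σ t)]
    rw [← ENNReal.rpow_add _ _ ht'.1.ne' ht'.2.ne]
    rw [dualWeight, ← ENNReal.rpow_mul]
    convert! ENNReal.rpow_one _ using 2
    field_simp
    ring
  unfold weightedNorm muckenhouptConst
  rw [← ENNReal.mul_rpow_of_nonneg _ _ (by positivity)]
  gcongr
  calc ∫⁻ t, maximalFn f t ^ p * w t ≤ K ^ q * (maxConst q * (maxConst p * ∫⁻ t, f t ^ p * w t)) :=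
        step1.trans (by gcongr; exact step2.trans (by gcongr))
    _ = _ := by ring

/-! ### Norms of Banach function spaces -/

/-- The maximal operator has norm at most `A` with respect to `ρ`. -/
def MaximalBoundedWith (ρ : (ℝ → ℝ≥0∞) → ℝ≥0∞) (A : ℝ≥0) : Prop :=
  ∀ f : ℝ → ℝ≥0∞, AEMeasurable f volume → ρ f < ∞ → ρ (maximalFn f) ≤ A * ρ f

theorem MaximalBoundedWith.mono {ρ : (ℝ → ℝ≥0∞) → ℝ≥0∞} {A B : ℝ≥0} (h : MaximalBoundedWith ρ A)
    (hAB : A ≤ B) : MaximalBoundedWith ρ B := fun f hf hρ => (h f hf hρ).trans (by gcongr)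

namespace BanachFunctionSpace

variable (Φ : BanachFunctionSpace)

theorem norm_congr_ae {f g : ℝ → ℝ≥0∞} (hf : AEMeasurable f volume) (h : f =ᵐ[volume] g) :
    Φ.norm f = Φ.norm g :=
  le_antisymm (Φ.norm_mono _ _ hf (hf.congr h) h.le) (Φ.norm_mono _ _ (hf.congr h) hf h.symm.le)

theorem norm_zero : Φ.norm (fun _ => 0) = 0 :=
  (Φ.norm_eq_zero_iff _ aemeasurable_const).2 EventuallyEq.rfl

theorem norm_finsetSum_le {ι : Type*} (s : Finset ι) {f : ι → ℝ → ℝ≥0∞}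
    (hf : ∀ i, AEMeasurable (f i) volume) :
    Φ.norm (fun t => ∑ i ∈ s, f i t) ≤ ∑ i ∈ s, Φ.norm (f i) := by
  classical
  induction s using Finset.induction_on with
  | empty => simp [Φ.norm_zero]
  | insert a s ha ih =>
    simp only [Finset.sum_insert ha]
    refine (Φ.norm_add_le _ _ (hf a) (Finset.aemeasurable_fun_sum s fun i _ => hf i)).trans ?_
    gcongr

theorem norm_tsum_le {f : ℕ → ℝ → ℝ≥0∞} (hf : ∀ n, AEMeasurable (f n) volume) :
    Φ.norm (fun t => ∑' n, f n t) ≤ ∑' n, Φ.norm (f n) := by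
  simp only [ENNReal.tsum_eq_iSup_nat]
  rw [Φ.norm_iSup (fun n t => ∑ i ∈ Finset.range n, f i t)
    (fun n => Finset.aemeasurable_fun_sum _ fun i _ => hf i)
    (fun m n h t => Finset.sum_le_sum_of_subset (Finset.range_mono h))]
  exact iSup_mono fun n => Φ.norm_finsetSum_le _ hf

theorem dualNorm_mono_ae {f g : ℝ → ℝ≥0∞} (h : f ≤ᵐ[volume] g) : Φ.dualNorm f ≤ Φ.dualNorm g := by
  refine iSup_mono fun k => iSup₂_mono fun _ _ => lintegral_mono_ae ?_
  filter_upwards [h] with t ht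
  gcongr

theorem dualNorm_const_mul {c : ℝ≥0∞} (hc : c ≠ ∞) (f : ℝ → ℝ≥0∞) :
    Φ.dualNorm (fun t => c * f t) = c * Φ.dualNorm f := by
  simp only [dualNorm, ENNReal.mul_iSup, mul_left_comm _ c, lintegral_const_mul' _ _ hc]

theorem dualNorm_tsum_le {f : ℕ → ℝ → ℝ≥0∞} (hf : ∀ n, AEMeasurable (f n) volume) :
    Φ.dualNorm (fun t => ∑' n, f n t) ≤ ∑' n, Φ.dualNorm (f n) := by
  refine iSup_le fun k => iSup₂_le fun hk hk1 => ?_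
  simp only [← ENNReal.tsum_mul_left]
  rw [lintegral_tsum (f := fun n t => k t * f n t) fun n => hk.mul (hf n)]
  exact ENNReal.tsum_le_tsum fun n => le_iSup_of_le k (le_iSup₂_of_le hk hk1 le_rfl)

/-- Hölder's inequality for `Φ` and its Köthe dual. -/
theorem lintegral_mul_le {f h : ℝ → ℝ≥0∞} (hf : AEMeasurable f volume) (hfin : Φ.norm f ≠ ∞) :
    ∫⁻ t, f t * h t ≤ Φ.norm f * Φ.dualNorm h := by
  rcases eq_or_ne (Φ.norm f) 0 with h0 | h0
  · have : ∫⁻ t, f t * h t = ∫⁻ _ : ℝ, 0 := by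
      refine lintegral_congr_ae ?_
      filter_upwards [(Φ.norm_eq_zero_iff f hf).1 h0] with t ht
      simp [ht]
    simp [this]
  · lift Φ.norm f to ℝ≥0 using hfin with a ha
    have ha0 : a ≠ 0 := by simpa using h0
    have h1 : Φ.norm (fun t => (a⁻¹ : ℝ≥0) * f t) ≤ 1 := by
      rw [Φ.norm_const_mul _ _ hf, ← ha, ← ENNReal.coe_mul, inv_mul_cancel₀ ha0]
      simp
    have h2 : ∫⁻ t, (a⁻¹ : ℝ≥0) * f t * h t ≤ Φ.dualNorm h :=
      le_iSup_of_le _ (le_iSup₂_of_le (hf.const_mul _) h1 le_rfl)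
    calc ∫⁻ t, f t * h t = a * ((a⁻¹ : ℝ≥0) * ∫⁻ t, f t * h t) := by
          rw [← mul_assoc, ← ENNReal.coe_mul, mul_inv_cancel₀ ha0]
          simp
      _ = a * ∫⁻ t, (a⁻¹ : ℝ≥0) * f t * h t := by
          simp only [mul_assoc]
          rw [lintegral_const_mul' _ _ (by simp)]
      _ ≤ a * Φ.dualNorm h := by gcongr

end BanachFunctionSpace

/-! ### The function `1 / (1 + |t|)` -/

/-- The function `1 / (1 + |t|)`, the size of the maximal function of a bump. -/
def decayFn (t : ℝ) : ℝ≥0∞ := ENNReal.ofReal (1 + |t|)⁻¹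

theorem measurable_decayFn : Measurable decayFn := by
  unfold decayFn
  fun_prop

theorem decayFn_pos (t : ℝ) : 0 < decayFn t := ENNReal.ofReal_pos.2 (by positivity)

theorem decayFn_lt_top (t : ℝ) : decayFn t < ∞ := ENNReal.ofReal_lt_top

/-- The maximal function of a nonzero function decays no faster than `1 / |t|`. -/
theorem exists_mul_decayFn_le_maximalFn {f : ℝ → ℝ≥0∞} (hf : AEMeasurable f volume)
    (h0 : ¬ f =ᵐ[volume] fun _ => 0) : ∃ c : ℝ≥0, c ≠ 0 ∧ ∀ t, c * decayFn t ≤ maximalFn f t := by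
  obtain ⟨n, hn⟩ : ∃ n : ℕ, ∫⁻ x in Ioo (-(n + 1 : ℝ)) (n + 1), f x ≠ 0 := by
    by_contra! h
    apply h0
    have hU : (⋃ n : ℕ, Ioo (-(n + 1 : ℝ)) (n + 1)) = univ := by
      refine eq_univ_of_forall fun x => mem_iUnion.2 ?_
      obtain ⟨n, hn⟩ := exists_nat_gt |x|
      exact ⟨n, by constructor <;> linarith [abs_lt.1 hn]⟩
    have : f =ᵐ[volume.restrict (⋃ n : ℕ, Ioo (-(n + 1 : ℝ)) (n + 1))] fun _ => 0 := by
      rw [EventuallyEq, ae_restrict_iUnion_iff]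
      exact fun n => (lintegral_eq_zero_iff' hf.restrict).1 (h n)
    rwa [hU, Measure.restrict_univ] at this
  set I := ∫⁻ x in Ioo (-(n + 1 : ℝ)) (n + 1), f x
  have hm : min I 1 ≠ ∞ := ((min_le_right _ _).trans_lt ENNReal.one_lt_top).ne
  set m := (min I 1).toNNReal with hmdef
  have hm0 : m ≠ 0 := by
    rw [hmdef, Ne, ENNReal.toNNReal_eq_zero_iff]
    simp [hm, hn]
  refine ⟨m / (2 * (n + 1)), by positivity, fun t => ?_⟩
  have ht : t ∈ Ioo (-(n + 1 + |t|)) (n + 1 + |t|) := by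
    constructor <;> linarith [neg_abs_le t, le_abs_self t, n.cast_nonneg (α := ℝ)]
  refine le_trans ?_ (average_le_maximalFn f ht)
  have hI : (m : ℝ≥0∞) ≤ ∫⁻ x in Ioo (-(n + 1 + |t|)) (n + 1 + |t|), f x := by
    rw [hmdef, ENNReal.coe_toNNReal hm]
    refine (min_le_left _ _).trans (lintegral_mono_set (Ioo_subset_Ioo ?_ ?_)) <;>
      linarith [abs_nonneg t]
  refine le_trans ?_ (ENNReal.div_le_div_right hI _)
  rw [ENNReal.le_div_iff_mul_le (.inl (ENNReal.ofReal_pos.2 (by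
    linarith [ht.1, ht.2])).ne') (.inl (by simp)), decayFn,
    ← ENNReal.ofReal_coe_nnreal, ← ENNReal.ofReal_coe_nnreal (p := m),
    ← ENNReal.ofReal_mul (by positivity), ← ENNReal.ofReal_mul (by positivity)]
  refine ENNReal.ofReal_le_ofReal ?_
  push_cast
  have h1 : (n : ℝ) + 1 + |t| ≤ (n + 1) * (1 + |t|) := by
    nlinarith [abs_nonneg t, n.cast_nonneg (α := ℝ)]
  have h2 : (0 : ℝ) ≤ m := m.2
  rw [div_mul_eq_mul_div, div_mul_eq_mul_div, div_le_iff₀ (by positivity), ← div_eq_mul_inv,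
    div_mul_eq_mul_div, div_le_iff₀ (by positivity)]
  nlinarith

/-- The truncations `min f (n / (1 + |t|))`, which increase to `f`. -/
def decayTrunc (f : ℝ → ℝ≥0∞) (n : ℕ) (t : ℝ) : ℝ≥0∞ := min (f t) (n * decayFn t)

theorem aemeasurable_decayTrunc {f : ℝ → ℝ≥0∞} (hf : AEMeasurable f volume) (n : ℕ) :
    AEMeasurable (decayTrunc f n) volume :=
  hf.min (measurable_decayFn.const_mul _).aemeasurable

theorem monotone_decayTrunc (f : ℝ → ℝ≥0∞) : Monotone (decayTrunc f) := fun m n hmn t => by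
  unfold decayTrunc
  gcongr

theorem decayTrunc_le (f : ℝ → ℝ≥0∞) (n : ℕ) (t : ℝ) : decayTrunc f n t ≤ f t := min_le_left _ _

theorem decayTrunc_le_mul (f : ℝ → ℝ≥0∞) (n : ℕ) (t : ℝ) : decayTrunc f n t ≤ n * decayFn t :=
  min_le_right _ _

theorem decayTrunc_ne_top (f : ℝ → ℝ≥0∞) (n : ℕ) (t : ℝ) : decayTrunc f n t ≠ ∞ :=
  ((decayTrunc_le_mul f n t).trans_lt (ENNReal.mul_lt_top (by simp) (decayFn_lt_top t))).ne

theorem iSup_decayTrunc (f : ℝ → ℝ≥0∞) (t : ℝ) : ⨆ n, decayTrunc f n t = f t := by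
  have h1 : Tendsto (fun n => decayTrunc f n t) atTop (𝓝 (min (f t) ∞)) := by
    refine tendsto_const_nhds.min ?_
    have := ENNReal.Tendsto.mul_const (b := decayFn t) ENNReal.tendsto_nat_nhds_top
      (.inl ENNReal.top_ne_zero)
    rwa [ENNReal.top_mul (decayFn_pos t).ne'] at this
  rw [min_top_right] at h1
  exact tendsto_nhds_unique (tendsto_atTop_iSup fun m n hmn => monotone_decayTrunc f hmn t) h1

namespace BanachFunctionSpace

variable (Φ : BanachFunctionSpace)

theorem norm_decayFn_lt_top {A : ℝ≥0} (hA : MaximalBoundedWith Φ.norm A) :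
    Φ.norm decayFn < ∞ := by
  obtain ⟨f, hf, hf0, hft⟩ := Φ.nontrivial
  obtain ⟨c, hc, hcf⟩ := exists_mul_decayFn_le_maximalFn hf
    (fun h => hf0 ((Φ.norm_eq_zero_iff f hf).2 h))
  have h1 := Φ.norm_mono _ _ (measurable_decayFn.const_mul (c : ℝ≥0∞)).aemeasurable
    (measurable_maximalFn f).aemeasurable (.of_forall hcf)
  rw [Φ.norm_const_mul _ _ measurable_decayFn.aemeasurable] at h1
  have h2 := (h1.trans (hA f hf hft.lt_top)).trans_lt (ENNReal.mul_lt_top (by simp) hft.lt_top)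
  by_contra! h
  simp [top_le_iff.1 h, hc] at h2

theorem dualNorm_decayFn_lt_top {B : ℝ≥0} (hB : MaximalBoundedWith Φ.dualNorm B)
    {h : ℝ → ℝ≥0∞} (hm : AEMeasurable h volume) (h0 : ¬ h =ᵐ[volume] fun _ => 0)
    (hfin : Φ.dualNorm h < ∞) : Φ.dualNorm decayFn < ∞ := by
  obtain ⟨c, hc, hcf⟩ := exists_mul_decayFn_le_maximalFn hm h0
  have h1 := Φ.dualNorm_mono_ae (.of_forall hcf)
  rw [Φ.dualNorm_const_mul (by simp)] at h1
  have h2 := (h1.trans (hB h hm hfin)).trans_lt (ENNReal.mul_lt_top (by simp) hfin)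
  by_contra! h
  simp [top_le_iff.1 h, hc] at h2

end BanachFunctionSpace

/-! ### Weighted Lebesgue spaces as Banach function spaces -/

theorem weightedNorm_eq {p : ℝ} {w f : ℝ → ℝ≥0∞} (hw : AEMeasurable w volume)
    (hf : AEMeasurable f volume) :
    weightedNorm p w f = (∫⁻ t, f t ^ p ∂(volume.withDensity w)) ^ (1 / p) := by
  rw [lintegral_withDensity_eq hw (hf.pow_const p), weightedNorm]

/-- The space `L^p_w` for a Muckenhoupt weight; its norm is definitionally `weightedNorm p w`. -/
def weightedSpace {p : ℝ} (hp : 1 < p) {w : ℝ → ℝ≥0∞} (hw : IsMuckenhoupt p w) :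
    BanachFunctionSpace where
  norm := weightedNorm p w
  norm_eq_zero_iff f hf := by
    have hp0 : 0 < p := by linarith
    rw [weightedNorm, ENNReal.rpow_eq_zero_iff_of_pos (by positivity),
      lintegral_eq_zero_iff' (f := fun t => f t ^ p * w t) ((hf.pow_const p).mul hw.1)]
    constructor
    · intro h
      filter_upwards [h, hw.2.1] with t h1 h2
      exact (ENNReal.rpow_eq_zero_iff_of_pos hp0).1 ((mul_eq_zero.1 h1).resolve_right h2.1.ne')
    · intro h
      filter_upwards [h] with t h1
      simp [h1, hp0]
  norm_const_mul c f hf := by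
    have hp0 : 0 < p := by linarith
    simp only [weightedNorm, ENNReal.mul_rpow_of_nonneg _ _ hp0.le, mul_assoc]
    rw [lintegral_const_mul' _ _ (ENNReal.rpow_ne_top_of_nonneg hp0.le (by simp)),
      ENNReal.mul_rpow_of_nonneg _ _ (by positivity), ← ENNReal.rpow_mul,
      mul_one_div_cancel hp0.ne', ENNReal.rpow_one]
  norm_add_le f g hf hg := by
    rw [weightedNorm_eq hw.1 hf, weightedNorm_eq hw.1 hg,
      weightedNorm_eq (f := fun t => f t + g t) hw.1 (hf.add hg)]
    exact ENNReal.lintegral_Lp_add_le (hf.mono_ac (withDensity_absolutelyContinuous _ _))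
      (hg.mono_ac (withDensity_absolutelyContinuous _ _)) hp.le
  norm_mono f g _ _ h := by
    have hp0 : 0 < p := by linarith
    unfold weightedNorm
    gcongr ?_ ^ _
    refine lintegral_mono_ae ?_
    filter_upwards [h] with t ht
    gcongr
  norm_iSup f hf hmono := by
    have hp0 : 0 < p := by linarith
    have hsup : ∀ (r : ℝ) (_ : 0 < r) (a : ℕ → ℝ≥0∞), (⨆ n, a n) ^ r = ⨆ n, a n ^ r :=
      fun r hr a => (ENNReal.orderIsoRpow r hr).map_iSup a
    unfold weightedNorm
    rw [← hsup _ (by positivity), ← lintegral_iSup' (f := fun n t => f n t ^ p * w t)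
      (fun n => ((hf n).pow_const p).mul hw.1)
      (.of_forall fun t m n h => by dsimp only; gcongr; exact hmono h t)]
    simp only [hsup p hp0, ENNReal.iSup_mul]
  nontrivial := by
    have hp0 : 0 < p := by linarith
    refine ⟨(Ioo 0 1).indicator 1, aemeasurable_one.indicator measurableSet_Ioo, ?_⟩
    have e : weightedNorm p w ((Ioo 0 1).indicator 1) = (∫⁻ t in Ioo 0 1, w t) ^ (1 / p) := by
      rw [weightedNorm, ← lintegral_indicator measurableSet_Ioo]
      congr 2
      funext t
      by_cases ht : t ∈ Ioo (0 : ℝ) 1 <;> simp [indicator, ht, hp0]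
    rw [e]
    have h1 := hw.setLIntegral_ne_zero zero_lt_one
    have h2 := hw.setLIntegral_ne_top hp zero_lt_one
    exact ⟨by simp [h1, h2], ENNReal.rpow_ne_top_of_nonneg (by positivity) h2⟩

theorem weightedSpace_maximalBounded {p : ℝ} (hp : 1 < p) {w : ℝ → ℝ≥0∞} (hw : IsMuckenhoupt p w)
    {K : ℝ≥0} (hK : apConst p w ≤ K) :
    MaximalBoundedWith (weightedSpace hp hw).norm (muckenhouptConst p K).toNNReal := by
  intro f hf _
  rw [ENNReal.coe_toNNReal (muckenhouptConst_lt_top hp (by simp)).ne]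
  exact weightedNorm_maximalFn_le hp hw (by simp) hK hf

theorem weightedNorm_decayFn_lt_top {p : ℝ} (hp : 1 < p) {w : ℝ → ℝ≥0∞} (hw : IsMuckenhoupt p w) :
    weightedNorm p w decayFn < ∞ := by
  have := hw.2.2
  lift apConst p w to ℝ≥0 using this.ne with K hK
  exact (weightedSpace hp hw).norm_decayFn_lt_top (weightedSpace_maximalBounded hp hw hK.symm.le)

/-- Hölder's inequality for `L^p_w` and `L^{p'}_σ`. -/
theorem lintegral_mul_le_weightedNorm {p q : ℝ} (hpq : p.HolderConjugate q) {w : ℝ → ℝ≥0∞}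
    (hw : IsMuckenhoupt p w) {f h : ℝ → ℝ≥0∞} (hf : AEMeasurable f volume)
    (hh : AEMeasurable h volume) :
    ∫⁻ t, f t * h t ≤ weightedNorm p w f * weightedNorm q (dualWeight p w) h := by
  have hp0 := hpq.pos
  have hq0 := hpq.symm.pos
  have key := ENNReal.lintegral_mul_le_Lp_mul_Lq volume hpq
    (f := fun t => f t * w t ^ (1 / p)) (g := fun t => h t * w t ^ (-(1 / p)))
    (hf.mul (hw.1.pow_const _)) (hh.mul (hw.1.pow_const _))
  refine le_trans (le_of_eq (lintegral_congr_ae ?_)) (key.trans (le_of_eq ?_))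
  · filter_upwards [hw.2.1] with t ht
    have : w t ^ (1 / p) * w t ^ (-(1 / p)) = 1 := by
      rw [← ENNReal.rpow_add _ _ ht.1.ne' ht.2.ne, add_neg_cancel, ENNReal.rpow_zero]
    calc f t * h t = f t * h t * 1 := (mul_one _).symm
      _ = f t * h t * (w t ^ (1 / p) * w t ^ (-(1 / p))) := by rw [this]
      _ = _ := by simp only [Pi.mul_apply]; ring
  · unfold weightedNorm
    congr 3
    · funext t
      rw [ENNReal.mul_rpow_of_nonneg _ _ hp0.le, ← ENNReal.rpow_mul, one_div_mul_cancel hp0.ne',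
        ENNReal.rpow_one]
    · funext t
      rw [ENNReal.mul_rpow_of_nonneg _ _ hq0.le, ← ENNReal.rpow_mul, dualWeight,
        one_div_sub_one_eq hpq]
      congr 2
      have := hpq.mul_eq_add
      field_simp
      linarith

/-- The Köthe dual of `L^p_w` is `L^{p'}_σ`. -/
theorem dualNorm_weightedSpace {p q : ℝ} (hpq : p.HolderConjugate q) {w : ℝ → ℝ≥0∞}
    (hw : IsMuckenhoupt p w) {h : ℝ → ℝ≥0∞} (hh : AEMeasurable h volume) :
    (weightedSpace hpq.lt hw).dualNorm h = weightedNorm q (dualWeight p w) h := by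
  have hp0 := hpq.pos
  have hq0 := hpq.symm.pos
  have hq1 := hpq.symm.sub_one_pos
  refine le_antisymm ?_ ?_
  · refine iSup_le fun f => iSup₂_le fun hf hf1 => ?_
    exact (lintegral_mul_le_weightedNorm hpq hw hf hh).trans (mul_le_of_le_one_left' hf1)
  have hσ := hw.dualWeight hpq
  have hσm := hσ.1
  set σ := dualWeight p w with hσdef
  -- `h` is approximated from below by functions of finite nonzero norm, which are tested against
  -- the extremal functions in Hölder's inequality.
  set F := decayTrunc h with hF
  have hFm : ∀ n, AEMeasurable (F n) volume := aemeasurable_decayTrunc hh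
  have hFmono : Monotone F := monotone_decayTrunc h
  have hsup := (weightedSpace hpq.symm.lt hσ).norm_iSup F hFm hFmono
  simp only [hF, iSup_decayTrunc] at hsup
  change weightedNorm q σ h = ⨆ n, weightedNorm q σ (F n) at hsup
  rw [hsup]
  refine iSup_le fun n => ?_
  have hSt : weightedNorm q σ (F n) < ∞ := by
    refine ((weightedSpace hpq.symm.lt hσ).norm_mono (F n) (fun t => (n : ℝ≥0) * decayFn t) (hFm n)
      (measurable_decayFn.const_mul _).aemeasurable
      (.of_forall fun t => by simpa using decayTrunc_le_mul h n t)).trans_lt ?_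
    rw [(weightedSpace hpq.symm.lt hσ).norm_const_mul _ _ measurable_decayFn.aemeasurable]
    exact ENNReal.mul_lt_top (by simp) (weightedNorm_decayFn_lt_top hpq.symm.lt hσ)
  rcases eq_or_ne (∫⁻ t, F n t ^ q * σ t) 0 with h0 | h0
  · rw [weightedNorm, h0, ENNReal.zero_rpow_of_pos (by positivity)]
    exact zero_le
  have hSt' : ∫⁻ t, F n t ^ q * σ t ≠ ∞ := fun h' => by
    simp [weightedNorm, h', hq0] at hSt
  rw [weightedNorm]
  set S := ∫⁻ t, F n t ^ q * σ t with hS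
  set c := S ^ (-(1 / p)) with hc
  have hct : c ≠ ∞ := ENNReal.rpow_ne_top_of_ne_zero h0 hSt'
  have hFfin : ∀ t, F n t ≠ ∞ := decayTrunc_ne_top h n
  have hgm : AEMeasurable (fun t => c * (F n t ^ (q - 1) * σ t)) volume :=
    (((hFm n).pow_const _).mul hσm).const_mul c
  have hnorm : weightedNorm p w (fun t => c * (F n t ^ (q - 1) * σ t)) ≤ 1 := by
    have e : ∫⁻ t, (c * (F n t ^ (q - 1) * σ t)) ^ p * w t = c ^ p * S := by
      rw [hS, ← lintegral_const_mul' _ _ (ENNReal.rpow_ne_top_of_nonneg hp0.le hct)]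
      refine lintegral_congr_ae ?_
      filter_upwards [hw.2.1] with t ht
      have e1 : (q - 1) * p = q := by rw [hpq.symm.sub_one_mul_conj]
      have e2 : σ t ^ p * w t = σ t := by
        rw [hσdef, dualWeight, ← ENNReal.rpow_mul]
        nth_rewrite 2 [← ENNReal.rpow_one (w t)]
        rw [← ENNReal.rpow_add _ _ ht.1.ne' ht.2.ne]
        congr 1
        have := hpq.sub_one_pos.ne'
        field_simp
        ring
      rw [ENNReal.mul_rpow_of_nonneg _ _ hp0.le, ENNReal.mul_rpow_of_nonneg _ _ hp0.le,
        ← ENNReal.rpow_mul (F n t), e1, mul_assoc, mul_assoc, e2]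
    rw [weightedNorm, e, hc, ← ENNReal.rpow_mul, neg_mul, one_div_mul_cancel hp0.ne',
      ENNReal.rpow_neg_one, ENNReal.inv_mul_cancel h0 hSt', ENNReal.one_rpow]
  refine le_trans ?_ (le_iSup_of_le _ (le_iSup₂_of_le hgm hnorm le_rfl))
  calc S ^ (1 / q) = c * S := by
        nth_rewrite 2 [← ENNReal.rpow_one S]
        rw [hc, ← ENNReal.rpow_add _ _ h0 hSt']
        congr 1
        have := hpq.inv_add_inv_eq_one
        rw [one_div, one_div]
        linarith
    _ = ∫⁻ t, c * (F n t ^ q * σ t) := by rw [lintegral_const_mul' _ _ hct]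
    _ ≤ _ := by
        refine lintegral_mono fun t => ?_
        have e : F n t ^ q = F n t ^ (q - 1) * F n t := by
          rcases eq_or_ne (F n t) 0 with h1 | h1
          · simp [h1, hq0]
          · nth_rewrite 3 [← ENNReal.rpow_one (F n t)]
            rw [← ENNReal.rpow_add _ _ h1 (hFfin t), sub_add_cancel]
        calc c * (F n t ^ q * σ t) = c * (F n t ^ (q - 1) * σ t) * F n t := by rw [e]; ring
          _ ≤ _ := by gcongr; exact decayTrunc_le h n t

theorem weightedSpace_dual_maximalBounded {p : ℝ} (hp : 1 < p) {w : ℝ → ℝ≥0∞}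
    (hw : IsMuckenhoupt p w) {K : ℝ≥0} (hK : apConst p w ≤ K) :
    MaximalBoundedWith (weightedSpace hp hw).dualNorm
      (muckenhouptConst p.conjExponent (K ^ (p.conjExponent - 1))).toNNReal := by
  have hpq := Real.HolderConjugate.conjExponent hp
  have hKt : (K : ℝ≥0∞) ^ (p.conjExponent - 1) ≠ ∞ :=
    ENNReal.rpow_ne_top_of_nonneg hpq.symm.sub_one_pos.le (by simp)
  intro h hh _
  rw [ENNReal.coe_toNNReal (muckenhouptConst_lt_top hpq.symm.lt hKt).ne,
    dualNorm_weightedSpace hpq hw hh,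
    dualNorm_weightedSpace hpq hw (measurable_maximalFn h).aemeasurable]
  exact weightedNorm_maximalFn_le hpq.symm.lt (hw.dualWeight hpq) hKt
    ((apConst_dualWeight_le hpq w).trans (ENNReal.rpow_le_rpow hK hpq.symm.sub_one_pos.le)) hh

/-- The minimum of two `A_p`-weights is an `A_p`-weight, so the spaces `L^p_w` are directed. -/
theorem IsMuckenhoupt.min {p : ℝ} (hp : 1 < p) {w v : ℝ → ℝ≥0∞} (hw : IsMuckenhoupt p w)
    (hv : IsMuckenhoupt p v) : IsMuckenhoupt p (fun t => min (w t) (v t)) := by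
  have hp1 : 0 < p - 1 := by linarith
  refine ⟨hw.1.min hv.1, ?_, ?_⟩
  · filter_upwards [hw.2.1, hv.2.1] with t h1 h2
    exact ⟨lt_min h1.1 h2.1, (min_le_left _ _).trans_lt h1.2⟩
  refine lt_of_le_of_lt ?_ (ENNReal.mul_lt_top (a := 2 ^ (p - 1))
    (ENNReal.rpow_lt_top_of_nonneg hp1.le (by simp)) (max_lt hw.2.2 hv.2.2))
  refine iSup_le fun a => iSup_le fun b => iSup_le fun hab => ?_
  set L := ENNReal.ofReal (b - a)
  set s₁ := (∫⁻ t in Ioo a b, _root_.dualWeight p w t) / L with hs₁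
  set s₂ := (∫⁻ t in Ioo a b, _root_.dualWeight p v t) / L with hs₂
  have h1 := average_mul_average_le_apConst p w hab
  have h2 := average_mul_average_le_apConst p v hab
  have hσ : (∫⁻ t in Ioo a b, Min.min (w t) (v t) ^ (-(1 / (p - 1)))) / L ≤ 2 * max s₁ s₂ := by
    have : s₁ + s₂ ≤ 2 * max s₁ s₂ := by
      rw [two_mul]
      exact add_le_add (le_max_left _ _) (le_max_right _ _)
    refine le_trans ?_ this
    rw [hs₁, hs₂, ← ENNReal.add_div, ← lintegral_add_left' hw.aemeasurable_dualWeight.restrict]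
    gcongr with t
    rcases min_choice (w t) (v t) with h | h <;> rw [h]
    · exact le_add_right le_rfl
    · exact le_add_left le_rfl
  refine (mul_le_mul' le_rfl (ENNReal.rpow_le_rpow hσ hp1.le)).trans ?_
  rw [ENNReal.mul_rpow_of_nonneg _ _ hp1.le, mul_left_comm]
  refine mul_le_mul' le_rfl ?_
  rcases le_total s₁ s₂ with h | h
  · rw [max_eq_right h]
    refine le_trans ?_ (le_max_right _ _)
    refine le_trans ?_ h2
    gcongr
    exact min_le_right _ _
  · rw [max_eq_left h]
    refine le_trans ?_ (le_max_left _ _)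
    refine le_trans ?_ h1
    gcongr
    exact min_le_left _ _

/-! ### The Lorentz–Luxemburg theorem -/

theorem memLp_two_of_le_decayFn {f : ℝ → ℝ} (hf : AEStronglyMeasurable f volume) {n : ℕ}
    (h : ∀ t, ‖f t‖ ≤ n * (1 + |t|)⁻¹) : MemLp f 2 volume := by
  have hD : MemLp (fun t : ℝ => (1 + |t|)⁻¹) 2 volume := by
    rw [memLp_two_iff_integrable_sq (by fun_prop)]
    have := integrable_one_add_norm (E := ℝ) (μ := volume) (r := 2) (by simp)
    refine this.congr (.of_forall fun t => ?_)
    dsimp only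
    rw [Real.rpow_neg (by positivity), inv_pow]
    norm_num
  refine (hD.const_mul (n : ℝ)).mono hf (.of_forall fun t => (h t).trans ?_)
  exact le_abs_self _

theorem toReal_le_of_le_mul_decayFn {x : ℝ≥0∞} {n : ℕ} {t : ℝ} (h : x ≤ n * decayFn t) :
    x.toReal ≤ n * (1 + |t|)⁻¹ := by
  refine (ENNReal.toReal_mono (ENNReal.mul_ne_top (by simp) (decayFn_lt_top t).ne) h).trans ?_
  rw [ENNReal.toReal_mul, decayFn, ENNReal.toReal_ofReal (by positivity)]
  simp

namespace BanachFunctionSpace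

variable (Φ : BanachFunctionSpace)

/-- The unit ball of `Φ` is closed under convergence almost everywhere. -/
theorem norm_le_of_tendsto_ae {f : ℕ → ℝ → ℝ≥0∞} {g : ℝ → ℝ≥0∞}
    (hf : ∀ n, AEMeasurable (f n) volume) (hg : AEMeasurable g volume)
    (h : ∀ᵐ t ∂volume, Tendsto (fun n => f n t) atTop (𝓝 (g t))) {B : ℝ≥0∞}
    (hB : ∀ n, Φ.norm (f n) ≤ B) : Φ.norm g ≤ B := by
  have e : g =ᵐ[volume] fun t => ⨆ n, ⨅ i, f (i + n) t := by
    filter_upwards [h] with t ht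
    rw [← liminf_eq_iSup_iInf_of_nat' (u := fun n => f n t), ht.liminf_eq]
  have hm : ∀ n, AEMeasurable (fun t => ⨅ i, f (i + n) t) volume := fun n =>
    AEMeasurable.iInf fun i => hf _
  rw [Φ.norm_congr_ae hg e, Φ.norm_iSup (fun n t => ⨅ i, f (i + n) t) hm]
  · exact iSup_le fun n => (Φ.norm_mono _ _ (hm n) (hf n) (.of_forall fun t =>
      (iInf_le _ 0).trans (by simp))).trans (hB n)
  · intro m n hmn t
    refine le_iInf fun i => (iInf_le _ (i + (n - m))).trans (le_of_eq ?_)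
    rw [add_assoc, Nat.sub_add_cancel hmn]

/-- The functions of norm at most `1` in `Φ` form a closed convex subset of `L²`. By the Hahn–Banach
theorem, a function outside, here of size `O(1 / (1 + |t|))` and hence in `L²`, is separated from it
by a functional, whose absolute value is an element of the unit ball of the Köthe dual. -/
theorem exists_dual_of_one_lt_norm {f : ℝ → ℝ≥0∞} (hf : AEMeasurable f volume) {n : ℕ}
    (hfn : ∀ t, f t ≤ n * decayFn t) (h1 : 1 < Φ.norm f) :
    ∃ h : ℝ → ℝ≥0∞, AEMeasurable h volume ∧ Φ.dualNorm h ≤ 1 ∧ 1 < ∫⁻ t, f t * h t := by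
  let K : Set (Lp ℝ 2 (volume : Measure ℝ)) := {g | Φ.norm (fun t => ‖g t‖ₑ) ≤ 1}
  have hmeas : ∀ g : Lp ℝ 2 (volume : Measure ℝ), AEMeasurable (fun t => ‖g t‖ₑ) volume :=
    fun g => (Lp.aestronglyMeasurable g).enorm
  have hmem : ∀ {g : Lp ℝ 2 (volume : Measure ℝ)} {g' : ℝ → ℝ}, g =ᵐ[volume] g' →
      Φ.norm (fun t => ‖g t‖ₑ) = Φ.norm (fun t => ‖g' t‖ₑ) := fun {g g'} h =>
    Φ.norm_congr_ae (hmeas g) (h.mono fun t ht => by dsimp only; rw [ht])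
  have hconv : Convex ℝ K := by
    intro g hg k hk a b ha hb hab
    have hfun := (Lp.coeFn_add (a • g) (b • k)).trans
      ((Lp.coeFn_smul a g).add (Lp.coeFn_smul b k))
    change Φ.norm _ ≤ 1
    rw [hmem hfun]
    have hb1 : ∀ (c : ℝ), 0 ≤ c → ∀ u : Lp ℝ 2 (volume : Measure ℝ), u ∈ K →
        Φ.norm (fun t => ‖(c • (u : ℝ → ℝ)) t‖ₑ) ≤ ENNReal.ofReal c := by
      intro c hc u hu
      have e : (fun t => ‖(c • (u : ℝ → ℝ)) t‖ₑ) = fun t => (c.toNNReal : ℝ≥0∞) * ‖u t‖ₑ := by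
        funext t
        rw [Pi.smul_apply, enorm_smul, Real.enorm_of_nonneg hc, ENNReal.ofReal]
      rw [e, Φ.norm_const_mul _ _ (hmeas u)]
      exact mul_le_of_le_one_right' hu
    calc Φ.norm (fun t => ‖(a • (g : ℝ → ℝ) + b • (k : ℝ → ℝ)) t‖ₑ)
        ≤ Φ.norm (fun t => ‖(a • (g : ℝ → ℝ)) t‖ₑ + ‖(b • (k : ℝ → ℝ)) t‖ₑ) :=
          Φ.norm_mono _ _
            (((Lp.aestronglyMeasurable g).const_smul a).add
              ((Lp.aestronglyMeasurable k).const_smul b)).enorm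
            ((((Lp.aestronglyMeasurable g).const_smul a).enorm).add
              (((Lp.aestronglyMeasurable k).const_smul b).enorm))
            (.of_forall fun t => enorm_add_le _ _)
      _ ≤ ENNReal.ofReal a + ENNReal.ofReal b :=
          (Φ.norm_add_le _ _ ((Lp.aestronglyMeasurable g).const_smul a).enorm
            ((Lp.aestronglyMeasurable k).const_smul b).enorm).trans
            (add_le_add (hb1 a ha g hg) (hb1 b hb k hk))
      _ = 1 := by rw [← ENNReal.ofReal_add ha hb, hab, ENNReal.ofReal_one]
  have hclosed : IsClosed K := by
    refine IsSeqClosed.isClosed fun u g hu hug => ?_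
    obtain ⟨ns, -, hns⟩ := (tendstoInMeasure_of_tendsto_Lp hug).exists_seq_tendsto_ae
    refine Φ.norm_le_of_tendsto_ae (fun k => hmeas (u (ns k))) (hmeas g) ?_ fun k => hu (ns k)
    filter_upwards [hns] with t ht
    exact ht.enorm
  have hF : MemLp (fun t => (f t).toReal) 2 volume :=
    memLp_two_of_le_decayFn hf.ennreal_toReal.aestronglyMeasurable (n := n) fun t => by
      rw [Real.norm_of_nonneg ENNReal.toReal_nonneg]
      exact toReal_le_of_le_mul_decayFn (hfn t)
  have hft : ∀ t, f t ≠ ∞ := fun t =>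
    ((hfn t).trans_lt (ENNReal.mul_lt_top (by simp) (decayFn_lt_top t))).ne
  have hFK : hF.toLp ∉ K := by
    intro h
    change Φ.norm _ ≤ 1 at h
    rw [hmem hF.coeFn_toLp] at h
    refine absurd h (not_le.2 ?_)
    convert h1 using 2
    funext t
    rw [Real.enorm_of_nonneg ENNReal.toReal_nonneg, ENNReal.ofReal_toReal (hft t)]
  obtain ⟨L, c, hLK, hLF⟩ := geometric_hahn_banach_closed_point hconv hclosed hFK
  set η := (InnerProductSpace.toDual ℝ _).symm L with hη
  have hL : ∀ a, L a = ∫ t, η t * a t := fun a => by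
    rw [← InnerProductSpace.toDual_symm_apply, MeasureTheory.L2.inner_def]
    refine integral_congr_ae (.of_forall fun t => ?_)
    simp [hη, mul_comm]
  have hint : ∀ a : Lp ℝ 2 (volume : Measure ℝ),
      Integrable (fun t => η t * a t) volume := fun a => by
    have := MeasureTheory.L2.integrable_inner (𝕜 := ℝ) η a
    refine this.congr (.of_forall fun t => ?_)
    simp [mul_comm]
  have hc : 0 < c := by
    have : (0 : Lp ℝ 2 (volume : Measure ℝ)) ∈ K := by
      change Φ.norm _ ≤ 1
      rw [hmem (Lp.coeFn_zero ℝ 2 volume)]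
      simp [Φ.norm_zero]
    simpa using hLK 0 this
  have hηm : AEStronglyMeasurable η volume := Lp.aestronglyMeasurable η
  refine ⟨fun t => ENNReal.ofReal c⁻¹ * ‖η t‖ₑ, (hmeas η).const_mul _, ?_, ?_⟩
  · refine iSup_le fun g => iSup₂_le fun hg hg1 => ?_
    have e : ∀ t, g t * (ENNReal.ofReal c⁻¹ * ‖η t‖ₑ) =
        ⨆ k, decayTrunc g k t * (ENNReal.ofReal c⁻¹ * ‖η t‖ₑ) := fun t => by
      rw [← ENNReal.iSup_mul, iSup_decayTrunc]
    simp only [e]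
    rw [lintegral_iSup' (f := fun k t => decayTrunc g k t * (ENNReal.ofReal c⁻¹ * ‖η t‖ₑ))
      (fun k => (aemeasurable_decayTrunc hg k).mul ((hmeas η).const_mul _))
      (.of_forall fun t k l hkl => mul_le_mul' (monotone_decayTrunc g hkl t) le_rfl)]
    refine iSup_le fun k => ?_
    -- Multiplying by the sign of `η` turns a nonnegative test function into one with
    -- `η a = |η| a`.
    set a : ℝ → ℝ := fun t => η t / |η t| * (decayTrunc g k t).toReal with ha
    have ham : AEStronglyMeasurable a volume := by
      have h1 : AEMeasurable η volume := hηm.aemeasurable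
      have h2 : AEMeasurable (fun t => |η t|) volume := by simpa using hηm.norm.aemeasurable
      exact ((h1.div h2).mul
        (aemeasurable_decayTrunc hg k).ennreal_toReal).aestronglyMeasurable
    have ha1 : ∀ t, ‖a t‖ ≤ (decayTrunc g k t).toReal := fun t => by
      rw [ha, norm_mul, norm_div, Real.norm_eq_abs, Real.norm_eq_abs, abs_abs,
        Real.norm_of_nonneg ENNReal.toReal_nonneg]
      exact mul_le_of_le_one_left ENNReal.toReal_nonneg (div_self_le_one _)
    have haLp : MemLp a 2 volume := memLp_two_of_le_decayFn ham (n := k) fun t =>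
      (ha1 t).trans (toReal_le_of_le_mul_decayFn (decayTrunc_le_mul g k t))
    have haK : haLp.toLp ∈ K := by
      change Φ.norm _ ≤ 1
      rw [hmem haLp.coeFn_toLp]
      refine (Φ.norm_mono _ _ ham.enorm hg (.of_forall fun t => ?_)).trans hg1
      refine le_trans ?_ (decayTrunc_le g k t)
      rw [← ofReal_norm, ← ENNReal.ofReal_toReal (decayTrunc_ne_top g k t)]
      exact ENNReal.ofReal_le_ofReal (ha1 t)
    have hlt := hLK _ haK
    rw [hL] at hlt
    have hpt : (fun t => η t * (haLp.toLp : Lp ℝ 2 (volume : Measure ℝ)) t) =ᵐ[volume]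
        fun t => ‖η t‖ * (decayTrunc g k t).toReal := by
      filter_upwards [haLp.coeFn_toLp] with t ht
      rw [ht, ha, Real.norm_eq_abs]
      rcases eq_or_ne (η t) 0 with h0 | h0
      · simp [h0]
      · have h0' : |η t| ≠ 0 := by simpa using h0
        field_simp
        rw [sq_abs]
    have hint' := (hint haLp.toLp).congr hpt
    rw [integral_congr_ae hpt] at hlt
    calc ∫⁻ t, decayTrunc g k t * (ENNReal.ofReal c⁻¹ * ‖η t‖ₑ)
        = ENNReal.ofReal c⁻¹ * ∫⁻ t, ENNReal.ofReal (‖η t‖ * (decayTrunc g k t).toReal) := by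
          rw [← lintegral_const_mul' _ _ (by simp)]
          refine lintegral_congr fun t => ?_
          rw [ENNReal.ofReal_mul (norm_nonneg _), ENNReal.ofReal_toReal (decayTrunc_ne_top g k t),
            ofReal_norm]
          ring
      _ = ENNReal.ofReal (c⁻¹ * ∫ t, ‖η t‖ * (decayTrunc g k t).toReal) := by
          rw [← ofReal_integral_eq_lintegral_ofReal hint'
            (.of_forall fun t => mul_nonneg (norm_nonneg _) ENNReal.toReal_nonneg),
            ENNReal.ofReal_mul (by positivity)]
      _ ≤ 1 := by
          rw [ENNReal.ofReal_le_one, inv_mul_le_iff₀ hc]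
          linarith
  · rw [hL] at hLF
    have hpt : (fun t => η t * (hF.toLp : Lp ℝ 2 (volume : Measure ℝ)) t) =ᵐ[volume]
        fun t => η t * (f t).toReal := by
      filter_upwards [hF.coeFn_toLp] with t ht
      rw [ht]
    have hint' := (hint hF.toLp).congr hpt
    rw [integral_congr_ae hpt] at hLF
    have h2 : c < ∫ t, ‖η t‖ * (f t).toReal := by
      refine hLF.trans_le (integral_mono_ae hint' ?_ (.of_forall fun t => ?_))
      · refine hint'.norm.congr (.of_forall fun t => ?_)
        dsimp only
        rw [norm_mul, Real.norm_of_nonneg ENNReal.toReal_nonneg]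
      · exact mul_le_mul_of_nonneg_right (le_abs_self _) ENNReal.toReal_nonneg
    have hint2 : Integrable (fun t => ‖η t‖ * (f t).toReal) volume := by
      refine hint'.norm.congr (.of_forall fun t => ?_)
      dsimp only
      rw [norm_mul, Real.norm_of_nonneg ENNReal.toReal_nonneg]
    calc (1 : ℝ≥0∞) < ENNReal.ofReal (c⁻¹ * ∫ t, ‖η t‖ * (f t).toReal) := by
          rw [ENNReal.one_lt_ofReal, lt_inv_mul_iff₀ hc]
          linarith
      _ = ENNReal.ofReal c⁻¹ * ∫⁻ t, ENNReal.ofReal (‖η t‖ * (f t).toReal) := by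
          rw [← ofReal_integral_eq_lintegral_ofReal hint2
            (.of_forall fun t => mul_nonneg (norm_nonneg _) ENNReal.toReal_nonneg),
            ENNReal.ofReal_mul (by positivity)]
      _ = ∫⁻ t, f t * (ENNReal.ofReal c⁻¹ * ‖η t‖ₑ) := by
          rw [← lintegral_const_mul' _ _ (by simp)]
          refine lintegral_congr fun t => ?_
          rw [ENNReal.ofReal_mul (norm_nonneg _), ENNReal.ofReal_toReal (hft t), ofReal_norm]
          ring

/-- **Lorentz–Luxemburg theorem**: by Fatou's property, the norm of `Φ` is dual to that of `Φ'`. -/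
theorem norm_le_of_forall_dualNorm_le {f : ℝ → ℝ≥0∞} (hf : AEMeasurable f volume) {B : ℝ≥0∞}
    (hB : ∀ h : ℝ → ℝ≥0∞, AEMeasurable h volume → Φ.dualNorm h ≤ 1 → ∫⁻ t, f t * h t ≤ B) :
    Φ.norm f ≤ B := by
  by_contra! hlt
  obtain ⟨b, hBb, hbf⟩ := ENNReal.lt_iff_exists_nnreal_btwn.1 hlt
  have hb0 : b ≠ 0 := by
    rintro rfl
    exact not_lt_zero hBb
  have e : f = fun t => ⨆ n, decayTrunc f n t := funext fun t => (iSup_decayTrunc f t).symm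
  rw [e, Φ.norm_iSup _ (aemeasurable_decayTrunc hf) (monotone_decayTrunc f), lt_iSup_iff] at hbf
  obtain ⟨n, hn⟩ := hbf
  have hgm : AEMeasurable (fun t => (b⁻¹ : ℝ≥0) * decayTrunc f n t) volume :=
    (aemeasurable_decayTrunc hf n).const_mul _
  obtain ⟨m, hm⟩ := exists_nat_ge (b⁻¹ * n)
  obtain ⟨h, hhm, hh1, hlt1⟩ := Φ.exists_dual_of_one_lt_norm hgm (n := m)
    (fun t => by
      calc ((b⁻¹ : ℝ≥0) : ℝ≥0∞) * decayTrunc f n t ≤ (b⁻¹ : ℝ≥0) * (n * decayFn t) := by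
            gcongr; exact decayTrunc_le_mul f n t
        _ = ((b⁻¹ * n : ℝ≥0) : ℝ≥0∞) * decayFn t := by push_cast; ring
        _ ≤ m * decayFn t := by gcongr; exact_mod_cast hm)
    (by
      rw [Φ.norm_const_mul _ _ (aemeasurable_decayTrunc hf n), ENNReal.coe_inv hb0,
        ← ENNReal.inv_mul_cancel (a := (b : ℝ≥0∞)) (by simpa using hb0) (by simp)]
      exact ENNReal.mul_lt_mul_right (by simp) (by simpa using hb0) hn)
  refine absurd hlt1 (not_lt.2 ?_)
  calc ∫⁻ t, (b⁻¹ : ℝ≥0) * decayTrunc f n t * h t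
      = (b⁻¹ : ℝ≥0) * ∫⁻ t, decayTrunc f n t * h t := by
        simp only [mul_assoc]
        rw [lintegral_const_mul' _ _ (by simp)]
    _ ≤ (b⁻¹ : ℝ≥0) * B := by
        gcongr
        refine (lintegral_mono fun t => ?_).trans (hB h hhm hh1)
        gcongr
        exact decayTrunc_le f n t
    _ ≤ (b⁻¹ : ℝ≥0) * b := by gcongr
    _ = 1 := by rw [← ENNReal.coe_mul, inv_mul_cancel₀ hb0]; simp

/-- The Köthe dual of a Banach function space is nonzero. -/
theorem exists_dualNorm_lt_top : ∃ h : ℝ → ℝ≥0∞, AEMeasurable h volume ∧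
    (¬ h =ᵐ[volume] fun _ => 0) ∧ Φ.dualNorm h ≤ 1 := by
  by_contra! hcon
  obtain ⟨f, hf, hf0, -⟩ := Φ.nontrivial
  refine hf0 (nonpos_iff_eq_zero.1 (Φ.norm_le_of_forall_dualNorm_le hf fun h hh hh1 => ?_))
  have h0 : h =ᵐ[volume] fun _ => 0 := by
    by_contra h0
    exact absurd hh1 (not_le.2 (hcon h hh h0))
  refine (lintegral_congr_ae ?_).trans_le (lintegral_zero (μ := volume)).le
  filter_upwards [h0] with t ht
  simp [ht]

theorem ae_lt_top_of_norm_ne_top {f : ℝ → ℝ≥0∞} (hf : AEMeasurable f volume)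
    (h : Φ.norm f ≠ ∞) : ∀ᵐ t ∂volume, f t < ∞ := by
  have hm : NullMeasurableSet {t | f t = ∞} volume :=
    hf.nullMeasurableSet_preimage (measurableSet_singleton ∞)
  have hi : AEMeasurable ({t | f t = ∞}.indicator (1 : ℝ → ℝ≥0∞)) volume :=
    aemeasurable_one.indicator₀ hm
  have hle : ∀ n : ℕ, n * Φ.norm ({t | f t = ∞}.indicator 1) ≤ Φ.norm f := fun n => by
    have := Φ.norm_const_mul n _ hi
    rw [ENNReal.coe_natCast] at this
    rw [← this]
    refine Φ.norm_mono _ _ (hi.const_mul _) hf (.of_forall fun t => ?_)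
    by_cases ht : f t = ∞ <;> simp [indicator, ht]
  have h0 : Φ.norm ({t | f t = ∞}.indicator 1) = 0 := by
    by_contra h0
    obtain ⟨n, hn⟩ := ENNReal.exists_nat_mul_gt h0 h
    exact absurd (hle n) (not_le.2 hn)
  filter_upwards [(Φ.norm_eq_zero_iff _ hi).1 h0] with t ht
  by_contra! hcon
  simp [indicator, top_le_iff.1 hcon] at ht

end BanachFunctionSpace

/-! ### The Rubio de Francia algorithm and extrapolation -/

/-- The function `∑ k, M^k f / (2A)^k` of Rubio de Francia's algorithm. -/
def rubioDeFrancia (A : ℝ≥0) (f : ℝ → ℝ≥0∞) (t : ℝ) : ℝ≥0∞ :=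
  ∑' k : ℕ, ((2 * A)⁻¹ ^ k : ℝ≥0) * maximalFn^[k] f t

theorem aemeasurable_iterate_maximalFn {f : ℝ → ℝ≥0∞} (hf : AEMeasurable f volume) (k : ℕ) :
    AEMeasurable (maximalFn^[k] f) volume := by
  cases k with
  | zero => exact hf
  | succ k =>
    rw [Function.iterate_succ_apply']
    exact (measurable_maximalFn _).aemeasurable

theorem aemeasurable_rubioDeFrancia (A : ℝ≥0) {f : ℝ → ℝ≥0∞} (hf : AEMeasurable f volume) :
    AEMeasurable (rubioDeFrancia A f) volume :=
  AEMeasurable.tsum fun k => (aemeasurable_iterate_maximalFn hf k).const_mul _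

theorem le_rubioDeFrancia (A : ℝ≥0) (f : ℝ → ℝ≥0∞) (t : ℝ) : f t ≤ rubioDeFrancia A f t := by
  refine le_trans ?_ (ENNReal.le_tsum 0)
  simp

theorem rubioDeFrancia_pos {A : ℝ≥0} (hA : A ≠ 0) {f : ℝ → ℝ≥0∞} (hf : AEMeasurable f volume)
    (h0 : ¬ f =ᵐ[volume] fun _ => 0) (t : ℝ) : 0 < rubioDeFrancia A f t := by
  obtain ⟨c, hc, hcf⟩ := exists_mul_decayFn_le_maximalFn hf h0
  refine lt_of_lt_of_le ?_ (ENNReal.le_tsum 1)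
  rw [Function.iterate_one, pow_one]
  refine ENNReal.mul_pos (by simpa using hA) (ne_of_gt ?_)
  exact (ENNReal.mul_pos (by simpa using hc) (decayFn_pos t).ne').trans_le (hcf t)

/-- `rubioDeFrancia A f` is an `A_1`-weight. -/
theorem maximalFn_rubioDeFrancia_le {A : ℝ≥0} (hA : A ≠ 0) {f : ℝ → ℝ≥0∞}
    (hf : AEMeasurable f volume) (t : ℝ) :
    maximalFn (rubioDeFrancia A f) t ≤ (2 * A : ℝ≥0) * rubioDeFrancia A f t := by
  refine (maximalFn_tsum_le (fun k => (aemeasurable_iterate_maximalFn hf k).const_mul _) t).trans ?_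
  rw [rubioDeFrancia, ← ENNReal.tsum_mul_left]
  have hA2 : 2 * A ≠ 0 := by simpa using hA
  calc ∑' k : ℕ, maximalFn (fun x => (((2 * A)⁻¹ ^ k : ℝ≥0) : ℝ≥0∞) * maximalFn^[k] f x) t
      = ∑' k : ℕ, ((2 * A : ℝ≥0) : ℝ≥0∞) *
        (((2 * A)⁻¹ ^ (k + 1) : ℝ≥0) * maximalFn^[k + 1] f t) := by
        refine tsum_congr fun k => ?_
        rw [maximalFn_const_mul ENNReal.coe_ne_top, Function.iterate_succ_apply', ← mul_assoc,
          ← ENNReal.coe_mul, pow_succ, mul_left_comm, mul_inv_cancel₀ hA2, mul_one]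
    _ ≤ _ := ENNReal.tsum_comp_le_tsum_of_injective (add_left_injective 1)
      fun k : ℕ => ((2 * A : ℝ≥0) : ℝ≥0∞) * (((2 * A)⁻¹ ^ k : ℝ≥0) * maximalFn^[k] f t)

theorem rubioDeFrancia_norm_le {ρ : (ℝ → ℝ≥0∞) → ℝ≥0∞} {A : ℝ≥0} (hA : A ≠ 0)
    (hρA : MaximalBoundedWith ρ A)
    (hmul : ∀ (c : ℝ≥0) (f : ℝ → ℝ≥0∞), AEMeasurable f volume → ρ (fun t => c * f t) = c * ρ f)
    (hsum : ∀ f : ℕ → ℝ → ℝ≥0∞, (∀ n, AEMeasurable (f n) volume) →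
      ρ (fun t => ∑' n, f n t) ≤ ∑' n, ρ (f n))
    {f : ℝ → ℝ≥0∞} (hf : AEMeasurable f volume) (hfin : ρ f < ∞) :
    ρ (rubioDeFrancia A f) ≤ 2 * ρ f := by
  have hk : ∀ k, ρ (maximalFn^[k] f) ≤ (A ^ k : ℝ≥0) * ρ f := by
    intro k
    induction k with
    | zero => simp
    | succ k ih =>
      rw [Function.iterate_succ_apply']
      refine (hρA _ (aemeasurable_iterate_maximalFn hf k)
        (ih.trans_lt (ENNReal.mul_lt_top (by simp) hfin))).trans ?_
      calc (A : ℝ≥0∞) * ρ (maximalFn^[k] f) ≤ A * ((A ^ k : ℝ≥0) * ρ f) := by gcongr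
        _ = _ := by rw [pow_succ]; push_cast; ring
  refine (hsum _ fun k => (aemeasurable_iterate_maximalFn hf k).const_mul _).trans ?_
  calc ∑' k, ρ (fun t => (((2 * A)⁻¹ ^ k : ℝ≥0) : ℝ≥0∞) * maximalFn^[k] f t)
      ≤ ∑' k : ℕ, (2⁻¹ : ℝ≥0∞) ^ k * ρ f := by
        refine ENNReal.tsum_le_tsum fun k => ?_
        rw [hmul _ _ (aemeasurable_iterate_maximalFn hf k)]
        calc (((2 * A)⁻¹ ^ k : ℝ≥0) : ℝ≥0∞) * ρ (maximalFn^[k] f)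
            ≤ ((2 * A)⁻¹ ^ k : ℝ≥0) * ((A ^ k : ℝ≥0) * ρ f) := by gcongr; exact hk k
          _ = ((2⁻¹ ^ k : ℝ≥0) : ℝ≥0∞) * ρ f := by
              rw [← mul_assoc, ← ENNReal.coe_mul, ← mul_pow, mul_inv, inv_mul_cancel_right₀ hA]
          _ = _ := by simp [ENNReal.inv_pow]
    _ = 2 * ρ f := by rw [ENNReal.tsum_mul_right, ENNReal.tsum_geometric,
        ENNReal.one_sub_inv_two, inv_inv]

/-- Factorization: `u^{1-p} v` is an `A_p`-weight if `u` and `v` are `A_1`-weights. -/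
theorem isMuckenhoupt_of_factors {p : ℝ} (hp : 1 < p) {u v : ℝ → ℝ≥0∞} {a b : ℝ≥0}
    (hum : AEMeasurable u volume) (hvm : AEMeasurable v volume)
    (hu0 : ∀ t, 0 < u t) (hv0 : ∀ t, 0 < v t)
    (hut : ∀ᵐ t ∂volume, u t < ∞) (hvt : ∀ᵐ t ∂volume, v t < ∞)
    (hua : ∀ t, maximalFn u t ≤ a * u t) (hvb : ∀ t, maximalFn v t ≤ b * v t) :
    IsMuckenhoupt p (fun t => u t ^ (1 - p) * v t) ∧
      apConst p (fun t => u t ^ (1 - p) * v t) ≤ (a : ℝ≥0∞) ^ (p - 1) * b := by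
  have hp1 : 0 < p - 1 := by linarith
  have hap : apConst p (fun t => u t ^ (1 - p) * v t) ≤ (a : ℝ≥0∞) ^ (p - 1) * b := by
    refine iSup_le fun x => iSup_le fun y => iSup_le fun hxy => ?_
    set L := ENNReal.ofReal (y - x) with hLdef
    have hL0 : L ≠ 0 := (ENNReal.ofReal_pos.2 (by linarith)).ne'
    have hLt : L ≠ ∞ := by simp [L]
    have hpt : ∀ {f : ℝ → ℝ≥0∞} {c : ℝ≥0}, AEMeasurable f volume → (∀ t, 0 < f t) →
        (∀ᵐ t ∂volume, f t < ∞) → (∀ t, maximalFn f t ≤ c * f t) →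
        (∀ t ∈ Ioo x y, (∫⁻ t in Ioo x y, f t) / L ≤ c * f t) ∧
        (∫⁻ t in Ioo x y, f t) / L ≠ 0 ∧ (∫⁻ t in Ioo x y, f t) / L ≠ ∞ := by
      intro f c hfm hf0 hft hfc
      have h1 : ∀ t ∈ Ioo x y, (∫⁻ t in Ioo x y, f t) / L ≤ c * f t := fun t ht =>
        (average_le_maximalFn f ht).trans (hfc t)
      refine ⟨h1, ?_, ?_⟩
      · have := lintegral_Ioo_ne_zero hfm (.of_forall hf0) hxy
        simp [ENNReal.div_eq_zero_iff, this, hLt]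
      · have hne : (ae (volume.restrict (Ioo x y))).NeBot := by
          rw [ae_neBot, Ne, Measure.restrict_eq_zero, Real.volume_Ioo]
          exact hL0
        obtain ⟨t, ht, htm⟩ := ((ae_restrict_of_ae (s := Ioo x y) hft).and
          (ae_restrict_mem measurableSet_Ioo)).exists
        exact ((h1 t htm).trans_lt (ENNReal.mul_lt_top (by simp) ht)).ne
    obtain ⟨hU, hU0, hUt⟩ := hpt hum hu0 hut hua
    obtain ⟨hV, hV0, hVt⟩ := hpt hvm hv0 hvt hvb
    set U := (∫⁻ t in Ioo x y, u t) / L with hUdef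
    set V := (∫⁻ t in Ioo x y, v t) / L with hVdef
    have hUp0 : U ^ (p - 1) ≠ 0 := by simp [hU0, hUt]
    have hUpt : U ^ (p - 1) ≠ ∞ := ENNReal.rpow_ne_top_of_nonneg hp1.le hUt
    have h1 : (∫⁻ t in Ioo x y, u t ^ (1 - p) * v t) / L ≤
        (a : ℝ≥0∞) ^ (p - 1) * (U ^ (p - 1))⁻¹ * V := by
      have : ∫⁻ t in Ioo x y, u t ^ (1 - p) * v t ≤
          ∫⁻ t in Ioo x y, (a : ℝ≥0∞) ^ (p - 1) * (U ^ (p - 1))⁻¹ * v t := by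
        refine setLIntegral_mono_ae' measurableSet_Ioo ?_
        filter_upwards [hut] with t htt ht
        gcongr
        have h2 := ENNReal.rpow_le_rpow (hU t ht) hp1.le
        rw [ENNReal.mul_rpow_of_nonneg _ _ hp1.le] at h2
        rw [← neg_sub, ENNReal.rpow_neg, ← div_eq_mul_inv, ENNReal.le_div_iff_mul_le (.inl hUp0)
          (.inl hUpt)]
        have h30 : u t ^ (p - 1) ≠ 0 := by simp [(hu0 t).ne', htt.ne]
        have h3t : u t ^ (p - 1) ≠ ∞ := ENNReal.rpow_ne_top_of_nonneg hp1.le htt.ne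
        calc (u t ^ (p - 1))⁻¹ * U ^ (p - 1)
            ≤ (u t ^ (p - 1))⁻¹ * ((a : ℝ≥0∞) ^ (p - 1) * u t ^ (p - 1)) := by gcongr
          _ = (a : ℝ≥0∞) ^ (p - 1) * ((u t ^ (p - 1))⁻¹ * u t ^ (p - 1)) := by ring
          _ = (a : ℝ≥0∞) ^ (p - 1) := by rw [ENNReal.inv_mul_cancel h30 h3t, mul_one]
      rw [lintegral_const_mul' _ _ (ENNReal.mul_ne_top (ENNReal.rpow_ne_top_of_nonneg hp1.le
        (by simp)) (by simpa using hUp0))] at this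
      rw [hVdef, ← mul_div_assoc]
      gcongr
    have h2 : ((∫⁻ t in Ioo x y, (u t ^ (1 - p) * v t) ^ (-(1 / (p - 1)))) / L) ^ (p - 1) ≤
        b * V⁻¹ * U ^ (p - 1) := by
      have : ∫⁻ t in Ioo x y, (u t ^ (1 - p) * v t) ^ (-(1 / (p - 1))) ≤
          ∫⁻ t in Ioo x y, (b * V⁻¹) ^ (1 / (p - 1)) * u t := by
        refine setLIntegral_mono_ae' measurableSet_Ioo ?_
        filter_upwards [hut, hvt] with t htu htv ht
        have e1 : (u t ^ (1 - p)) ^ (-(1 / (p - 1))) = u t := by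
          rw [← ENNReal.rpow_mul]
          convert! ENNReal.rpow_one _ using 2
          field_simp
          ring
        rw [ENNReal.mul_rpow_of_ne_top (ENNReal.rpow_ne_top_of_ne_zero (hu0 t).ne' htu.ne) htv.ne,
          e1, mul_comm]
        gcongr
        rw [ENNReal.rpow_neg, ← ENNReal.inv_rpow]
        refine ENNReal.rpow_le_rpow ?_ (by positivity)
        rw [← div_eq_mul_inv, ENNReal.le_div_iff_mul_le (.inl hV0) (.inl hVt)]
        calc (v t)⁻¹ * V ≤ (v t)⁻¹ * (b * v t) := by gcongr; exact hV t ht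
          _ = b * ((v t)⁻¹ * v t) := by ring
          _ = b := by rw [ENNReal.inv_mul_cancel (hv0 t).ne' htv.ne, mul_one]
      rw [lintegral_const_mul' _ _ (ENNReal.rpow_ne_top_of_nonneg (by positivity)
        (ENNReal.mul_ne_top (by simp) (by simpa using hV0)))] at this
      calc _ ≤ ((b * V⁻¹) ^ (1 / (p - 1)) * U) ^ (p - 1) := by
            rw [hUdef, ← mul_div_assoc]
            gcongr
        _ = _ := by
            rw [ENNReal.mul_rpow_of_nonneg _ _ hp1.le, ← ENNReal.rpow_mul,
              one_div_mul_cancel hp1.ne', ENNReal.rpow_one]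
    calc _ ≤ ((a : ℝ≥0∞) ^ (p - 1) * (U ^ (p - 1))⁻¹ * V) * (b * V⁻¹ * U ^ (p - 1)) :=
          mul_le_mul' h1 h2
      _ = (a : ℝ≥0∞) ^ (p - 1) * b * (U ^ (p - 1) * (U ^ (p - 1))⁻¹) * (V * V⁻¹) := by ring
      _ = _ := by rw [ENNReal.mul_inv_cancel hUp0 hUpt, ENNReal.mul_inv_cancel hV0 hVt,
        mul_one, mul_one]
  refine ⟨⟨(hum.pow_const _).mul hvm, ?_, hap.trans_lt (ENNReal.mul_lt_top
    (ENNReal.rpow_lt_top_of_nonneg hp1.le (by simp)) (by simp))⟩, hap⟩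
  filter_upwards [hut, hvt] with t h1 h2
  exact ⟨ENNReal.mul_pos (ENNReal.rpow_pos (hu0 t) h1.ne).ne' (hv0 t).ne',
    ENNReal.mul_lt_top (ENNReal.rpow_ne_top_of_ne_zero (hu0 t).ne' h1.ne).lt_top h2⟩

/-- The bound for the `A_p`-constants of the weights used to extrapolate to a space on which the
maximal operator has norm at most `A`, and at most `B` on the Köthe dual. -/
def extrapolationConst (p : ℝ) (A B : ℝ≥0) : ℝ≥0∞ :=
  ((2 * A : ℝ≥0) : ℝ≥0∞) ^ (p - 1) * (2 * B : ℝ≥0)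

theorem extrapolationConst_lt_top {p : ℝ} (hp : 1 < p) (A B : ℝ≥0) :
    extrapolationConst p A B < ∞ :=
  ENNReal.mul_lt_top (ENNReal.rpow_lt_top_of_nonneg (by linarith) ENNReal.coe_ne_top)
    ENNReal.coe_lt_top

/-- The weights of Rubio de Francia's extrapolation: `w = u^{1-p} v`, where `u ≥ g` and `v ≥ h` are
`A_1`-weights of comparable norms in `Φ` and `Φ'`. -/
theorem exists_extrapolation_weight {p : ℝ} (hp : 1 < p) (Φ : BanachFunctionSpace) {A B : ℝ≥0}
    (hA0 : A ≠ 0) (hB0 : B ≠ 0) (hA : MaximalBoundedWith Φ.norm A)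
    (hB : MaximalBoundedWith Φ.dualNorm B) {g h : ℝ → ℝ≥0∞} (hg : AEMeasurable g volume)
    (hh : AEMeasurable h volume) (hg0 : ¬ g =ᵐ[volume] fun _ => 0)
    (hh0 : ¬ h =ᵐ[volume] fun _ => 0) (hgt : Φ.norm g < ∞) (hht : Φ.dualNorm h < ∞) :
    ∃ u v : ℝ → ℝ≥0∞, AEMeasurable u volume ∧ AEMeasurable v volume ∧
      IsMuckenhoupt p (fun t => u t ^ (1 - p) * v t) ∧
      apConst p (fun t => u t ^ (1 - p) * v t) ≤ extrapolationConst p A B ∧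
      (∀ t, g t ≤ u t) ∧ (∀ t, h t ≤ v t) ∧ (∀ t, 0 < u t) ∧ (∀ᵐ t ∂volume, u t < ∞) ∧
      ∫⁻ t, u t * v t ≤ 4 * (Φ.norm g * Φ.dualNorm h) := by
  set u := rubioDeFrancia A g
  set v := rubioDeFrancia B h
  have hum : AEMeasurable u volume := aemeasurable_rubioDeFrancia A hg
  have hvm : AEMeasurable v volume := aemeasurable_rubioDeFrancia B hh
  have hu : Φ.norm u ≤ 2 * Φ.norm g := rubioDeFrancia_norm_le hA0 hA
    (fun c f hf => Φ.norm_const_mul c f hf) (fun f hf => Φ.norm_tsum_le hf) hg hgt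
  have hv : Φ.dualNorm v ≤ 2 * Φ.dualNorm h := rubioDeFrancia_norm_le hB0 hB
    (fun c f _ => Φ.dualNorm_const_mul ENNReal.coe_ne_top f) (fun f hf => Φ.dualNorm_tsum_le hf)
    hh hht
  have hut : Φ.norm u < ∞ := hu.trans_lt (ENNReal.mul_lt_top (by simp) hgt)
  have huv : ∫⁻ t, u t * v t ≤ 4 * (Φ.norm g * Φ.dualNorm h) := by
    refine (Φ.lintegral_mul_le hum hut.ne).trans ((mul_le_mul' hu hv).trans (le_of_eq ?_))
    ring
  have hu0 : ∀ t, 0 < u t := rubioDeFrancia_pos hA0 hg hg0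
  have hv0 : ∀ t, 0 < v t := rubioDeFrancia_pos hB0 hh hh0
  have hufin := Φ.ae_lt_top_of_norm_ne_top hum hut.ne
  have hvfin : ∀ᵐ t ∂volume, v t < ∞ := by
    have h1 : ∫⁻ t, u t * v t ≠ ∞ := (huv.trans_lt (ENNReal.mul_lt_top (by simp)
      (ENNReal.mul_lt_top hgt hht))).ne
    filter_upwards [ae_lt_top' (hum.mul hvm) h1] with t ht
    by_contra! hcon
    simp [top_le_iff.1 hcon, (hu0 t).ne'] at ht
  obtain ⟨hM, hK⟩ := isMuckenhoupt_of_factors hp hum hvm hu0 hv0 hufin hvfin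
    (maximalFn_rubioDeFrancia_le hA0 hg) (maximalFn_rubioDeFrancia_le hB0 hh)
  exact ⟨u, v, hum, hvm, hM, hK, le_rubioDeFrancia A g, le_rubioDeFrancia B h, hu0, hufin, huv⟩

/-- In the space weighted with `u^{1-p} v`, the norm of `g ≤ u` is controlled by `∫ u v`. -/
theorem weightedNorm_factor_le {p : ℝ} (hp : 1 < p) {g u v : ℝ → ℝ≥0∞} (hgu : ∀ t, g t ≤ u t)
    (hu0 : ∀ t, 0 < u t) (hut : ∀ᵐ t ∂volume, u t < ∞) :
    weightedNorm p (fun t => u t ^ (1 - p) * v t) g ≤ (∫⁻ t, u t * v t) ^ (1 / p) := by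
  have hp0 : 0 < p := by linarith
  unfold weightedNorm
  gcongr ?_ ^ _
  refine lintegral_mono_ae ?_
  filter_upwards [hut] with t ht
  rw [← mul_assoc]
  gcongr
  calc g t ^ p * u t ^ (1 - p) ≤ u t ^ p * u t ^ (1 - p) := by gcongr; exact hgu t
    _ = u t := by
      rw [← ENNReal.rpow_add _ _ (hu0 t).ne' ht.ne, add_sub_cancel, ENNReal.rpow_one]

/-- Every function in an admissible space lies in `L^p_w` for a weight `w` with controlled
`A_p`-constant. -/
theorem exists_weightedNorm_lt_top {p : ℝ} (hp : 1 < p) (Φ : BanachFunctionSpace) {A B : ℝ≥0}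
    (hA0 : A ≠ 0) (hB0 : B ≠ 0) (hA : MaximalBoundedWith Φ.norm A)
    (hB : MaximalBoundedWith Φ.dualNorm B) {g : ℝ → ℝ≥0∞} (hg : AEMeasurable g volume)
    (hgt : Φ.norm g < ∞) :
    ∃ w, IsMuckenhoupt p w ∧ apConst p w ≤ extrapolationConst p A B ∧ weightedNorm p w g < ∞ := by
  obtain ⟨h, hh, hh0, hh1⟩ := Φ.exists_dualNorm_lt_top
  -- adding `1 / (1 + |t|)` makes `g` nonzero
  have hg'm : AEMeasurable (fun t => g t + decayFn t) volume :=
    hg.add measurable_decayFn.aemeasurable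
  have hg't : Φ.norm (fun t => g t + decayFn t) < ∞ :=
    (Φ.norm_add_le _ _ hg measurable_decayFn.aemeasurable).trans_lt
      (ENNReal.add_lt_top.2 ⟨hgt, Φ.norm_decayFn_lt_top hA⟩)
  obtain ⟨u, v, -, -, hM, hK, hgu, -, hu0, hut, huv⟩ := exists_extrapolation_weight hp Φ hA0 hB0
    hA hB hg'm hh (fun h0 => by
      obtain ⟨t, ht⟩ := h0.exists
      exact (decayFn_pos t).ne' (add_eq_zero.1 ht).2) hh0 hg't (hh1.trans_lt ENNReal.one_lt_top)
  refine ⟨_, hM, hK, (weightedNorm_factor_le hp (fun t => le_self_add.trans (hgu t)) hu0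
    hut).trans_lt ?_⟩
  exact ENNReal.rpow_lt_top_of_nonneg (by positivity) (huv.trans_lt (ENNReal.mul_lt_top (by simp)
    (ENNReal.mul_lt_top hg't (hh1.trans_lt ENNReal.one_lt_top)))).ne

/-- **Rubio de Francia extrapolation** to Banach function spaces. -/
theorem norm_le_of_weightedNorm_le {p : ℝ} (hp : 1 < p) (Φ : BanachFunctionSpace) {A B : ℝ≥0}
    (hA0 : A ≠ 0) (hB0 : B ≠ 0) (hA : MaximalBoundedWith Φ.norm A)
    (hB : MaximalBoundedWith Φ.dualNorm B) {f g : ℝ → ℝ≥0∞} (hf : AEMeasurable f volume)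
    (hg : AEMeasurable g volume) (hgt : Φ.norm g < ∞) {C : ℝ≥0}
    (hfg : ∀ w, IsMuckenhoupt p w → apConst p w ≤ extrapolationConst p A B →
      weightedNorm p w f ≤ C * weightedNorm p w g) :
    Φ.norm f ≤ 4 * C * Φ.norm g := by
  have hp0 : 0 < p := by linarith
  by_cases hg0 : g =ᵐ[volume] fun _ => 0
  · obtain ⟨w, hw, hK, -⟩ := exists_weightedNorm_lt_top hp Φ hA0 hB0 hA hB hg hgt
    have h1 := hfg w hw hK
    have h2 : weightedNorm p w g = 0 := ((weightedSpace hp hw).norm_eq_zero_iff g hg).2 hg0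
    rw [h2, mul_zero, nonpos_iff_eq_zero] at h1
    have h3 : f =ᵐ[volume] fun _ => 0 := ((weightedSpace hp hw).norm_eq_zero_iff f hf).1 h1
    rw [(Φ.norm_eq_zero_iff f hf).2 h3]
    exact zero_le
  refine Φ.norm_le_of_forall_dualNorm_le hf fun h hh hh1 => ?_
  by_cases hh0 : h =ᵐ[volume] fun _ => 0
  · have : ∫⁻ t, f t * h t = ∫⁻ _ : ℝ, 0 := by
      refine lintegral_congr_ae ?_
      filter_upwards [hh0] with t ht
      simp [ht]
    simp [this]
  obtain ⟨u, v, hum, hvm, hM, hK, hgu, hhv, hu0, hut, huv⟩ := exists_extrapolation_weight hp Φ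
    hA0 hB0 hA hB hg hh hg0 hh0 hgt (hh1.trans_lt ENNReal.one_lt_top)
  set w := fun t => u t ^ (1 - p) * v t with hw
  have hpq := Real.HolderConjugate.conjExponent hp
  set q := p.conjExponent
  have hq0 : 0 < q := hpq.symm.pos
  have key := lintegral_mul_le_weightedNorm hpq hM hf hvm
  set I := ∫⁻ t, u t * v t with hI
  have hv' : weightedNorm q (dualWeight p w) v ≤ I ^ (1 / q) := by
    unfold weightedNorm
    gcongr ?_ ^ _
    refine lintegral_mono_ae ?_
    filter_upwards [hut, hM.2.1] with t ht hwt
    have hvt : v t ≠ ∞ := fun h' => by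
      have : u t ^ (1 - p) * v t < ∞ := hwt.2
      rw [h', ENNReal.mul_top (ENNReal.rpow_pos (hu0 t) ht.ne).ne'] at this
      exact lt_irrefl _ this
    have hv0 : v t ≠ 0 := fun h' => by
      have : 0 < u t ^ (1 - p) * v t := hwt.1
      rw [h', mul_zero] at this
      exact lt_irrefl _ this
    rw [dualWeight, hw, one_div_sub_one_eq hpq, ENNReal.mul_rpow_of_ne_top
      (ENNReal.rpow_ne_top_of_ne_zero (hu0 t).ne' ht.ne) hvt, ← ENNReal.rpow_mul,
      mul_left_comm, ← ENNReal.rpow_add _ _ hv0 hvt]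
    refine le_of_eq ?_
    congr 1
    · convert! ENNReal.rpow_one _ using 2
      have := hpq.mul_eq_add
      linarith
    · convert! ENNReal.rpow_one _ using 2
      ring
  calc ∫⁻ t, f t * h t ≤ ∫⁻ t, f t * v t := by gcongr with t; exact hhv t
    _ ≤ weightedNorm p w f * weightedNorm q (dualWeight p w) v := key
    _ ≤ (C * I ^ (1 / p)) * I ^ (1 / q) := by
        gcongr
        exact (hfg w hM hK).trans (by gcongr; exact weightedNorm_factor_le hp hgu hu0 hut)
    _ = C * I := by
        rw [mul_assoc, ← ENNReal.rpow_add_of_nonneg _ _ (by positivity) (by positivity), one_div,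
          one_div, hpq.inv_add_inv_eq_one, ENNReal.rpow_one]
    _ ≤ C * (4 * (Φ.norm g * 1)) := by
        gcongr
        exact huv.trans (by gcongr)
    _ = _ := by ring

/-! ### Smooth symbols and their dilates -/

/-- Smooth symbols all of whose derivatives are bounded. -/
def IsBoundedSymbol (χ : ℝ → ℂ) : Prop :=
  ContDiff ℝ (⊤ : ℕ∞) χ ∧ ∀ i, ∃ C, ∀ x, ‖iteratedDeriv i χ x‖ ≤ C

theorem IsBoundedSymbol.hasTemperateGrowth {χ : ℝ → ℂ} (h : IsBoundedSymbol χ) :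
    χ.HasTemperateGrowth := by
  refine ⟨h.1, fun i => ?_⟩
  obtain ⟨C, hC⟩ := h.2 i
  exact ⟨0, C, fun x => by simpa [norm_iteratedFDeriv_eq_norm_iteratedDeriv] using hC x⟩

theorem IsBoundedSymbol.comp_const_mul {χ : ℝ → ℂ} (h : IsBoundedSymbol χ) (c : ℝ) :
    IsBoundedSymbol (fun x => χ (c * x)) := by
  refine ⟨h.1.comp (contDiff_const.mul contDiff_id), fun i => ?_⟩
  obtain ⟨C, hC⟩ := h.2 i
  refine ⟨|c| ^ i * C, fun x => ?_⟩
  rw [iteratedDeriv_comp_const_smul (h.1.of_le (mod_cast le_top)) c, norm_smul, norm_pow,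
    Real.norm_eq_abs]
  gcongr
  exact hC _

theorem IsBoundedSymbol.sub {χ η : ℝ → ℂ} (h : IsBoundedSymbol χ) (h' : IsBoundedSymbol η) :
    IsBoundedSymbol (fun x => χ x - η x) := by
  refine ⟨h.1.sub h'.1, fun i => ?_⟩
  obtain ⟨C, hC⟩ := h.2 i
  obtain ⟨C', hC'⟩ := h'.2 i
  refine ⟨C + C', fun x => ?_⟩
  rw [iteratedDeriv_fun_sub (h.1.of_le (mod_cast le_top)).contDiffAt
    (h'.1.of_le (mod_cast le_top)).contDiffAt]
  exact (norm_sub_le _ _).trans (add_le_add (hC x) (hC' x))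

theorem IsBoundedSymbol.const (c : ℂ) : IsBoundedSymbol (fun _ => c) := by
  refine ⟨contDiff_const, fun i => ⟨‖c‖, fun x => ?_⟩⟩
  rw [iteratedDeriv_const]
  split_ifs <;> simp

theorem IsBoundedSymbol.of_hasCompactSupport {χ : ℝ → ℂ} (h : ContDiff ℝ (⊤ : ℕ∞) χ)
    (hc : HasCompactSupport χ) : IsBoundedSymbol χ := by
  refine ⟨h, fun i => ?_⟩
  obtain ⟨C, hC⟩ := (hc.iteratedFDeriv i (𝕜 := ℝ)).exists_bound_of_continuous
    (h.continuous_iteratedFDeriv (mod_cast le_top))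
  exact ⟨C, fun x => by simpa [norm_iteratedFDeriv_eq_norm_iteratedDeriv] using hC x⟩

/-- The dilate `χ(2^{-n} ·)`. -/
def dilate (χ : ℝ → ℂ) (n : ℕ) (x : ℝ) : ℂ := χ ((2⁻¹ : ℝ) ^ n * x)

theorem IsBoundedSymbol.dilate {χ : ℝ → ℂ} (h : IsBoundedSymbol χ) (n : ℕ) :
    IsBoundedSymbol (dilate χ n) :=
  h.comp_const_mul _

section Cutoff

variable {E : Type*} [NormedAddCommGroup E] [NormedSpace ℂ E]

theorem seminorm_smulLeftCLM_dilate_le {χ : ℝ → ℂ} (hχ : IsBoundedSymbol χ) {r : ℝ} (hr : 0 < r)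
    (h0 : ∀ x, |x| ≤ r → χ x = 0) (N k m : ℕ) :
    ∃ q : Seminorm ℂ 𝓢(ℝ, E), Continuous q ∧ ∀ (n : ℕ) (h : 𝓢(ℝ, E)),
      SchwartzMap.seminorm ℂ k m (SchwartzMap.smulLeftCLM E (dilate χ n) h) ≤
        ((2⁻¹ : ℝ) ^ N) ^ n * q h := by
  choose B hB using hχ.2
  have hB0 : ∀ i, 0 ≤ B i := fun i => (norm_nonneg _).trans (hB i 0)
  let c : ℕ → ℝ≥0 := fun i => ⟨m.choose i * B i * (r⁻¹) ^ N, by have := hB0 i; positivity⟩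
  let q : Seminorm ℂ 𝓢(ℝ, E) :=
    ∑ i ∈ Finset.range (m + 1), c i • SchwartzMap.seminorm ℂ (k + N) (m - i)
  have hqa : ∀ h, q h = ∑ i ∈ Finset.range (m + 1),
      m.choose i * B i * (r⁻¹) ^ N * SchwartzMap.seminorm ℂ (k + N) (m - i) h := fun h => by
    simp only [q, sum_apply, smul_apply]
    rfl
  refine ⟨q, ?_, fun n h => ?_⟩
  · have : (q : 𝓢(ℝ, E) → ℝ) = fun h => ∑ i ∈ Finset.range (m + 1),
        m.choose i * B i * (r⁻¹) ^ N * SchwartzMap.seminorm ℂ (k + N) (m - i) h := funext hqa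
    rw [this]
    exact continuous_finsetSum _ fun i _ => continuous_const.mul
      ((schwartz_withSeminorms ℂ ℝ E).continuous_seminorm (k + N, m - i))
  refine SchwartzMap.seminorm_le_bound' ℂ k m _ (by positivity) fun x => ?_
  rw [SchwartzMap.smulLeftCLM_apply (hχ.dilate n).hasTemperateGrowth]
  rcases lt_or_ge ((2⁻¹ : ℝ) ^ n * |x|) r with hx | hx
  · have : (fun x => dilate χ n x • h x) =ᶠ[𝓝 x] fun _ => 0 := by
      have ho : IsOpen {y : ℝ | (2⁻¹ : ℝ) ^ n * |y| < r} :=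
        isOpen_lt (by fun_prop) continuous_const
      filter_upwards [ho.mem_nhds hx] with y hy
      have : dilate χ n y = 0 := h0 _ (by
        rw [abs_mul, abs_of_pos (by positivity)]
        exact le_of_lt hy)
      simp [this]
    rw [EventuallyEq.iteratedDeriv_eq m this, iteratedDeriv_const]
    simp only [ite_self, norm_zero, mul_zero]
    positivity
  have hL : ‖iteratedDeriv m (fun x => dilate χ n x • h x) x‖ ≤ ∑ i ∈ Finset.range (m + 1),
      m.choose i * B i * ‖iteratedDeriv (m - i) h x‖ := by
    have := norm_iteratedFDeriv_smul_le (𝕜 := ℝ) (hχ.dilate n).1 (h.smooth ⊤) x (n := m)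
      (mod_cast le_top)
    simp only [norm_iteratedFDeriv_eq_norm_iteratedDeriv] at this
    refine this.trans (Finset.sum_le_sum fun i _ => ?_)
    gcongr
    have e : iteratedDeriv i (dilate χ n) x = _ := congrFun
      (iteratedDeriv_comp_const_smul (hχ.1.of_le (mod_cast le_top)) ((2⁻¹ : ℝ) ^ n)) x
    rw [e, norm_smul, norm_pow, norm_pow, norm_inv, Real.norm_ofNat]
    calc _ ≤ (1 : ℝ) * B i := by
          gcongr
          · exact pow_le_one₀ (by positivity) (pow_le_one₀ (by norm_num) (by norm_num))
          · exact hB i _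
      _ = _ := one_mul _
  have h1 : |x| ^ k ≤ ((2⁻¹ : ℝ) ^ N) ^ n * (r⁻¹) ^ N * |x| ^ (k + N) := by
    have : (1 : ℝ) ≤ ((2⁻¹ : ℝ) ^ n * |x| * r⁻¹) ^ N :=
      one_le_pow₀ (by rw [← div_eq_mul_inv, one_le_div hr]; exact hx)
    calc |x| ^ k = |x| ^ k * 1 := (mul_one _).symm
      _ ≤ |x| ^ k * ((2⁻¹ : ℝ) ^ n * |x| * r⁻¹) ^ N := by gcongr
      _ = _ := by rw [mul_pow, mul_pow, ← pow_mul, ← pow_mul, mul_comm n N, pow_add]; ring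
  calc |x| ^ k * ‖iteratedDeriv m (fun x => dilate χ n x • h x) x‖
      ≤ (((2⁻¹ : ℝ) ^ N) ^ n * (r⁻¹) ^ N * |x| ^ (k + N)) * ∑ i ∈ Finset.range (m + 1),
        m.choose i * B i * ‖iteratedDeriv (m - i) h x‖ := by gcongr
    _ = ((2⁻¹ : ℝ) ^ N) ^ n * ∑ i ∈ Finset.range (m + 1), m.choose i * B i * (r⁻¹) ^ N *
        (|x| ^ (k + N) * ‖iteratedDeriv (m - i) h x‖) := by
        rw [mul_assoc, mul_assoc, Finset.mul_sum, Finset.mul_sum]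
        congr 1
        exact Finset.sum_congr rfl fun i _ => by ring
    _ ≤ _ := by
        rw [hqa]
        gcongr with i
        · have := hB0 i
          positivity
        · exact SchwartzMap.le_seminorm' ℂ _ _ h x

/-- Cutting off a Schwartz function near the origin at scale `2^n` makes it small, at any rate
`2^{-nN}`, with respect to every continuous seminorm. -/
theorem exists_seminorm_smulLeftCLM_dilate_le {χ : ℝ → ℂ} (hχ : IsBoundedSymbol χ) {r : ℝ}
    (hr : 0 < r) (h0 : ∀ x, |x| ≤ r → χ x = 0) (N : ℕ) (q : Seminorm ℂ 𝓢(ℝ, E))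
    (hq : Continuous q) :
    ∃ q' : Seminorm ℂ 𝓢(ℝ, E), Continuous q' ∧ ∀ (n : ℕ) (h : 𝓢(ℝ, E)),
      q (SchwartzMap.smulLeftCLM E (dilate χ n) h) ≤ ((2⁻¹ : ℝ) ^ N) ^ n * q' h := by
  obtain ⟨s, C, -, hC⟩ := Seminorm.bound_of_continuous (schwartz_withSeminorms ℂ ℝ E) q hq
  choose Q hQ hQb using fun km : ℕ × ℕ =>
    seminorm_smulLeftCLM_dilate_le (E := E) hχ hr h0 N km.1 km.2
  have hqa : ∀ h, (C • ∑ km ∈ s, Q km) h = C * ∑ km ∈ s, Q km h := fun h => by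
    simp only [sum_apply, smul_apply]
    rfl
  refine ⟨C • ∑ km ∈ s, Q km, ?_, fun n h => ?_⟩
  · have : ((C • ∑ km ∈ s, Q km : Seminorm ℂ 𝓢(ℝ, E)) : 𝓢(ℝ, E) → ℝ) =
      fun h => C * ∑ km ∈ s, Q km h := funext hqa
    rw [this]
    exact continuous_const.mul (continuous_finsetSum _ fun i _ => hQ i)
  rw [hqa]
  refine (hC _).trans ?_
  have h1 := Seminorm.finset_sup_le_sum (schwartzSeminormFamily ℂ ℝ E) s
    (SchwartzMap.smulLeftCLM E (dilate χ n) h)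
  rw [sum_apply] at h1
  calc _ ≤ C * ∑ km ∈ s, schwartzSeminormFamily ℂ ℝ E km
          (SchwartzMap.smulLeftCLM E (dilate χ n) h) :=
        mul_le_mul_of_nonneg_left h1 C.2
    _ ≤ C * ∑ km ∈ s, ((2⁻¹ : ℝ) ^ N) ^ n * Q km h := by
        gcongr with km
        exact hQb km n h
    _ = _ := by rw [← Finset.mul_sum]; ring

end Cutoff

/-! ### The dyadic resolution of the identity -/

/-- The symbol of `ψ_j(D)` in the normalization of Mathlib's Fourier transform. -/
def dyadicSymbol (ψ : ℝ → ℂ) (j : ℕ) (ξ : ℝ) : ℂ := dyadic ψ j (2 * Real.pi * ξ)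

theorem IsGenerator.isBoundedSymbol {ψ : ℝ → ℂ} (hψ : IsGenerator ψ) : IsBoundedSymbol ψ :=
  .of_hasCompactSupport hψ.1 (HasCompactSupport.of_support_subset_isCompact isCompact_Icc
    ((subset_tsupport ψ).trans hψ.2.1))

theorem IsGenerator.eq_zero {ψ : ℝ → ℂ} (hψ : IsGenerator ψ) {x : ℝ} (hx : 2 < |x|) : ψ x = 0 := by
  by_contra h
  have := hψ.2.1 (subset_tsupport ψ h)
  exact absurd (abs_le.2 this) (not_le.2 hx)

theorem IsGenerator.eq_one {ψ : ℝ → ℂ} (hψ : IsGenerator ψ) {x : ℝ} (hx : |x| ≤ 1) : ψ x = 1 :=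
  hψ.2.2 x (abs_le.1 hx)

theorem dyadicSymbol_zero (ψ : ℝ → ℂ) :
    dyadicSymbol ψ 0 = dilate (fun ξ => ψ (2 * Real.pi * ξ)) 0 := by
  funext ξ
  simp [dyadicSymbol, dyadic, dilate]

theorem dyadicSymbol_succ (ψ : ℝ → ℂ) (j : ℕ) :
    dyadicSymbol ψ (j + 1) = dilate (fun ξ => ψ (Real.pi * ξ) - ψ (2 * Real.pi * ξ)) j := by
  funext ξ
  simp only [dyadicSymbol, dyadic, dilate, inv_pow]
  congr 2 <;> field_simp
  ring

theorem sum_dyadicSymbol (ψ : ℝ → ℂ) (n : ℕ) (ξ : ℝ) :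
    ∑ j ∈ Finset.range (n + 1), dyadicSymbol ψ j ξ = ψ (2 * Real.pi * ξ / 2 ^ n) := by
  induction n with
  | zero => simp [dyadicSymbol, dyadic]
  | succ n ih => rw [Finset.sum_range_succ, ih]; simp [dyadicSymbol, dyadic]

theorem IsGenerator.isBoundedSymbol_dyadicSymbol {ψ : ℝ → ℂ} (hψ : IsGenerator ψ) (j : ℕ) :
    IsBoundedSymbol (dyadicSymbol ψ j) := by
  cases j with
  | zero =>
    rw [dyadicSymbol_zero]
    exact (hψ.isBoundedSymbol.comp_const_mul _).dilate 0
  | succ j =>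
    rw [dyadicSymbol_succ]
    exact ((hψ.isBoundedSymbol.comp_const_mul _).sub (hψ.isBoundedSymbol.comp_const_mul _)).dilate j

theorem IsGenerator.dyadicSymbol_hasTemperateGrowth {ψ : ℝ → ℂ} (hψ : IsGenerator ψ) (j : ℕ) :
    (dyadicSymbol ψ j).HasTemperateGrowth :=
  (hψ.isBoundedSymbol_dyadicSymbol j).hasTemperateGrowth

theorem IsGenerator.dyadicSymbol_eq_zero_of_lt {ψ : ℝ → ℂ} (hψ : IsGenerator ψ) {j : ℕ} {ξ : ℝ}
    (h : 2 ^ (j + 1) < |2 * Real.pi * ξ|) : dyadicSymbol ψ j ξ = 0 := by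
  have key : ∀ n ≤ j, ψ (2 * Real.pi * ξ / 2 ^ n) = 0 := fun n hn => hψ.eq_zero (by
    rw [abs_div, abs_of_pos (by positivity : (0 : ℝ) < 2 ^ n), lt_div_iff₀ (by positivity)]
    refine lt_of_le_of_lt ?_ h
    rw [← pow_succ']
    exact pow_le_pow_right₀ (by norm_num) (by omega))
  cases j with
  | zero => simpa [dyadicSymbol, dyadic] using key 0 le_rfl
  | succ j => simp [dyadicSymbol, dyadic, key j (by omega), key (j + 1) le_rfl]

theorem IsGenerator.dyadicSymbol_succ_eq_zero_of_le {ψ : ℝ → ℂ} (hψ : IsGenerator ψ) {j : ℕ}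
    {ξ : ℝ} (h : |2 * Real.pi * ξ| ≤ 2 ^ j) : dyadicSymbol ψ (j + 1) ξ = 0 := by
  have key : ∀ n ≥ j, ψ (2 * Real.pi * ξ / 2 ^ n) = 1 := fun n hn => hψ.eq_one (by
    rw [abs_div, abs_of_pos (by positivity : (0 : ℝ) < 2 ^ n), div_le_one (by positivity)]
    exact h.trans (pow_le_pow_right₀ (by norm_num) hn))
  simp [dyadicSymbol, dyadic, key j le_rfl, key (j + 1) (by omega)]

theorem IsGenerator.dyadicSymbol_mul_eq_zero {ψ : ℝ → ℂ} (hψ : IsGenerator ψ) {j k : ℕ}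
    (h : j + 2 ≤ k) : dyadicSymbol ψ j * dyadicSymbol ψ k = 0 := by
  funext ξ
  obtain ⟨k, rfl⟩ : ∃ l, k = l + 1 := ⟨k - 1, by omega⟩
  rcases le_or_gt |2 * Real.pi * ξ| (2 ^ k) with h1 | h1
  · simp [hψ.dyadicSymbol_succ_eq_zero_of_le h1]
  · have : (2 : ℝ) ^ (j + 1) ≤ 2 ^ k := pow_le_pow_right₀ (by norm_num) (by omega)
    simp [hψ.dyadicSymbol_eq_zero_of_lt (this.trans_lt h1)]

/-- The indices `m` with `|m - k| ≤ 1`. -/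
def near (k : ℕ) : Finset ℕ := Finset.Icc (k - 1) (k + 1)

theorem mem_near {k m : ℕ} : m ∈ near k ↔ m ≤ k + 1 ∧ k ≤ m + 1 := by
  rw [near, Finset.mem_Icc]
  omega

theorem card_near_le (k : ℕ) : (near k).card ≤ 3 := by
  rw [near, Nat.card_Icc]
  omega

theorem IsGenerator.dyadicSymbol_mul_eq_zero_of_notMem {ψ : ℝ → ℂ} (hψ : IsGenerator ψ) {j k : ℕ}
    (h : j ∉ near k) : dyadicSymbol ψ j * dyadicSymbol ψ k = 0 := by
  rw [mem_near] at h
  rcases (by omega : j + 2 ≤ k ∨ k + 2 ≤ j) with h | h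
  · exact hψ.dyadicSymbol_mul_eq_zero h
  · rw [mul_comm]
    exact hψ.dyadicSymbol_mul_eq_zero h

theorem IsGenerator.sum_near_dyadicSymbol_mul {ψ : ℝ → ℂ} (hψ : IsGenerator ψ) (k : ℕ) :
    (fun ξ => ∑ m ∈ near k, (dyadicSymbol ψ m * dyadicSymbol ψ k) ξ) = dyadicSymbol ψ k := by
  funext ξ
  have h1 : ∑ m ∈ near k, (dyadicSymbol ψ m * dyadicSymbol ψ k) ξ =
      ∑ m ∈ Finset.range (k + 1 + 1), (dyadicSymbol ψ m * dyadicSymbol ψ k) ξ := by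
    refine Finset.sum_subset (fun m hm => ?_) fun m _ hm => ?_
    · rw [mem_near] at hm
      rw [Finset.mem_range]
      omega
    · rw [hψ.dyadicSymbol_mul_eq_zero_of_notMem hm, Pi.zero_apply]
  rw [h1]
  simp only [Pi.mul_apply]
  rw [← Finset.sum_mul, sum_dyadicSymbol]
  rcases le_or_gt |2 * Real.pi * ξ| (2 ^ (k + 1)) with h | h
  · rw [hψ.eq_one, one_mul]
    rw [abs_div, abs_of_pos (by positivity : (0 : ℝ) < 2 ^ (k + 1)), div_le_one (by positivity)]
    exact h
  · rw [hψ.dyadicSymbol_eq_zero_of_lt h, mul_zero]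

section Operators

variable {X : Type*} [NormedAddCommGroup X] [NormedSpace ℂ X]

theorem dyadicD_apply (ψ : ℝ → ℂ) (j : ℕ) (u : 𝓢'(ℝ, X)) :
    dyadicD ψ j u = TemperedDistribution.fourierMultiplierCLM X (dyadicSymbol ψ j) u := rfl

theorem dyadicS_apply (ψ : ℝ → ℂ) (j : ℕ) (f : 𝓢(ℝ, X)) :
    dyadicS ψ j f = SchwartzMap.fourierMultiplierCLM X (dyadicSymbol ψ j) f := rfl

theorem dyadicD_comm {ψ : ℝ → ℂ} (hψ : IsGenerator ψ) (j k : ℕ) (u : 𝓢'(ℝ, X)) :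
    dyadicD ψ j (dyadicD ψ k u) = dyadicD ψ k (dyadicD ψ j u) := by
  simp only [dyadicD_apply]
  rw [TemperedDistribution.fourierMultiplierCLM_fourierMultiplierCLM_apply
    (hψ.dyadicSymbol_hasTemperateGrowth _) (hψ.dyadicSymbol_hasTemperateGrowth _), mul_comm,
    TemperedDistribution.fourierMultiplierCLM_fourierMultiplierCLM_apply
    (hψ.dyadicSymbol_hasTemperateGrowth _) (hψ.dyadicSymbol_hasTemperateGrowth _)]

theorem dyadicD_dyadicD_eq_zero {ψ : ℝ → ℂ} (hψ : IsGenerator ψ) {j k : ℕ} (h : j ∉ near k)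
    (u : 𝓢'(ℝ, X)) : dyadicD ψ j (dyadicD ψ k u) = 0 := by
  simp only [dyadicD_apply]
  rw [TemperedDistribution.fourierMultiplierCLM_fourierMultiplierCLM_apply
    (hψ.dyadicSymbol_hasTemperateGrowth _) (hψ.dyadicSymbol_hasTemperateGrowth _),
    mul_comm, hψ.dyadicSymbol_mul_eq_zero_of_notMem h]
  have := TemperedDistribution.fourierMultiplierCLM_const (E := ℝ) (F := X) 0
  rw [zero_smul] at this
  exact DFunLike.congr_fun this u

theorem sum_near_dyadicD {ψ : ℝ → ℂ} (hψ : IsGenerator ψ) (k : ℕ) (u : 𝓢'(ℝ, X)) :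
    ∑ m ∈ near k, dyadicD ψ m (dyadicD ψ k u) = dyadicD ψ k u := by
  have h1 : ∀ m, dyadicD ψ m (dyadicD ψ k u) =
      TemperedDistribution.fourierMultiplierCLM X (dyadicSymbol ψ m * dyadicSymbol ψ k) u :=
    fun m => by
      simp only [dyadicD_apply]
      rw [TemperedDistribution.fourierMultiplierCLM_fourierMultiplierCLM_apply
        (hψ.dyadicSymbol_hasTemperateGrowth _) (hψ.dyadicSymbol_hasTemperateGrowth _), mul_comm]
  have h2 := TemperedDistribution.fourierMultiplierCLM_sum X
    (g := fun m => dyadicSymbol ψ m * dyadicSymbol ψ k) (s := near k) fun m _ =>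
      (hψ.dyadicSymbol_hasTemperateGrowth m).mul (hψ.dyadicSymbol_hasTemperateGrowth k)
  rw [hψ.sum_near_dyadicSymbol_mul] at h2
  simp only [h1]
  rw [dyadicD_apply, h2]
  simp

/-- The transpose of `ψ_j(D)`. -/
def dyadicTranspose (ψ : ℝ → ℂ) (j : ℕ) (φ : 𝓢(ℝ, ℂ)) : 𝓢(ℝ, ℂ) :=
  FourierTransform.fourier (SchwartzMap.smulLeftCLM ℂ (dyadicSymbol ψ j)
    (FourierTransformInv.fourierInv φ))

theorem dyadicD_apply_apply (ψ : ℝ → ℂ) (j : ℕ) (u : 𝓢'(ℝ, X)) (φ : 𝓢(ℝ, ℂ)) :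
    dyadicD ψ j u φ = u (dyadicTranspose ψ j φ) := rfl

theorem exists_seminorm_smulLeftCLM_dyadicSymbol_le {ψ : ℝ → ℂ} (hψ : IsGenerator ψ) (N : ℕ)
    (q : Seminorm ℂ 𝓢(ℝ, X)) (hq : Continuous q) :
    ∃ q' : Seminorm ℂ 𝓢(ℝ, X), Continuous q' ∧ ∀ (j : ℕ) (h : 𝓢(ℝ, X)),
      q (SchwartzMap.smulLeftCLM X (dyadicSymbol ψ j) h) ≤ ((2⁻¹ : ℝ) ^ N) ^ j * q' h := by
  have hχ : IsBoundedSymbol (fun ξ => ψ (Real.pi * ξ) - ψ (2 * Real.pi * ξ)) :=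
    (hψ.isBoundedSymbol.comp_const_mul _).sub (hψ.isBoundedSymbol.comp_const_mul _)
  have hpi := Real.pi_pos
  obtain ⟨q₁, hq₁, hb⟩ := exists_seminorm_smulLeftCLM_dilate_le hχ (r := (2 * Real.pi)⁻¹)
    (by positivity) (fun x hx => by
      have h2 : |2 * Real.pi * x| ≤ 1 := by
        rw [abs_mul, abs_of_pos (by positivity)]
        calc 2 * Real.pi * |x| ≤ 2 * Real.pi * (2 * Real.pi)⁻¹ := by gcongr
          _ = 1 := by field_simp
      have h1 : |Real.pi * x| ≤ 1 := by
        rw [mul_assoc, abs_mul, abs_two] at h2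
        linarith [abs_nonneg (Real.pi * x)]
      rw [hψ.eq_one h1, hψ.eq_one h2, sub_self]) N q hq
  let A := SchwartzMap.smulLeftCLM (𝕜 := ℂ) X (dyadicSymbol ψ 0)
  let c : ℝ≥0 := 2 ^ N
  refine ⟨q.comp (A : 𝓢(ℝ, X) →ₗ[ℂ] 𝓢(ℝ, X)) + c • q₁, ?_, fun j h => ?_⟩
  · change Continuous fun h => q (A h) + c * q₁ h
    exact (hq.comp A.continuous).add (continuous_const.mul hq₁)
  change q (SchwartzMap.smulLeftCLM X (dyadicSymbol ψ j) h) ≤ ((2⁻¹ : ℝ) ^ N) ^ j *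
    (q (A h) + (c : ℝ) * q₁ h)
  have hn := apply_nonneg q (A h)
  have hn₁ := apply_nonneg q₁ h
  cases j with
  | zero =>
    rw [pow_zero, one_mul]
    exact le_add_of_nonneg_right (by positivity)
  | succ j =>
    rw [dyadicSymbol_succ]
    refine (hb j h).trans ?_
    calc ((2⁻¹ : ℝ) ^ N) ^ j * q₁ h = ((2⁻¹ : ℝ) ^ N) ^ (j + 1) * ((c : ℝ) * q₁ h) := by
          simp only [c]
          push_cast
          rw [pow_succ, mul_assoc, ← mul_assoc ((2⁻¹ : ℝ) ^ N), ← mul_pow]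
          norm_num
      _ ≤ _ := by
          gcongr
          exact le_add_of_nonneg_left hn

/-- The blocks of a test function decrease faster than any power of `2^{-j}`. -/
theorem exists_seminorm_dyadicS_le {ψ : ℝ → ℂ} (hψ : IsGenerator ψ) (N : ℕ)
    (q : Seminorm ℂ 𝓢(ℝ, X)) (hq : Continuous q) :
    ∃ q' : Seminorm ℂ 𝓢(ℝ, X), Continuous q' ∧ ∀ (j : ℕ) (h : 𝓢(ℝ, X)),
      q (dyadicS ψ j h) ≤ ((2⁻¹ : ℝ) ^ N) ^ j * q' h := by
  obtain ⟨q', hq', hb⟩ := exists_seminorm_smulLeftCLM_dyadicSymbol_le hψ N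
    (q.comp (FourierTransform.fourierInvCLM ℂ 𝓢(ℝ, X) : 𝓢(ℝ, X) →ₗ[ℂ] 𝓢(ℝ, X)))
    (hq.comp (FourierTransform.fourierInvCLM ℂ 𝓢(ℝ, X)).continuous)
  exact ⟨q'.comp (FourierTransform.fourierCLM ℂ 𝓢(ℝ, X) : 𝓢(ℝ, X) →ₗ[ℂ] 𝓢(ℝ, X)),
    hq'.comp (FourierTransform.fourierCLM ℂ 𝓢(ℝ, X)).continuous, fun j h => hb j _⟩

/-- The blocks of a test function decrease faster than any power of `2^{-j}`; version for the
transpose. -/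
theorem exists_seminorm_dyadicTranspose_le {ψ : ℝ → ℂ} (hψ : IsGenerator ψ) (N : ℕ)
    (q : Seminorm ℂ 𝓢(ℝ, ℂ)) (hq : Continuous q) :
    ∃ q' : Seminorm ℂ 𝓢(ℝ, ℂ), Continuous q' ∧ ∀ (j : ℕ) (h : 𝓢(ℝ, ℂ)),
      q (dyadicTranspose ψ j h) ≤ ((2⁻¹ : ℝ) ^ N) ^ j * q' h := by
  obtain ⟨q', hq', hb⟩ := exists_seminorm_smulLeftCLM_dyadicSymbol_le hψ N
    (q.comp (FourierTransform.fourierCLM ℂ 𝓢(ℝ, ℂ) : 𝓢(ℝ, ℂ) →ₗ[ℂ] 𝓢(ℝ, ℂ)))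
    (hq.comp (FourierTransform.fourierCLM ℂ 𝓢(ℝ, ℂ)).continuous)
  exact ⟨q'.comp (FourierTransform.fourierInvCLM ℂ 𝓢(ℝ, ℂ) : 𝓢(ℝ, ℂ) →ₗ[ℂ] 𝓢(ℝ, ℂ)),
    hq'.comp (FourierTransform.fourierInvCLM ℂ 𝓢(ℝ, ℂ)).continuous, fun j h => hb j _⟩

/-- The absolute value of a distribution at a test function is a continuous seminorm. -/
theorem exists_seminorm_apply (u : 𝓢'(ℝ, X)) :
    ∃ q : Seminorm ℂ 𝓢(ℝ, ℂ), Continuous q ∧ ∀ φ, ‖u φ‖ = q φ :=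
  ⟨(normSeminorm ℂ X).comp (u : 𝓢(ℝ, ℂ) →ₗ[ℂ] X), u.continuous.norm, fun _ => rfl⟩

/-- If `χ = 1` near the origin, then multiplication by `χ(2^{-n} ·)` tends to the identity on test
functions. -/
theorem tendsto_seminorm_smulLeftCLM_dilate {χ : ℝ → ℂ} (hχ : IsBoundedSymbol χ) {r : ℝ}
    (hr : 0 < r) (h1 : ∀ x, |x| ≤ r → χ x = 1) (q : Seminorm ℂ 𝓢(ℝ, ℂ)) (hq : Continuous q)
    (φ : 𝓢(ℝ, ℂ)) :
    Tendsto (fun n => q (SchwartzMap.smulLeftCLM ℂ (dilate χ n) φ - φ)) atTop (𝓝 0) := by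
  have hχ' := hχ.sub (.const 1)
  obtain ⟨q', -, hb⟩ := exists_seminorm_smulLeftCLM_dilate_le hχ' hr
    (fun x hx => by rw [h1 x hx, sub_self]) 1 q hq
  have e : ∀ n, SchwartzMap.smulLeftCLM ℂ (dilate χ n) φ - φ =
      SchwartzMap.smulLeftCLM ℂ (dilate (fun x => χ x - 1) n) φ := fun n => by
    ext x
    rw [sub_apply, SchwartzMap.smulLeftCLM_apply_apply (hχ.dilate n).hasTemperateGrowth,
      SchwartzMap.smulLeftCLM_apply_apply (hχ'.dilate n).hasTemperateGrowth]
    simp [dilate, sub_mul]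
  refine squeeze_zero (fun n => apply_nonneg q _) (fun n => (e n ▸ hb n φ :)) ?_
  simpa using (tendsto_pow_atTop_nhds_zero_of_lt_one (by norm_num : (0 : ℝ) ≤ (2⁻¹) ^ 1)
    (by norm_num)).mul_const (q' φ)

/-- A tempered distribution is determined by its values at compactly supported test functions. -/
theorem eq_zero_of_hasCompactSupport {u : 𝓢'(ℝ, X)} {ψ : ℝ → ℂ} (hψ : IsGenerator ψ)
    (h : ∀ φ : 𝓢(ℝ, ℂ), HasCompactSupport φ → u φ = 0) : u = 0 := by
  ext φ
  obtain ⟨q, hq, hqu⟩ := exists_seminorm_apply u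
  have ht := tendsto_seminorm_smulLeftCLM_dilate hψ.isBoundedSymbol one_pos
    (fun x => hψ.eq_one) q hq φ
  have e : ∀ n, q (SchwartzMap.smulLeftCLM ℂ (dilate ψ n) φ - φ) = ‖u φ‖ := fun n => by
    rw [← hqu, map_sub, h, zero_sub, norm_neg]
    have hc : HasCompactSupport (dilate ψ n) := by
      refine HasCompactSupport.intro (isCompact_Icc (a := -2 ^ (n + 1)) (b := 2 ^ (n + 1))) ?_
      intro x hx
      refine hψ.eq_zero ?_
      rw [mem_Icc, ← abs_le, not_le] at hx
      rw [abs_mul, abs_of_pos (by positivity), inv_pow, inv_mul_eq_div, lt_div_iff₀ (by positivity),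
        ← pow_succ']
      exact hx
    rw [SchwartzMap.smulLeftCLM_apply (hψ.isBoundedSymbol.dilate n).hasTemperateGrowth]
    exact hc.smul_right
  simp only [e] at ht
  have := tendsto_nhds_unique ht tendsto_const_nhds
  simpa using this.symm

/-- The Littlewood–Paley decomposition of a tempered distribution converges weakly. -/
theorem tendsto_sum_dyadicD {ψ : ℝ → ℂ} (hψ : IsGenerator ψ) (u : 𝓢'(ℝ, X)) (φ : 𝓢(ℝ, ℂ)) :
    Tendsto (fun n => ∑ k ∈ Finset.range n, dyadicD ψ k u φ) atTop (𝓝 (u φ)) := by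
  rw [← tendsto_add_atTop_iff_nat 1, tendsto_iff_norm_sub_tendsto_zero]
  set χ : ℝ → ℂ := fun ξ => ψ (2 * Real.pi * ξ) with hχd
  have hpi := Real.pi_pos
  have hχ : IsBoundedSymbol χ := hψ.isBoundedSymbol.comp_const_mul _
  obtain ⟨q, hq, hqu⟩ := exists_seminorm_apply u
  have ht := tendsto_seminorm_smulLeftCLM_dilate hχ (r := (2 * Real.pi)⁻¹) (by positivity)
    (fun x hx => hψ.eq_one (by
      rw [abs_mul, abs_of_pos (by positivity)]
      calc 2 * Real.pi * |x| ≤ 2 * Real.pi * (2 * Real.pi)⁻¹ := by gcongr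
        _ = 1 := by field_simp))
    (q.comp (FourierTransform.fourierCLM ℂ 𝓢(ℝ, ℂ) : 𝓢(ℝ, ℂ) →ₗ[ℂ] 𝓢(ℝ, ℂ)))
    (hq.comp (FourierTransform.fourierCLM ℂ 𝓢(ℝ, ℂ)).continuous)
    (FourierTransformInv.fourierInv φ)
  refine ht.congr fun n => ?_
  have e1 : ∑ k ∈ Finset.range (n + 1), SchwartzMap.smulLeftCLM ℂ (dyadicSymbol ψ k)
      (FourierTransformInv.fourierInv φ) =
      SchwartzMap.smulLeftCLM ℂ (dilate χ n) (FourierTransformInv.fourierInv φ) := by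
    have := SchwartzMap.smulLeftCLM_sum (F := ℂ) (s := Finset.range (n + 1))
      (g := fun k => dyadicSymbol ψ k) fun k _ => hψ.dyadicSymbol_hasTemperateGrowth k
    have e2 : (fun ξ => ∑ k ∈ Finset.range (n + 1), dyadicSymbol ψ k ξ) = dilate χ n := by
      funext ξ
      rw [sum_dyadicSymbol, dilate, hχd, inv_pow]
      congr 1
      field_simp
    rw [e2] at this
    rw [this]
    simp
  have e3 : ∑ k ∈ Finset.range (n + 1), dyadicD ψ k u φ =
      u (FourierTransform.fourierCLM ℂ 𝓢(ℝ, ℂ) (SchwartzMap.smulLeftCLM ℂ (dilate χ n)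
        (FourierTransformInv.fourierInv φ))) := by
    rw [← e1, map_sum, map_sum]
    rfl
  have e4 : u φ = u (FourierTransform.fourierCLM ℂ 𝓢(ℝ, ℂ) (FourierTransformInv.fourierInv φ)) := by
    congr 1
    rw [FourierTransform.fourierCLM_apply]
    exact (FourierTransform.fourier_fourierInv_eq φ).symm
  rw [e3, e4, ← map_sub, ← map_sub, hqu]
  rfl

end Operators

/-! ### Regular tempered distributions -/

theorem exists_isGenerator : ∃ ψ : ℝ → ℂ, IsGenerator ψ := by
  let b : ContDiffBump (0 : ℝ) := ⟨1, 2, one_pos, one_lt_two⟩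
  refine ⟨fun x => (b x : ℂ), Complex.ofRealCLM.contDiff.comp b.contDiff, ?_, fun ξ hξ => ?_⟩
  · have h1 : tsupport (fun x => (b x : ℂ)) ⊆ tsupport b := by
      refine closure_mono fun x hx => ?_
      simpa using hx
    refine h1.trans ?_
    rw [b.tsupport_eq, Real.closedBall_eq_Icc]
    simp [b]
  · change ((b ξ : ℝ) : ℂ) = 1
    rw [b.one_of_mem_closedBall, Complex.ofReal_one]
    rw [Real.closedBall_eq_Icc]
    simpa [b] using hξ

theorem locallyIntegrable_of_lintegral_decayFn {X : Type*} [NormedAddCommGroup X]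
    {g : ℝ → X} (hg : AEStronglyMeasurable g volume)
    (hgD : ∫⁻ t, ‖g t‖ₑ * decayFn t ≠ ∞) : LocallyIntegrable g volume := by
  rw [locallyIntegrable_iff]
  intro k hk
  obtain ⟨R, hR⟩ := hk.isBounded.exists_norm_le
  refine ⟨hg.restrict, ?_⟩
  calc ∫⁻ t in k, ‖g t‖ₑ ≤ ∫⁻ t in k, ENNReal.ofReal (1 + R) * (‖g t‖ₑ * decayFn t) := by
        refine setLIntegral_mono' hk.measurableSet fun t ht => ?_
        have h1 : 1 ≤ ENNReal.ofReal (1 + R) * decayFn t := by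
          have := hR t ht
          rw [Real.norm_eq_abs] at this
          rw [decayFn, ← ENNReal.ofReal_mul (by linarith [abs_nonneg t]), ENNReal.one_le_ofReal,
            ← div_eq_mul_inv, one_le_div (by positivity)]
          linarith
        calc ‖g t‖ₑ = ‖g t‖ₑ * 1 := (mul_one _).symm
          _ ≤ ‖g t‖ₑ * (ENNReal.ofReal (1 + R) * decayFn t) := by gcongr
          _ = _ := by ring
    _ ≤ ∫⁻ t, ENNReal.ofReal (1 + R) * (‖g t‖ₑ * decayFn t) := setLIntegral_le_lintegral _ _
    _ < ∞ := by
        rw [lintegral_const_mul' _ _ ENNReal.ofReal_ne_top]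
        exact ENNReal.mul_lt_top ENNReal.ofReal_lt_top hgD.lt_top

section Regular

variable {X : Type*} [NormedAddCommGroup X] [NormedSpace ℂ X]

theorem Represents.sub {u v : 𝓢'(ℝ, X)} {g h : ℝ → X} (hu : Represents u g)
    (hv : Represents v h) : Represents (u - v) (fun t => g t - h t) := by
  have := hu.add (hv.smul (-1))
  simp only [neg_smul, one_smul, ← sub_eq_add_neg] at this
  exact this

theorem Represents.sum {ι : Type*} (s : Finset ι) {u : ι → 𝓢'(ℝ, X)} {g : ι → ℝ → X}
    (h : ∀ i ∈ s, Represents (u i) (g i)) :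
    Represents (∑ i ∈ s, u i) (fun t => ∑ i ∈ s, g i t) := by
  classical
  induction s using Finset.induction_on with
  | empty => simpa using Represents.zero
  | insert i s his ih =>
    simp only [Finset.sum_insert his]
    exact (h i (Finset.mem_insert_self _ _)).add
      (ih fun j hj => h j (Finset.mem_insert_of_mem hj))

theorem Represents.ae_eq [CompleteSpace X] {u : 𝓢'(ℝ, X)} {g h : ℝ → X} (hg : Represents u g)
    (hh : Represents u h) : g =ᵐ[volume] h := by
  refine ae_eq_of_integral_contDiff_smul_eq hg.1 hh.1 fun η hη hηc => ?_
  have h₁ : HasCompactSupport (Complex.ofRealCLM ∘ η) := hηc.comp_left rfl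
  have h₂ : ContDiff ℝ (⊤ : ℕ∞) (Complex.ofRealCLM ∘ η) := Complex.ofRealCLM.contDiff.comp hη
  have := (hg.2 (h₁.toSchwartzMap h₂) h₁).symm.trans (hh.2 (h₁.toSchwartzMap h₂) h₁)
  simpa using this

theorem Represents.eq {u v : 𝓢'(ℝ, X)} {g : ℝ → X} (hu : Represents u g) (hv : Represents v g) :
    u = v := by
  obtain ⟨ψ, hψ⟩ := exists_isGenerator
  rw [← sub_eq_zero]
  refine eq_zero_of_hasCompactSupport hψ fun φ hφ => ?_
  have : (u - v) φ = u φ - v φ := rfl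
  rw [this, hu.2 φ hφ, hv.2 φ hφ, sub_self]

theorem Represents.distNorm_eq [CompleteSpace X] (Φ : BanachFunctionSpace) {u : 𝓢'(ℝ, X)}
    {g : ℝ → X} (hu : Represents u g) : distNorm Φ.norm u = Φ.norm (fun t => ‖g t‖ₑ) := by
  refine le_antisymm (iInf₂_le g hu) (le_iInf₂ fun h hh => le_of_eq ?_)
  refine Φ.norm_congr_ae hu.aemeasurable ?_
  filter_upwards [hu.ae_eq hh] with t ht
  rw [ht]

theorem exists_represents_of_distNorm_lt_top {ρ : (ℝ → ℝ≥0∞) → ℝ≥0∞} {u : 𝓢'(ℝ, X)}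
    (h : distNorm ρ u < ∞) : ∃ g, Represents u g := by
  simp only [distNorm, iInf_lt_iff] at h
  obtain ⟨g, hg, -⟩ := h
  exact ⟨g, hg⟩

/-- A continuous seminorm that dominates `(1 + |t|) ‖φ t‖`. -/
def decaySeminorm (X : Type*) [NormedAddCommGroup X] [NormedSpace ℂ X] : Seminorm ℂ 𝓢(ℝ, X) :=
  SchwartzMap.seminorm ℂ 0 0 + SchwartzMap.seminorm ℂ 1 0

theorem continuous_decaySeminorm : Continuous (decaySeminorm X) :=
  ((schwartz_withSeminorms ℂ ℝ X).continuous_seminorm (0, 0)).add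
    ((schwartz_withSeminorms ℂ ℝ X).continuous_seminorm (1, 0))

theorem enorm_le_decaySeminorm (φ : 𝓢(ℝ, X)) (t : ℝ) :
    ‖φ t‖ₑ ≤ ENNReal.ofReal (decaySeminorm X φ) * decayFn t := by
  rw [decayFn, ← ENNReal.ofReal_mul (apply_nonneg _ _), ← ofReal_norm]
  refine ENNReal.ofReal_le_ofReal ?_
  rw [← div_eq_mul_inv, le_div_iff₀ (by positivity)]
  have h0 := SchwartzMap.norm_pow_mul_le_seminorm ℂ φ 0 t
  have h1 := SchwartzMap.norm_pow_mul_le_seminorm ℂ φ 1 t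
  rw [pow_zero, one_mul] at h0
  rw [pow_one, Real.norm_eq_abs] at h1
  calc ‖φ t‖ * (1 + |t|) = ‖φ t‖ + |t| * ‖φ t‖ := by ring
    _ ≤ _ := add_le_add h0 h1

theorem exists_temperedDistribution_of_le (A : 𝓢(ℝ, ℂ) →ₗ[ℂ] X) {q : Seminorm ℂ 𝓢(ℝ, ℂ)}
    (hq : Continuous q) (h : ∀ φ, ‖A φ‖ ≤ q φ) : ∃ u : 𝓢'(ℝ, X), ∀ φ, u φ = A φ := by
  have hA : Continuous A := by
    refine continuous_of_continuousAt_zero A ?_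
    rw [ContinuousAt, map_zero]
    refine squeeze_zero_norm h ?_
    have := hq.tendsto 0
    rwa [map_zero] at this
  exact ⟨ContinuousLinearMap.toPointwiseConvergenceCLM ℂ (RingHom.id ℂ) _ _ ⟨A, hA⟩, fun _ => rfl⟩

theorem lintegral_enorm_smul_le {g : ℝ → X} (φ : 𝓢(ℝ, ℂ)) :
    ∫⁻ t, ‖φ t • g t‖ₑ ≤ ENNReal.ofReal (decaySeminorm ℂ φ) * ∫⁻ t, ‖g t‖ₑ * decayFn t := by
  rw [← lintegral_const_mul' _ _ ENNReal.ofReal_ne_top]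
  refine lintegral_mono fun t => ?_
  rw [enorm_smul]
  calc _ ≤ ENNReal.ofReal (decaySeminorm ℂ φ) * decayFn t * ‖g t‖ₑ := by
        gcongr
        exact enorm_le_decaySeminorm φ t
    _ = _ := by ring

theorem integrable_schwartz_smul {g : ℝ → X} (hg : AEStronglyMeasurable g volume)
    (hgD : ∫⁻ t, ‖g t‖ₑ * decayFn t ≠ ∞) (φ : 𝓢(ℝ, ℂ)) : Integrable (fun t => φ t • g t) := by
  refine ⟨φ.continuous.aestronglyMeasurable.smul hg, ?_⟩
  exact (lintegral_enorm_smul_le φ).trans_lt (ENNReal.mul_lt_top ENNReal.ofReal_lt_top hgD.lt_top)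

/-- A function `g` with `∫ |g(t)| / (1 + |t|) dt < ∞` defines a tempered distribution. -/
theorem exists_represents {g : ℝ → X} (hg : AEStronglyMeasurable g volume)
    (hgD : ∫⁻ t, ‖g t‖ₑ * decayFn t ≠ ∞) :
    ∃ u : 𝓢'(ℝ, X), Represents u g ∧ ∀ φ : 𝓢(ℝ, ℂ), u φ = ∫ t, φ t • g t := by
  let A : 𝓢(ℝ, ℂ) →ₗ[ℂ] X :=
    { toFun := fun φ => ∫ t, φ t • g t
      map_add' := fun φ η => by
        rw [← integral_add (integrable_schwartz_smul hg hgD φ) (integrable_schwartz_smul hg hgD η)]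
        refine integral_congr_ae (.of_forall fun t => ?_)
        simp [add_smul]
      map_smul' := fun c φ => by
        rw [RingHom.id_apply, ← integral_smul]
        refine integral_congr_ae (.of_forall fun t => ?_)
        simp [mul_smul] }
  let c : ℝ≥0 := (∫⁻ t, ‖g t‖ₑ * decayFn t).toNNReal
  have hc : (c : ℝ≥0∞) = ∫⁻ t, ‖g t‖ₑ * decayFn t := ENNReal.coe_toNNReal hgD
  obtain ⟨u, hu⟩ := exists_temperedDistribution_of_le A (q := c • decaySeminorm ℂ)
    (continuous_const.mul continuous_decaySeminorm) fun φ => by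
      have h1 : ‖A φ‖ₑ ≤ ENNReal.ofReal (decaySeminorm ℂ φ) * c :=
        (enorm_integral_le_lintegral_enorm _).trans ((lintegral_enorm_smul_le φ).trans_eq
          (by rw [hc]))
      have h2 := ENNReal.toReal_mono (ENNReal.mul_ne_top ENNReal.ofReal_ne_top ENNReal.coe_ne_top)
        h1
      rw [toReal_enorm, ENNReal.toReal_mul, ENNReal.toReal_ofReal (apply_nonneg _ _),
        ENNReal.coe_toReal, mul_comm] at h2
      exact h2
  exact ⟨u, ⟨locallyIntegrable_of_lintegral_decayFn hg hgD, fun φ _ => hu φ⟩, hu⟩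

/-- The representation of a distribution extends from compactly supported test functions to all of
them. -/
theorem Represents.apply_eq {u : 𝓢'(ℝ, X)} {g : ℝ → X} (hu : Represents u g)
    (hgD : ∫⁻ t, ‖g t‖ₑ * decayFn t ≠ ∞) (φ : 𝓢(ℝ, ℂ)) : u φ = ∫ t, φ t • g t := by
  obtain ⟨v, hv, hvφ⟩ := exists_represents hu.1.aestronglyMeasurable hgD
  rw [hu.eq hv, hvφ]

theorem represents_schwartz [CompleteSpace X] (φ : 𝓢(ℝ, X)) : Represents (φ : 𝓢'(ℝ, X)) φ :=
  ⟨φ.continuous.locallyIntegrable, fun η _ => by simp⟩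

end Regular

/-! ### Banach function spaces between weighted `L^1` and weighted `L^∞` -/

/-- The function `1 / (1 + |t|)` belongs to `Φ` and to its Köthe dual. -/
structure BanachFunctionSpace.IsTame (Φ : BanachFunctionSpace) : Prop where
  norm_lt_top : Φ.norm decayFn < ∞
  dualNorm_lt_top : Φ.dualNorm decayFn < ∞

theorem BanachFunctionSpace.isTame (Φ : BanachFunctionSpace) {A B : ℝ≥0}
    (hA : MaximalBoundedWith Φ.norm A) (hB : MaximalBoundedWith Φ.dualNorm B) : Φ.IsTame := by
  obtain ⟨h, hh, hh0, hh1⟩ := Φ.exists_dualNorm_lt_top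
  exact ⟨Φ.norm_decayFn_lt_top hA,
    Φ.dualNorm_decayFn_lt_top hB hh hh0 (hh1.trans_lt ENNReal.one_lt_top)⟩

theorem weightedSpace_isTame {p : ℝ} (hp : 1 < p) {w : ℝ → ℝ≥0∞} (hw : IsMuckenhoupt p w) :
    (weightedSpace hp hw).IsTame := by
  have h := hw.2.2
  lift apConst p w to ℝ≥0 using h.ne with K hK
  exact BanachFunctionSpace.isTame _ (weightedSpace_maximalBounded hp hw hK.symm.le)
    (weightedSpace_dual_maximalBounded hp hw hK.symm.le)

namespace BanachFunctionSpace.IsTame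

variable {X : Type*} [NormedAddCommGroup X] [NormedSpace ℂ X] {Φ : BanachFunctionSpace}

theorem lintegral_mul_decayFn_ne_top (hΦ : Φ.IsTame) {f : ℝ → ℝ≥0∞} (hf : AEMeasurable f volume)
    (h : Φ.norm f ≠ ∞) : ∫⁻ t, f t * decayFn t ≠ ∞ :=
  ((Φ.lintegral_mul_le hf h).trans_lt
    (ENNReal.mul_lt_top h.lt_top hΦ.dualNorm_lt_top)).ne

variable [CompleteSpace X]

theorem enorm_apply_le (hΦ : Φ.IsTame) {u : 𝓢'(ℝ, X)} (hu : distNorm Φ.norm u < ∞)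
    (φ : 𝓢(ℝ, ℂ)) : ‖u φ‖ₑ ≤
      ENNReal.ofReal (decaySeminorm ℂ φ) * (distNorm Φ.norm u * Φ.dualNorm decayFn) := by
  obtain ⟨g, hg⟩ := exists_represents_of_distNorm_lt_top hu
  rw [hg.distNorm_eq] at hu ⊢
  rw [hg.apply_eq (hΦ.lintegral_mul_decayFn_ne_top hg.aemeasurable hu.ne)]
  refine (enorm_integral_le_lintegral_enorm _).trans ((lintegral_enorm_smul_le φ).trans ?_)
  gcongr
  exact Φ.lintegral_mul_le hg.aemeasurable hu.ne

theorem eq_zero (hΦ : Φ.IsTame) {u : 𝓢'(ℝ, X)} (hu : distNorm Φ.norm u = 0) : u = 0 := by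
  ext φ
  have := hΦ.enorm_apply_le (hu.trans_lt ENNReal.zero_lt_top) φ
  rw [hu, zero_mul, mul_zero, nonpos_iff_eq_zero, enorm_eq_zero] at this
  exact this

theorem tendsto_apply (hΦ : Φ.IsTame) {u : ℕ → 𝓢'(ℝ, X)} {v : 𝓢'(ℝ, X)}
    (h : Tendsto (fun n => distNorm Φ.norm (v - u n)) atTop (𝓝 0)) (φ : 𝓢(ℝ, ℂ)) :
    Tendsto (fun n => u n φ) atTop (𝓝 (v φ)) := by
  rw [tendsto_iff_edist_tendsto_0]
  have h1 : Tendsto (fun n => ENNReal.ofReal (decaySeminorm ℂ φ) *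
      (distNorm Φ.norm (v - u n) * Φ.dualNorm decayFn)) atTop (𝓝 0) := by
    have := ENNReal.Tendsto.const_mul (a := ENNReal.ofReal (decaySeminorm ℂ φ))
      (ENNReal.Tendsto.mul_const h (.inr hΦ.dualNorm_lt_top.ne)) (.inr ENNReal.ofReal_ne_top)
    simpa using this
  refine tendsto_of_tendsto_of_tendsto_of_le_of_le' tendsto_const_nhds h1
    (.of_forall fun n => zero_le) ?_
  filter_upwards [h.eventually_lt_const ENNReal.zero_lt_top] with n hn
  rw [edist_comm, edist_eq_enorm_sub]
  exact hΦ.enorm_apply_le hn φ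

theorem distNorm_schwartz_le (φ : 𝓢(ℝ, X)) :
    distNorm Φ.norm (φ : 𝓢'(ℝ, X)) ≤ ENNReal.ofReal (decaySeminorm X φ) * Φ.norm decayFn := by
  rw [(represents_schwartz φ).distNorm_eq]
  refine (Φ.norm_mono _ _ (represents_schwartz φ).aemeasurable
    (measurable_decayFn.const_mul _).aemeasurable (.of_forall (enorm_le_decaySeminorm φ))).trans ?_
  exact (Φ.norm_const_mul _ _ measurable_decayFn.aemeasurable).le

theorem distNorm_schwartz_lt_top (hΦ : Φ.IsTame) (φ : 𝓢(ℝ, X)) :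
    distNorm Φ.norm (φ : 𝓢'(ℝ, X)) < ∞ :=
  (distNorm_schwartz_le φ).trans_lt (ENNReal.mul_lt_top ENNReal.ofReal_lt_top hΦ.norm_lt_top)

/-- The Riesz–Fischer property of `Φ(X)`. -/
theorem exists_tsum (hΦ : Φ.IsTame) {z : ℕ → 𝓢'(ℝ, X)}
    (hz : ∑' n, distNorm Φ.norm (z n) ≠ ∞) :
    ∃ v : 𝓢'(ℝ, X), ∀ n, distNorm Φ.norm (v - ∑ k ∈ Finset.range n, z k) ≤
      ∑' k, distNorm Φ.norm (z (k + n)) := by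
  have hz' : ∀ n, distNorm Φ.norm (z n) < ∞ := fun n =>
    (ENNReal.le_tsum n).trans_lt hz.lt_top
  choose g hg using fun n => exists_represents_of_distNorm_lt_top (hz' n)
  simp only [(hg _).distNorm_eq Φ] at hz ⊢
  have hm : ∀ n, AEMeasurable (fun t => ‖g n t‖ₑ) volume := fun n => (hg n).aemeasurable
  have hfin : ∀ᵐ t ∂volume, ∑' n, ‖g n t‖ₑ < ∞ :=
    Φ.ae_lt_top_of_norm_ne_top (AEMeasurable.tsum hm)
      ((Φ.norm_tsum_le hm).trans_lt hz.lt_top).ne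
  have hsum : ∀ᵐ t ∂volume, Summable fun n => g n t := by
    filter_upwards [hfin] with t ht
    have : Summable fun n => ‖g n t‖₊ := ENNReal.tsum_coe_ne_top_iff_summable.1 ht.ne
    exact Summable.of_nnnorm this
  have hGm : AEStronglyMeasurable (fun t => ∑' n, g n t) volume := by
    refine aestronglyMeasurable_of_tendsto_ae atTop
      (f := fun n t => ∑ k ∈ Finset.range n, g k t) (fun n => ?_) ?_
    · exact Finset.aestronglyMeasurable_fun_sum _ fun k _ => (hg k).1.aestronglyMeasurable
    · filter_upwards [hsum] with t ht using ht.hasSum.tendsto_sum_nat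
  have hGt : Φ.norm (fun t => ‖∑' n, g n t‖ₑ) ≠ ∞ := by
    refine ((Φ.norm_mono _ _ hGm.enorm (AEMeasurable.tsum hm) ?_).trans_lt
      ((Φ.norm_tsum_le hm).trans_lt hz.lt_top)).ne
    exact .of_forall fun t => enorm_tsum_le_tsum_enorm
  obtain ⟨v, hv, -⟩ := exists_represents hGm (hΦ.lintegral_mul_decayFn_ne_top hGm.enorm hGt)
  refine ⟨v, fun n => ?_⟩
  have hr := hv.sub (Represents.sum (Finset.range n) fun k _ => hg k)
  rw [hr.distNorm_eq]
  refine (Φ.norm_mono _ _ hr.aemeasurable (AEMeasurable.tsum fun k => hm (k + n)) ?_).trans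
    (Φ.norm_tsum_le fun k => hm (k + n))
  filter_upwards [hsum] with t ht
  rw [← ht.sum_add_tsum_nat_add n, add_sub_cancel_left]
  exact enorm_tsum_le_tsum_enorm

end BanachFunctionSpace.IsTame

/-- Test functions are dense in `L^p_w(X)`. -/
theorem exists_schwartz_distNorm_sub_le {X : Type*} [NormedAddCommGroup X] [NormedSpace ℂ X]
    [CompleteSpace X] {p : ℝ} (hp : 1 < p) {w : ℝ → ℝ≥0∞} (hw : IsMuckenhoupt p w)
    {u : 𝓢'(ℝ, X)} (hu : distNorm (weightedNorm p w) u < ∞) {ε : ℝ} (hε : 0 < ε) :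
    ∃ φ : 𝓢(ℝ, X), distNorm (weightedNorm p w) (u - (φ : 𝓢'(ℝ, X))) ≤ ENNReal.ofReal ε := by
  obtain ⟨g, hg⟩ := exists_represents_of_distNorm_lt_top hu
  have hp0 : 0 < p := by linarith
  have := hw.isLocallyFinite hp
  have hpt : (ENNReal.ofReal p).toReal = p := ENNReal.toReal_ofReal hp0.le
  have key : ∀ f : ℝ → X, AEStronglyMeasurable f volume →
      eLpNorm f (ENNReal.ofReal p) (volume.withDensity w) =
        weightedNorm p w (fun t => ‖f t‖ₑ) := fun f hf => by
    rw [eLpNorm_eq_lintegral_rpow_enorm_toReal (by simpa using hp0) ENNReal.ofReal_ne_top, hpt,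
      weightedNorm_eq hw.1 hf.enorm]
  have hgm := hg.1.aestronglyMeasurable
  have hgL : MemLp g (ENNReal.ofReal p) (volume.withDensity w) := by
    refine ⟨hgm.mono_ac (withDensity_absolutelyContinuous _ _), ?_⟩
    rw [key g hgm]
    exact (hg.distNorm_eq (weightedSpace hp hw)).symm.trans_lt hu
  obtain ⟨f, hfc, hfs, hf⟩ := hgL.exist_eLpNorm_sub_le ENNReal.ofReal_ne_top
    (by rw [ENNReal.one_le_ofReal]; exact hp.le) hε
  let φ : 𝓢(ℝ, X) := hfc.toSchwartzMap hfs
  refine ⟨φ, ?_⟩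
  have hr := hg.sub (represents_schwartz φ)
  refine (hr.distNorm_eq (weightedSpace hp hw)).trans_le (le_trans (le_of_eq ?_) hf)
  exact (key (g - f) (hgm.sub hfs.continuous.aestronglyMeasurable)).symm

/-! ### Pointwise bound of the dyadic multipliers by the maximal function -/

/-- A radially decreasing majorant as a superposition of indicators of dyadic intervals. -/
theorem ofReal_one_add_abs_pow_le_tsum (y : ℝ) :
    ENNReal.ofReal ((1 + |y|) ^ 2)⁻¹ ≤
      ∑' i : ℕ, 4 * (4⁻¹ : ℝ≥0∞) ^ i * (Ioo (-(2 : ℝ) ^ i) (2 ^ i)).indicator 1 y := by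
  have h4 : ∀ k : ℕ, 4 * (4⁻¹ : ℝ≥0∞) ^ k = ENNReal.ofReal (4 * (4⁻¹) ^ k) := fun k => by
    rw [ENNReal.ofReal_mul (by norm_num), ENNReal.ofReal_pow (by norm_num),
      ENNReal.ofReal_inv_of_pos (by norm_num)]
    simp
  have hex : ∃ k : ℕ, |y| < 2 ^ k := pow_unbounded_of_one_lt _ one_lt_two
  classical
  set k := Nat.find hex with hk
  have hk1 : |y| < 2 ^ k := Nat.find_spec hex
  refine le_trans ?_ (ENNReal.le_tsum k)
  rw [indicator_of_mem (by rw [mem_Ioo, ← abs_lt]; exact hk1), Pi.one_apply, mul_one, h4]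
  refine ENNReal.ofReal_le_ofReal ?_
  rcases Nat.eq_zero_or_pos k with h0 | h0
  · rw [h0, pow_zero]
    have : 1 ≤ (1 + |y|) ^ 2 := one_le_pow₀ (by linarith [abs_nonneg y])
    linarith [inv_le_one_of_one_le₀ this]
  · obtain ⟨l, hl⟩ : ∃ l, k = l + 1 := ⟨k - 1, by omega⟩
    have h1 : (2 : ℝ) ^ l ≤ |y| := by
      have := Nat.find_min hex (m := l) (by omega)
      exact not_lt.1 this
    rw [hl, pow_succ, inv_pow]
    have : (4 : ℝ) ^ l ≤ (1 + |y|) ^ 2 := by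
      calc (4 : ℝ) ^ l = (2 ^ l) ^ 2 := by rw [← pow_mul, mul_comm, pow_mul]; norm_num
        _ ≤ _ := by gcongr; linarith
    calc ((1 + |y|) ^ 2)⁻¹ ≤ (4 ^ l)⁻¹ := inv_anti₀ (by positivity) this
      _ = _ := by ring

theorem lintegral_indicator_mul_le_maximalFn (f : ℝ → ℝ≥0∞) (t : ℝ) (i n : ℕ) :
    ∫⁻ y, 2 ^ n * (Ioo (-(2 : ℝ) ^ i) (2 ^ i)).indicator 1 (2 ^ n * y) * f (t - y) ≤
      2 * 2 ^ i * maximalFn f t := by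
  set R : ℝ := 2 ^ i / 2 ^ n with hR
  have hR0 : 0 < R := by positivity
  have e : ∀ y, (2 : ℝ≥0∞) ^ n * (Ioo (-(2 : ℝ) ^ i) (2 ^ i)).indicator 1 (2 ^ n * y) * f (t - y) =
      (fun x => 2 ^ n * (Ioo (t - R) (t + R)).indicator f x) (t - y) := fun y => by
    have : 2 ^ n * y ∈ Ioo (-(2 : ℝ) ^ i) (2 ^ i) ↔ t - y ∈ Ioo (t - R) (t + R) := by
      rw [mem_Ioo, ← abs_lt, mem_Ioo, abs_mul, abs_of_pos (by positivity), mul_comm,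
        ← lt_div_iff₀ (by positivity), ← hR, abs_lt]
      constructor <;> rintro ⟨h1, h2⟩ <;> constructor <;> linarith
    by_cases hy : 2 ^ n * y ∈ Ioo (-(2 : ℝ) ^ i) (2 ^ i)
    · simp [indicator_of_mem hy, indicator_of_mem (this.1 hy)]
    · simp [indicator_of_notMem hy, indicator_of_notMem (this.not.1 hy)]
  simp only [e]
  rw [lintegral_sub_left_eq_self (fun x => 2 ^ n * (Ioo (t - R) (t + R)).indicator f x) t,
    lintegral_const_mul' _ _ (by simp), lintegral_indicator measurableSet_Ioo]
  have h1 := average_le_maximalFn f (a := t - R) (b := t + R) (t := t)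
    ⟨by linarith, by linarith⟩
  rw [ENNReal.div_le_iff_le_mul (.inl (by simp [hR0])) (.inl ENNReal.ofReal_ne_top)] at h1
  calc (2 : ℝ≥0∞) ^ n * ∫⁻ x in Ioo (t - R) (t + R), f x
      ≤ 2 ^ n * (maximalFn f t * ENNReal.ofReal (t + R - (t - R))) := by gcongr
    _ = 2 * 2 ^ i * maximalFn f t := by
        have : t + R - (t - R) = 2 * 2 ^ i * ((2 ^ n)⁻¹) := by rw [hR]; ring
        rw [this, ENNReal.ofReal_mul (by positivity), ENNReal.ofReal_mul (by positivity),
          ENNReal.ofReal_inv_of_pos (by positivity), ENNReal.ofReal_pow (by positivity),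
          ENNReal.ofReal_pow (by positivity)]
        simp only [ENNReal.ofReal_ofNat]
        calc (2 : ℝ≥0∞) ^ n * (maximalFn f t * (2 * 2 ^ i * (2 ^ n)⁻¹))
            = 2 * 2 ^ i * maximalFn f t * (2 ^ n * (2 ^ n)⁻¹) := by ring
          _ = _ := by rw [ENNReal.mul_inv_cancel (by simp) (by simp), mul_one]

/-- Convolution with an `L^1`-normalized dilate of a kernel that is `O((1 + |y|)^{-2})` is dominated
by the maximal function. -/
theorem lintegral_dilate_mul_le_maximalFn {κ : ℝ → ℝ≥0∞} {c : ℝ≥0∞}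
    (hκ : ∀ y, κ y ≤ c * ENNReal.ofReal ((1 + |y|) ^ 2)⁻¹) {f : ℝ → ℝ≥0∞}
    (hf : Measurable f) (t : ℝ) (n : ℕ) :
    ∫⁻ y, 2 ^ n * κ (2 ^ n * y) * f (t - y) ≤ c * 16 * maximalFn f t := by
  have hind : ∀ i : ℕ, Measurable fun y : ℝ =>
      2 ^ n * (Ioo (-(2 : ℝ) ^ i) (2 ^ i)).indicator (1 : ℝ → ℝ≥0∞) (2 ^ n * y) * f (t - y) :=
    fun i => (((measurable_one.indicator measurableSet_Ioo).comp
      (measurable_const_mul _)).const_mul _).mul (hf.comp (measurable_const.sub measurable_id))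
  calc ∫⁻ y, 2 ^ n * κ (2 ^ n * y) * f (t - y)
      ≤ ∫⁻ y, c * ∑' i : ℕ, 4 * (4⁻¹ : ℝ≥0∞) ^ i *
        (2 ^ n * (Ioo (-(2 : ℝ) ^ i) (2 ^ i)).indicator 1 (2 ^ n * y) * f (t - y)) := by
        refine lintegral_mono fun y => ?_
        calc (2 : ℝ≥0∞) ^ n * κ (2 ^ n * y) * f (t - y)
            ≤ 2 ^ n * (c * ∑' i : ℕ, 4 * (4⁻¹ : ℝ≥0∞) ^ i *
              (Ioo (-(2 : ℝ) ^ i) (2 ^ i)).indicator 1 (2 ^ n * y)) * f (t - y) := by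
              gcongr
              exact (hκ _).trans (by gcongr; exact ofReal_one_add_abs_pow_le_tsum _)
          _ = _ := by
              rw [← ENNReal.tsum_mul_left, ← ENNReal.tsum_mul_left, ← ENNReal.tsum_mul_right,
                ← ENNReal.tsum_mul_left]
              exact tsum_congr fun i => by ring
    _ = c * ∑' i : ℕ, 4 * (4⁻¹ : ℝ≥0∞) ^ i *
        ∫⁻ y, 2 ^ n * (Ioo (-(2 : ℝ) ^ i) (2 ^ i)).indicator 1 (2 ^ n * y) * f (t - y) := by
        rw [lintegral_const_mul _ (Measurable.tsum fun i => (hind i).const_mul _),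
          lintegral_tsum fun i => ((hind i).const_mul _).aemeasurable]
        congr 1
        exact tsum_congr fun i => lintegral_const_mul _ (hind i)
    _ ≤ c * ∑' i : ℕ, 4 * (4⁻¹ : ℝ≥0∞) ^ i * (2 * 2 ^ i * maximalFn f t) := by
        gcongr with i
        exact lintegral_indicator_mul_le_maximalFn f t i n
    _ = c * ∑' i : ℕ, 8 * maximalFn f t * (2⁻¹ : ℝ≥0∞) ^ i := by
        congr 1
        refine tsum_congr fun i => ?_
        have : (4⁻¹ : ℝ≥0∞) ^ i * 2 ^ i = 2⁻¹ ^ i := by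
          rw [← mul_pow]
          congr 1
          rw [show (4 : ℝ≥0∞) = 2 * 2 by norm_num, ENNReal.mul_inv (by simp) (by simp), mul_assoc,
            ENNReal.inv_mul_cancel (by simp) (by simp), mul_one]
        calc 4 * (4⁻¹ : ℝ≥0∞) ^ i * (2 * 2 ^ i * maximalFn f t)
            = 8 * maximalFn f t * ((4⁻¹ : ℝ≥0∞) ^ i * 2 ^ i) := by ring
          _ = _ := by rw [this]
    _ = c * 16 * maximalFn f t := by
        rw [ENNReal.tsum_mul_left, ENNReal.tsum_geometric, ENNReal.one_sub_inv_two, inv_inv]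
        ring

section Multiplier

variable {X : Type*} [NormedAddCommGroup X] [NormedSpace ℂ X] [CompleteSpace X]

theorem fourierMultiplierCLM_eq_convolution {χ : ℝ → ℂ} (hχ : ContDiff ℝ (⊤ : ℕ∞) χ)
    (hc : HasCompactSupport χ) (φ : 𝓢(ℝ, X)) (t : ℝ) :
    SchwartzMap.fourierMultiplierCLM X χ φ t =
      ∫ y, FourierTransformInv.fourierInv χ y • φ (t - y) := by
  set κ : 𝓢(ℝ, ℂ) := FourierTransformInv.fourierInv (hc.toSchwartzMap hχ) with hκ
  have h1 : SchwartzMap.fourierMultiplierCLM X χ φ =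
      SchwartzMap.convolution (ContinuousLinearMap.lsmul ℂ ℂ) κ φ := by
    rw [SchwartzMap.fourierMultiplierCLM_apply]
    rw [← FourierTransform.fourierInv_fourier_eq (F := 𝓢(ℝ, X))
      (SchwartzMap.convolution (ContinuousLinearMap.lsmul ℂ ℂ) κ φ)]
    congr 1
    rw [SchwartzMap.fourier_convolution]
    ext x
    rw [SchwartzMap.smulLeftCLM_apply_apply (hc.hasTemperateGrowth hχ),
      SchwartzMap.pairing_apply_apply, hκ, FourierTransform.fourier_fourierInv_eq]
    simp
  have h2 : (κ : ℝ → ℂ) = FourierTransformInv.fourierInv χ := by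
    rw [hκ, SchwartzMap.fourierInv_coe]
    rfl
  rw [h1, SchwartzMap.convolution_apply, ← h2]
  rfl

theorem fourierInv_dilate (χ : ℝ → ℂ) (n : ℕ) (y : ℝ) :
    FourierTransformInv.fourierInv (dilate χ n) y =
      2 ^ n * FourierTransformInv.fourierInv χ (2 ^ n * y) := by
  rw [Real.fourierInv_eq', Real.fourierInv_eq']
  have := Measure.integral_comp_mul_left (fun v : ℝ =>
    Complex.exp (↑(2 * Real.pi * inner ℝ v (2 ^ n * y)) * Complex.I) • χ v) ((2⁻¹ : ℝ) ^ n)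
  have e : ∫ v, Complex.exp (↑(2 * Real.pi * inner ℝ v y) * Complex.I) • dilate χ n v =
      ∫ v, Complex.exp (↑(2 * Real.pi * inner ℝ ((2⁻¹ : ℝ) ^ n * v) (2 ^ n * y)) * Complex.I) •
        χ ((2⁻¹ : ℝ) ^ n * v) := by
    refine integral_congr_ae (.of_forall fun v => ?_)
    have : inner ℝ ((2⁻¹ : ℝ) ^ n * v) (2 ^ n * y) = inner ℝ v y := by
      simp only [inv_pow, RCLike.inner_apply, conj_trivial]
      field_simp
    simp only [this]
    rfl
  rw [e, this, inv_pow, inv_inv, abs_of_pos (by positivity)]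
  simp

/-- Fourier multipliers with dilated symbols are dominated by the maximal function, uniformly in
the dilation. -/
theorem exists_enorm_fourierMultiplierCLM_dilate_le {χ : ℝ → ℂ} (hχ : ContDiff ℝ (⊤ : ℕ∞) χ)
    (hc : HasCompactSupport χ) : ∃ C : ℝ≥0, ∀ (n : ℕ) (φ : 𝓢(ℝ, X)) (t : ℝ),
      ‖SchwartzMap.fourierMultiplierCLM X (dilate χ n) φ t‖ₑ ≤
        C * maximalFn (fun x => ‖φ x‖ₑ) t := by
  set κ : 𝓢(ℝ, ℂ) := FourierTransformInv.fourierInv (hc.toSchwartzMap hχ) with hκ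
  set c := 2 ^ 2 * ((Finset.Iic (2, 0)).sup fun m => SchwartzMap.seminorm ℂ m.1 m.2) κ with hcdef
  have hκc : ∀ y, ‖κ y‖ₑ ≤ ENNReal.ofReal c * ENNReal.ofReal ((1 + |y|) ^ 2)⁻¹ := fun y => by
    have h1 := SchwartzMap.one_add_le_sup_seminorm_apply (𝕜 := ℂ) (m := (2, 0)) (k := 2) (n := 0)
      le_rfl le_rfl κ y
    rw [norm_iteratedFDeriv_zero, Real.norm_eq_abs] at h1
    rw [← ENNReal.ofReal_mul (by positivity), ← ofReal_norm]
    refine ENNReal.ofReal_le_ofReal ?_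
    rw [← div_eq_mul_inv, le_div_iff₀ (by positivity), mul_comm]
    exact h1
  refine ⟨c.toNNReal * 16, fun n φ t => ?_⟩
  have hcn : HasCompactSupport (dilate χ n) :=
    hc.comp_homeomorph (Homeomorph.mulLeft₀ ((2⁻¹ : ℝ) ^ n) (by positivity))
  have hsn : ContDiff ℝ (⊤ : ℕ∞) (dilate χ n) := hχ.comp (contDiff_const.mul contDiff_id)
  rw [fourierMultiplierCLM_eq_convolution hsn hcn]
  refine (enorm_integral_le_lintegral_enorm _).trans ?_
  have := lintegral_dilate_mul_le_maximalFn hκc (f := fun x => ‖φ x‖ₑ)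
    φ.continuous.enorm.measurable t n
  refine le_trans (le_of_eq (lintegral_congr fun y => ?_)) (this.trans_eq ?_)
  · rw [fourierInv_dilate, enorm_smul, enorm_mul, enorm_pow]
    have h2 : (κ : ℝ → ℂ) = FourierTransformInv.fourierInv χ := by
      rw [hκ, SchwartzMap.fourierInv_coe]
      rfl
    rw [← h2]
    simp [← ofReal_norm]
  · push_cast
    rfl

theorem exists_enorm_dyadicS_le {ψ : ℝ → ℂ} (hψ : IsGenerator ψ) :
    ∃ C : ℝ≥0, ∀ (j : ℕ) (φ : 𝓢(ℝ, X)) (t : ℝ),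
      ‖dyadicS ψ j φ t‖ₑ ≤ C * maximalFn (fun x => ‖φ x‖ₑ) t := by
  have hc : HasCompactSupport ψ := HasCompactSupport.of_support_subset_isCompact isCompact_Icc
    ((subset_tsupport ψ).trans hψ.2.1)
  have hs : ∀ c : ℝ, ContDiff ℝ (⊤ : ℕ∞) fun x => ψ (c * x) := fun c =>
    hψ.1.comp (contDiff_const.mul contDiff_id)
  have hcc : ∀ c : ℝ, c ≠ 0 → HasCompactSupport fun x => ψ (c * x) := fun c hc0 =>
    hc.comp_homeomorph (Homeomorph.mulLeft₀ c hc0)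
  have hpi := Real.pi_pos
  obtain ⟨C₀, h₀⟩ := exists_enorm_fourierMultiplierCLM_dilate_le (X := X) (hs (2 * Real.pi))
    (hcc _ (by positivity))
  obtain ⟨C₁, h₁⟩ := exists_enorm_fourierMultiplierCLM_dilate_le (X := X)
    ((hs Real.pi).sub (hs (2 * Real.pi))) ((hcc _ hpi.ne').sub (hcc _ (by positivity)))
  refine ⟨max C₀ C₁, fun j φ t => ?_⟩
  rw [dyadicS_apply]
  cases j with
  | zero =>
    rw [dyadicSymbol_zero]
    refine (h₀ 0 φ t).trans ?_
    gcongr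
    exact le_max_left _ _
  | succ j =>
    rw [dyadicSymbol_succ]
    refine (h₁ j φ t).trans ?_
    gcongr
    exact le_max_right _ _

theorem coe_dyadicS {ψ : ℝ → ℂ} (hψ : IsGenerator ψ) (j : ℕ) (φ : 𝓢(ℝ, X)) :
    ((dyadicS ψ j φ : 𝓢(ℝ, X)) : 𝓢'(ℝ, X)) = dyadicD ψ j (φ : 𝓢'(ℝ, X)) :=
  (TemperedDistribution.fourierMultiplierCLM_toTemperedDistributionCLM_eq
    (hψ.dyadicSymbol_hasTemperateGrowth j) φ).symm

end Multiplier

/-! ### Extension by density from test functions to all weighted spaces -/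

theorem isMuckenhoupt_one (p : ℝ) : IsMuckenhoupt p (fun _ => 1) := by
  refine ⟨aemeasurable_const, .of_forall fun _ => ⟨zero_lt_one, ENNReal.one_lt_top⟩, ?_⟩
  refine lt_of_le_of_lt (iSup_le fun a => iSup_le fun b => iSup_le fun h => ?_) ENNReal.one_lt_top
  have h0 : ENNReal.ofReal (b - a) ≠ 0 := (ENNReal.ofReal_pos.2 (by linarith)).ne'
  simp [ENNReal.div_self h0 ENNReal.ofReal_ne_top]

section DistNorm

variable {X : Type*} [NormedAddCommGroup X] [NormedSpace ℂ X]

theorem distNorm_neg (Φ : BanachFunctionSpace) (u : 𝓢'(ℝ, X)) :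
    distNorm Φ.norm (-u) = distNorm Φ.norm u := by
  have key : ∀ v : 𝓢'(ℝ, X), distNorm Φ.norm (-v) ≤ distNorm Φ.norm v := fun v => by
    simpa using distNorm_smul_le Φ (-1) v
  exact le_antisymm (key u) (by simpa using key (-u))

theorem distNorm_sub_comm (Φ : BanachFunctionSpace) (u v : 𝓢'(ℝ, X)) :
    distNorm Φ.norm (u - v) = distNorm Φ.norm (v - u) := by
  rw [← neg_sub, distNorm_neg]

theorem distNorm_sub_le (Φ : BanachFunctionSpace) (u v w : 𝓢'(ℝ, X)) :
    distNorm Φ.norm (u - w) ≤ distNorm Φ.norm (u - v) + distNorm Φ.norm (v - w) := by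
  rw [← sub_add_sub_cancel u v w]
  exact distNorm_add_le Φ _ _

theorem distNorm_le_sub_add (Φ : BanachFunctionSpace) (u v : 𝓢'(ℝ, X)) :
    distNorm Φ.norm u ≤ distNorm Φ.norm (u - v) + distNorm Φ.norm v := by
  simpa using distNorm_sub_le Φ u v 0

theorem distNorm_sum_le (Φ : BanachFunctionSpace) {ι : Type*} (s : Finset ι) (u : ι → 𝓢'(ℝ, X)) :
    distNorm Φ.norm (∑ i ∈ s, u i) ≤ ∑ i ∈ s, distNorm Φ.norm (u i) := by
  classical
  induction s using Finset.induction_on with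
  | empty => simp [distNorm_zero]
  | insert i s his ih =>
    rw [Finset.sum_insert his, Finset.sum_insert his]
    exact (distNorm_add_le Φ _ _).trans (by gcongr)

theorem distNorm_weight_mono {p : ℝ} (hp : 1 < p) {w v : ℝ → ℝ≥0∞} (h : ∀ t, w t ≤ v t)
    (u : 𝓢'(ℝ, X)) : distNorm (weightedNorm p w) u ≤ distNorm (weightedNorm p v) u := by
  refine iInf₂_mono fun g _ => ?_
  unfold weightedNorm
  gcongr with t
  · exact h t

end DistNorm

section Extension

variable {X Y : Type*} [NormedAddCommGroup X] [NormedSpace ℂ X]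
  [NormedAddCommGroup Y] [NormedSpace ℂ Y] {p : ℝ}

/-- `S` is bounded on `L^p_w`, with a constant that depends on an upper bound of the `A_p`-constant
of `w` only. -/
def BoundedOnWeights (p : ℝ) (S : 𝓢(ℝ, X) →ₗ[ℂ] 𝓢'(ℝ, Y)) (C : ℝ≥0 → ℝ≥0) : Prop :=
  ∀ (N : ℝ≥0) (w : ℝ → ℝ≥0∞), IsMuckenhoupt p w → apConst p w ≤ N → ∀ φ : 𝓢(ℝ, X),
    distNorm (weightedNorm p w) (S φ) ≤ C N * distNorm (weightedNorm p w) (φ : 𝓢'(ℝ, X))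

/-- The pair `(u, v)` is a limit in `L^p_w × L^p_w` of pairs `(φ, S φ)`. -/
def IsExtensionAt (p : ℝ) (w : ℝ → ℝ≥0∞) (S : 𝓢(ℝ, X) →ₗ[ℂ] 𝓢'(ℝ, Y)) (u : 𝓢'(ℝ, X))
    (v : 𝓢'(ℝ, Y)) : Prop :=
  ∃ φ : ℕ → 𝓢(ℝ, X),
    Tendsto (fun n => distNorm (weightedNorm p w) (u - (φ n : 𝓢'(ℝ, X)))) atTop (𝓝 0) ∧
    Tendsto (fun n => distNorm (weightedNorm p w) (v - S (φ n))) atTop (𝓝 0)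

/-- The graph of the extension of `S` to the union of the spaces `L^p_w`. -/
def IsExtension (p : ℝ) (S : 𝓢(ℝ, X) →ₗ[ℂ] 𝓢'(ℝ, Y)) (u : 𝓢'(ℝ, X)) (v : 𝓢'(ℝ, Y)) : Prop :=
  ∃ w, IsMuckenhoupt p w ∧ IsExtensionAt p w S u v

theorem IsExtensionAt.mono (hp : 1 < p) {w w' : ℝ → ℝ≥0∞} {S : 𝓢(ℝ, X) →ₗ[ℂ] 𝓢'(ℝ, Y)}
    {u : 𝓢'(ℝ, X)} {v : 𝓢'(ℝ, Y)} (h : IsExtensionAt p w S u v) (hw : ∀ t, w' t ≤ w t) :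
    IsExtensionAt p w' S u v := by
  obtain ⟨φ, h1, h2⟩ := h
  exact ⟨φ, tendsto_of_tendsto_of_tendsto_of_le_of_le tendsto_const_nhds h1 (fun _ => zero_le)
    fun _ => distNorm_weight_mono hp hw _, tendsto_of_tendsto_of_tendsto_of_le_of_le
    tendsto_const_nhds h2 (fun _ => zero_le) fun _ => distNorm_weight_mono hp hw _⟩

theorem IsExtensionAt.add (hp : 1 < p) {w : ℝ → ℝ≥0∞} (hw : IsMuckenhoupt p w)
    {S : 𝓢(ℝ, X) →ₗ[ℂ] 𝓢'(ℝ, Y)} {u u' : 𝓢'(ℝ, X)} {v v' : 𝓢'(ℝ, Y)}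
    (h : IsExtensionAt p w S u v) (h' : IsExtensionAt p w S u' v') :
    IsExtensionAt p w S (u + u') (v + v') := by
  obtain ⟨φ, h1, h2⟩ := h
  obtain ⟨φ', h1', h2'⟩ := h'
  refine ⟨fun n => φ n + φ' n, ?_, ?_⟩
  · have := h1.add h1'
    rw [add_zero] at this
    refine tendsto_of_tendsto_of_tendsto_of_le_of_le tendsto_const_nhds this (fun _ => zero_le)
      fun n => ?_
    rw [map_add, add_sub_add_comm]
    exact distNorm_add_le (weightedSpace hp hw) _ _
  · have := h2.add h2'
    rw [add_zero] at this
    refine tendsto_of_tendsto_of_tendsto_of_le_of_le tendsto_const_nhds this (fun _ => zero_le)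
      fun n => ?_
    rw [map_add, add_sub_add_comm]
    exact distNorm_add_le (weightedSpace hp hw) _ _

theorem IsExtensionAt.smul (hp : 1 < p) {w : ℝ → ℝ≥0∞} (hw : IsMuckenhoupt p w)
    {S : 𝓢(ℝ, X) →ₗ[ℂ] 𝓢'(ℝ, Y)} {u : 𝓢'(ℝ, X)} {v : 𝓢'(ℝ, Y)} (c : ℂ)
    (h : IsExtensionAt p w S u v) : IsExtensionAt p w S (c • u) (c • v) := by
  obtain ⟨φ, h1, h2⟩ := h
  refine ⟨fun n => c • φ n, ?_, ?_⟩
  · have := ENNReal.Tendsto.const_mul (a := ‖c‖ₑ) h1 (.inr enorm_ne_top)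
    rw [mul_zero] at this
    refine tendsto_of_tendsto_of_tendsto_of_le_of_le tendsto_const_nhds this (fun _ => zero_le)
      fun n => ?_
    rw [map_smul, ← smul_sub]
    exact distNorm_smul_le (weightedSpace hp hw) _ _
  · have := ENNReal.Tendsto.const_mul (a := ‖c‖ₑ) h2 (.inr enorm_ne_top)
    rw [mul_zero] at this
    refine tendsto_of_tendsto_of_tendsto_of_le_of_le tendsto_const_nhds this (fun _ => zero_le)
      fun n => ?_
    rw [map_smul, ← smul_sub]
    exact distNorm_smul_le (weightedSpace hp hw) _ _

theorem IsExtensionAt.distNorm_le (hp : 1 < p) {w : ℝ → ℝ≥0∞} (hw : IsMuckenhoupt p w) {N : ℝ≥0}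
    (hN : apConst p w ≤ N) {S : 𝓢(ℝ, X) →ₗ[ℂ] 𝓢'(ℝ, Y)} {C : ℝ≥0 → ℝ≥0}
    (hS : BoundedOnWeights p S C) {u : 𝓢'(ℝ, X)} {v : 𝓢'(ℝ, Y)} (h : IsExtensionAt p w S u v) :
    distNorm (weightedNorm p w) v ≤ C N * distNorm (weightedNorm p w) u := by
  obtain ⟨φ, h1, h2⟩ := h
  have ht := h2.add (ENNReal.Tendsto.const_mul (a := (C N : ℝ≥0∞))
    (h1.add (tendsto_const_nhds (x := distNorm (weightedNorm p w) u))) (.inr ENNReal.coe_ne_top))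
  rw [zero_add, zero_add] at ht
  refine ge_of_tendsto' ht fun n => ?_
  refine (distNorm_le_sub_add (weightedSpace hp hw) v (S (φ n))).trans (add_le_add le_rfl ?_)
  refine (hS N w hw hN (φ n)).trans ?_
  gcongr
  refine (distNorm_le_sub_add (weightedSpace hp hw) _ u).trans_eq ?_
  rw [distNorm_sub_comm]
  rfl

/-- Limits in `L^p_w` and in `L^p_{w'}` are added in `L^p_{min(w, w')}`. -/
theorem IsExtension.add (hp : 1 < p) {S : 𝓢(ℝ, X) →ₗ[ℂ] 𝓢'(ℝ, Y)} {u u' : 𝓢'(ℝ, X)}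
    {v v' : 𝓢'(ℝ, Y)} (h : IsExtension p S u v) (h' : IsExtension p S u' v') :
    IsExtension p S (u + u') (v + v') := by
  obtain ⟨w, hw, h⟩ := h
  obtain ⟨w', hw', h'⟩ := h'
  exact ⟨_, hw.min hp hw', (h.mono hp fun t => min_le_left _ _).add hp (hw.min hp hw')
    (h'.mono hp fun t => min_le_right _ _)⟩

theorem IsExtension.smul (hp : 1 < p) {S : 𝓢(ℝ, X) →ₗ[ℂ] 𝓢'(ℝ, Y)} {u : 𝓢'(ℝ, X)}
    {v : 𝓢'(ℝ, Y)} (c : ℂ) (h : IsExtension p S u v) : IsExtension p S (c • u) (c • v) := by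
  obtain ⟨w, hw, h⟩ := h
  exact ⟨w, hw, h.smul hp hw c⟩

theorem isExtension_coe (hp : 1 < p) (S : 𝓢(ℝ, X) →ₗ[ℂ] 𝓢'(ℝ, Y)) (φ : 𝓢(ℝ, X)) :
    IsExtension p S (φ : 𝓢'(ℝ, X)) (S φ) := by
  have h := distNorm_zero (X := X) (weightedSpace hp (isMuckenhoupt_one p))
  have h' := distNorm_zero (X := Y) (weightedSpace hp (isMuckenhoupt_one p))
  refine ⟨_, isMuckenhoupt_one p, fun _ => φ, ?_, ?_⟩
  · simp only [sub_self]
    exact tendsto_const_nhds.congr fun _ => h.symm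
  · simp only [sub_self]
    exact tendsto_const_nhds.congr fun _ => h'.symm

theorem dyadicD_sub (ψ : ℝ → ℂ) (j : ℕ) (u v : 𝓢'(ℝ, X)) :
    dyadicD ψ j (u - v) = dyadicD ψ j u - dyadicD ψ j v := map_sub _ _ _

/-- `ψ_j(D) ∘ S`. -/
def dyadicComp (ψ : ℝ → ℂ) (j : ℕ) (S : 𝓢(ℝ, X) →ₗ[ℂ] 𝓢'(ℝ, Y)) : 𝓢(ℝ, X) →ₗ[ℂ] 𝓢'(ℝ, Y) :=
  (TemperedDistribution.fourierMultiplierCLM Y (dyadicSymbol ψ j) :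
    𝓢'(ℝ, Y) →ₗ[ℂ] 𝓢'(ℝ, Y)) ∘ₗ S

theorem dyadicComp_apply (ψ : ℝ → ℂ) (j : ℕ) (S : 𝓢(ℝ, X) →ₗ[ℂ] 𝓢'(ℝ, Y)) (φ : 𝓢(ℝ, X)) :
    dyadicComp ψ j S φ = dyadicD ψ j (S φ) := rfl

variable [CompleteSpace Y]

/-- The extension does not depend on the weight: the spaces `L^p_w` are directed, so the difference
of two candidates is an extension at `0` for a single weight. -/
theorem IsExtension.unique (hp : 1 < p) {S : 𝓢(ℝ, X) →ₗ[ℂ] 𝓢'(ℝ, Y)} {C : ℝ≥0 → ℝ≥0}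
    (hS : BoundedOnWeights p S C) {u : 𝓢'(ℝ, X)} {v v' : 𝓢'(ℝ, Y)} (h : IsExtension p S u v)
    (h' : IsExtension p S u v') : v = v' := by
  obtain ⟨w, hw, hd⟩ := h.add hp (h'.smul hp (-1))
  have hK := hw.2.2
  lift apConst p w to ℝ≥0 using hK.ne with N hN
  have := hd.distNorm_le hp hw hN.symm.le hS
  have h0 : u + (-1 : ℂ) • u = 0 := by simp
  have hz : distNorm (weightedNorm p w) (0 : 𝓢'(ℝ, X)) = 0 := distNorm_zero (weightedSpace hp hw)
  rw [h0, hz, mul_zero, nonpos_iff_eq_zero] at this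
  have := (weightedSpace_isTame hp hw).eq_zero this
  rwa [neg_smul, one_smul, ← sub_eq_add_neg, sub_eq_zero] at this

variable [CompleteSpace X]

/-- Extension by density of the test functions. -/
theorem exists_isExtensionAt (hp : 1 < p) {w : ℝ → ℝ≥0∞} (hw : IsMuckenhoupt p w)
    {S : 𝓢(ℝ, X) →ₗ[ℂ] 𝓢'(ℝ, Y)} {C : ℝ≥0 → ℝ≥0} (hS : BoundedOnWeights p S C) {u : 𝓢'(ℝ, X)}
    (hu : distNorm (weightedNorm p w) u < ∞) : ∃ v, IsExtensionAt p w S u v := by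
  have hK := hw.2.2
  lift apConst p w to ℝ≥0 using hK.ne with N hN
  choose φ hφ using fun n : ℕ => exists_schwartz_distNorm_sub_le hp hw hu
    (pow_pos (by norm_num : (0 : ℝ) < 2⁻¹) n)
  have hpow : ∀ n : ℕ, ENNReal.ofReal ((2⁻¹ : ℝ) ^ n) = 2⁻¹ ^ n := fun n => by
    rw [ENNReal.ofReal_pow (by norm_num), ENNReal.ofReal_inv_of_pos (by norm_num)]
    simp
  simp only [hpow] at hφ
  have hz : ∀ n, distNorm (weightedNorm p w) (S (φ (n + 1)) - S (φ n)) ≤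
      C N * 2 * 2⁻¹ ^ n := fun n => by
    rw [← map_sub]
    refine (hS N w hw hN.symm.le _).trans ?_
    rw [mul_assoc]
    gcongr
    rw [map_sub]
    refine (distNorm_sub_le (weightedSpace hp hw) _ u _).trans ?_
    rw [distNorm_sub_comm, two_mul]
    refine add_le_add ((hφ (n + 1)).trans ?_) (hφ n)
    exact pow_le_pow_right_of_le_one' ENNReal.one_half_lt_one.le (Nat.le_succ n)
  have hsum : ∑' n, distNorm (weightedNorm p w) (S (φ (n + 1)) - S (φ n)) ≠ ∞ := by
    refine ((ENNReal.tsum_le_tsum hz).trans_lt ?_).ne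
    rw [ENNReal.tsum_mul_left, ENNReal.tsum_geometric, ENNReal.one_sub_inv_two, inv_inv]
    exact ENNReal.mul_lt_top (ENNReal.mul_lt_top (by simp) (by simp)) (by simp)
  obtain ⟨v, hv⟩ := (weightedSpace_isTame hp hw).exists_tsum hsum
  refine ⟨v + S (φ 0), φ, ?_, ?_⟩
  · refine tendsto_of_tendsto_of_tendsto_of_le_of_le tendsto_const_nhds
      (ENNReal.tendsto_pow_atTop_nhds_zero_of_lt_one ENNReal.one_half_lt_one) (fun _ => zero_le) hφ
  · refine tendsto_of_tendsto_of_tendsto_of_le_of_le tendsto_const_nhds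
      (ENNReal.tendsto_sum_nat_add _ hsum) (fun _ => zero_le) fun n => ?_
    refine le_trans (le_of_eq ?_) (hv n)
    rw [Finset.sum_range_sub (fun n => S (φ n)), sub_sub_eq_add_sub]
    rfl

theorem IsExtension.distNorm_le (hp : 1 < p) {S : 𝓢(ℝ, X) →ₗ[ℂ] 𝓢'(ℝ, Y)} {C : ℝ≥0 → ℝ≥0}
    (hS : BoundedOnWeights p S C) {u : 𝓢'(ℝ, X)} {v : 𝓢'(ℝ, Y)} (h : IsExtension p S u v)
    {w : ℝ → ℝ≥0∞} (hw : IsMuckenhoupt p w) {N : ℝ≥0} (hN : apConst p w ≤ N)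
    (hu : distNorm (weightedNorm p w) u < ∞) :
    distNorm (weightedNorm p w) v ≤ C N * distNorm (weightedNorm p w) u := by
  obtain ⟨v', hv'⟩ := exists_isExtensionAt hp hw hS hu
  rw [h.unique hp hS ⟨w, hw, hv'⟩]
  exact hv'.distNorm_le hp hw hN hS

/-- The constant in the extrapolated estimate; the summand `1` only serves to make it positive. -/
def extrapolatedConst (p : ℝ) (C : ℝ≥0 → ℝ≥0) (A B : ℝ≥0) : ℝ≥0 :=
  4 * (C (extrapolationConst p A B).toNNReal + 1)

variable {Φ : BanachFunctionSpace} {A B : ℝ≥0}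

theorem exists_isExtension_of_distNorm_lt_top (hp : 1 < p) (hA0 : A ≠ 0) (hB0 : B ≠ 0)
    (hA : MaximalBoundedWith Φ.norm A) (hB : MaximalBoundedWith Φ.dualNorm B)
    {S : 𝓢(ℝ, X) →ₗ[ℂ] 𝓢'(ℝ, Y)} {C : ℝ≥0 → ℝ≥0} (hS : BoundedOnWeights p S C) {u : 𝓢'(ℝ, X)}
    (hu : distNorm Φ.norm u < ∞) : ∃ v, IsExtension p S u v := by
  obtain ⟨g, hg⟩ := exists_represents_of_distNorm_lt_top hu
  rw [hg.distNorm_eq] at hu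
  obtain ⟨w, hw, -, hgw⟩ := exists_weightedNorm_lt_top hp Φ hA0 hB0 hA hB hg.aemeasurable hu
  obtain ⟨v, hv⟩ := exists_isExtensionAt hp hw hS
    ((hg.distNorm_eq (weightedSpace hp hw)).trans_lt hgw)
  exact ⟨v, w, hw, hv⟩

/-- The extension of an operator that is bounded on `L^p_w` is bounded on `Φ(X)`. -/
theorem IsExtension.distNorm_le_extrapolatedConst (hp : 1 < p) (hA0 : A ≠ 0) (hB0 : B ≠ 0)
    (hA : MaximalBoundedWith Φ.norm A) (hB : MaximalBoundedWith Φ.dualNorm B)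
    {S : 𝓢(ℝ, X) →ₗ[ℂ] 𝓢'(ℝ, Y)} {C : ℝ≥0 → ℝ≥0} (hS : BoundedOnWeights p S C) {u : 𝓢'(ℝ, X)}
    {v : 𝓢'(ℝ, Y)} (h : IsExtension p S u v) (hu : distNorm Φ.norm u < ∞) :
    distNorm Φ.norm v ≤ extrapolatedConst p C A B * distNorm Φ.norm u := by
  obtain ⟨g, hg⟩ := exists_represents_of_distNorm_lt_top hu
  rw [hg.distNorm_eq] at hu ⊢
  have hN : ∀ w, apConst p w ≤ extrapolationConst p A B →
      apConst p w ≤ (extrapolationConst p A B).toNNReal := fun w hw => by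
    rwa [ENNReal.coe_toNNReal (extrapolationConst_lt_top hp A B).ne]
  obtain ⟨w, hw, hwK, hgw⟩ := exists_weightedNorm_lt_top hp Φ hA0 hB0 hA hB hg.aemeasurable hu
  have hgd : ∀ {w}, IsMuckenhoupt p w → distNorm (weightedNorm p w) u =
      weightedNorm p w fun t => ‖g t‖ₑ := fun hw => hg.distNorm_eq (weightedSpace hp hw)
  have hvw := h.distNorm_le hp hS hw (hN w hwK) ((hgd hw).trans_lt hgw)
  obtain ⟨f, hf⟩ := exists_represents_of_distNorm_lt_top (hvw.trans_lt (ENNReal.mul_lt_top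
    ENNReal.coe_lt_top ((hgd hw).trans_lt hgw)))
  rw [hf.distNorm_eq, extrapolatedConst]
  push_cast
  refine norm_le_of_weightedNorm_le hp Φ hA0 hB0 hA hB (C := C _ + 1) hf.aemeasurable
    hg.aemeasurable hu fun w hw hwK => ?_
  rcases eq_or_ne (weightedNorm p w fun t => ‖g t‖ₑ) ∞ with ht | ht
  · rw [ht, ENNReal.mul_top (by simp)]
    exact le_top
  · have := h.distNorm_le hp hS hw (hN w hwK) ((hgd hw).trans_lt ht.lt_top)
    rw [hgd hw] at this
    refine (hf.distNorm_eq (weightedSpace hp hw)).symm.trans_le (this.trans ?_)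
    gcongr
    simp

/-! ### The dyadic multipliers on weighted spaces -/

/-- `ψ_j(D)` as an operator from test functions to distributions. -/
def dyadicOp (ψ : ℝ → ℂ) (X : Type*) [NormedAddCommGroup X] [NormedSpace ℂ X] (j : ℕ) :
    𝓢(ℝ, X) →ₗ[ℂ] 𝓢'(ℝ, X) :=
  (SchwartzMap.toTemperedDistributionCLM ℝ X volume : 𝓢(ℝ, X) →ₗ[ℂ] 𝓢'(ℝ, X)) ∘ₗ
    (SchwartzMap.fourierMultiplierCLM X (dyadicSymbol ψ j) : 𝓢(ℝ, X) →ₗ[ℂ] 𝓢(ℝ, X))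

theorem exists_boundedOnWeights_dyadicOp (hp : 1 < p) {ψ : ℝ → ℂ} (hψ : IsGenerator ψ) :
    ∃ C : ℝ≥0 → ℝ≥0, ∀ j, BoundedOnWeights p (dyadicOp ψ X j) C := by
  obtain ⟨c, hc⟩ := exists_enorm_dyadicS_le (X := X) hψ
  refine ⟨fun N => c * (muckenhouptConst p N).toNNReal, fun j N w hw hN φ => ?_⟩
  have hφ := represents_schwartz φ
  have hjφ := represents_schwartz (dyadicS ψ j φ)
  have h1 : distNorm (weightedNorm p w) (dyadicOp ψ X j φ) = _ :=
    hjφ.distNorm_eq (weightedSpace hp hw)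
  have h2 : distNorm (weightedNorm p w) (φ : 𝓢'(ℝ, X)) = _ := hφ.distNorm_eq (weightedSpace hp hw)
  rw [h1, h2]
  refine ((weightedSpace hp hw).norm_mono _ _ hjφ.aemeasurable
    ((measurable_maximalFn _).aemeasurable.const_mul _) (.of_forall (hc j φ))).trans ?_
  rw [(weightedSpace hp hw).norm_const_mul _ _ (measurable_maximalFn _).aemeasurable]
  push_cast
  rw [mul_assoc]
  gcongr
  rw [ENNReal.coe_toNNReal (muckenhouptConst_lt_top hp ENNReal.coe_ne_top).ne]
  exact weightedNorm_maximalFn_le hp hw ENNReal.coe_ne_top hN hφ.aemeasurable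

/-- The operator `ψ_j(D)` on distributions is the extension of that on test functions. -/
theorem isExtensionAt_dyadicD (hp : 1 < p) {ψ : ℝ → ℂ} (hψ : IsGenerator ψ) (j : ℕ)
    {w : ℝ → ℝ≥0∞} (hw : IsMuckenhoupt p w) {u : 𝓢'(ℝ, X)}
    (hu : distNorm (weightedNorm p w) u < ∞) :
    IsExtensionAt p w (dyadicOp ψ X j) u (dyadicD ψ j u) := by
  obtain ⟨C, hC⟩ := exists_boundedOnWeights_dyadicOp (X := X) hp hψ
  obtain ⟨v, φ, h1, h2⟩ := exists_isExtensionAt hp hw (hC j) hu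
  have hv : v = dyadicD ψ j u := by
    ext η
    have t2 := (weightedSpace_isTame hp hw).tendsto_apply h2 η
    have t1 := (weightedSpace_isTame hp hw).tendsto_apply h1 (dyadicTranspose ψ j η)
    refine tendsto_nhds_unique t2 (t1.congr fun n => ?_)
    rw [← dyadicD_apply_apply, ← coe_dyadicS hψ]
    rfl
  exact hv ▸ ⟨φ, h1, h2⟩

theorem exists_distNorm_dyadicD_le (X : Type*) [NormedAddCommGroup X] [NormedSpace ℂ X]
    [CompleteSpace X] (hp : 1 < p) {ψ : ℝ → ℂ} (hψ : IsGenerator ψ) :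
    ∃ C : ℝ≥0 → ℝ≥0, ∀ (j : ℕ) (N : ℝ≥0) (w : ℝ → ℝ≥0∞), IsMuckenhoupt p w → apConst p w ≤ N →
      ∀ u : 𝓢'(ℝ, X), distNorm (weightedNorm p w) (dyadicD ψ j u) ≤
        (C N + 1 : ℝ≥0) * distNorm (weightedNorm p w) u := by
  obtain ⟨C, hC⟩ := exists_boundedOnWeights_dyadicOp (X := X) hp hψ
  refine ⟨C, fun j N w hw hN u => ?_⟩
  rcases eq_or_ne (distNorm (weightedNorm p w) u) ∞ with h | h
  · rw [h, ENNReal.mul_top (by simp)]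
    exact le_top
  · refine ((isExtensionAt_dyadicD hp hψ j hw h.lt_top).distNorm_le hp hw hN (hC j)).trans ?_
    gcongr
    simp

theorem tendsto_distNorm_dyadicD (hp : 1 < p) {ψ : ℝ → ℂ} (hψ : IsGenerator ψ) (j : ℕ)
    {w : ℝ → ℝ≥0∞} (hw : IsMuckenhoupt p w) {u : ℕ → 𝓢'(ℝ, X)}
    (h : Tendsto (fun n => distNorm (weightedNorm p w) (u n)) atTop (𝓝 0)) :
    Tendsto (fun n => distNorm (weightedNorm p w) (dyadicD ψ j (u n))) atTop (𝓝 0) := by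
  obtain ⟨C, hC⟩ := exists_distNorm_dyadicD_le X hp hψ
  have hK := hw.2.2
  lift apConst p w to ℝ≥0 using hK.ne with N hN
  have := ENNReal.Tendsto.const_mul (a := ((C N + 1 : ℝ≥0) : ℝ≥0∞)) h (.inr ENNReal.coe_ne_top)
  rw [mul_zero] at this
  exact tendsto_of_tendsto_of_tendsto_of_le_of_le tendsto_const_nhds this (fun _ => zero_le)
    fun n => hC j N w hw hN.symm.le (u n)

theorem IsExtension.multiplier_both (hp : 1 < p) {ψ : ℝ → ℂ} (hψ : IsGenerator ψ) (j : ℕ)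
    {S : 𝓢(ℝ, X) →ₗ[ℂ] 𝓢'(ℝ, Y)} (hS : ∀ φ, S (dyadicS ψ j φ) = dyadicD ψ j (S φ))
    {u : 𝓢'(ℝ, X)} {v : 𝓢'(ℝ, Y)} (h : IsExtension p S u v) :
    IsExtension p S (dyadicD ψ j u) (dyadicD ψ j v) := by
  obtain ⟨w, hw, φ, h1, h2⟩ := h
  refine ⟨w, hw, fun n => dyadicS ψ j (φ n), ?_, ?_⟩
  · have := tendsto_distNorm_dyadicD hp hψ j hw h1
    simp only [dyadicD_sub, ← coe_dyadicS hψ] at this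
    exact this
  · simp only [hS, ← dyadicD_sub]
    exact tendsto_distNorm_dyadicD hp hψ j hw h2

end Extension

section Composition

variable {X Y : Type*} [NormedAddCommGroup X] [NormedSpace ℂ X]
  [NormedAddCommGroup Y] [NormedSpace ℂ Y] [CompleteSpace Y] {p : ℝ}

theorem exists_boundedOnWeights_dyadicComp (hp : 1 < p) {ψ : ℝ → ℂ} (hψ : IsGenerator ψ)
    {C : ℝ≥0 → ℝ≥0} : ∃ C' : ℝ≥0 → ℝ≥0, ∀ (j : ℕ) (S : 𝓢(ℝ, X) →ₗ[ℂ] 𝓢'(ℝ, Y)),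
      BoundedOnWeights p S C → BoundedOnWeights p (dyadicComp ψ j S) C' := by
  obtain ⟨c, hc⟩ := exists_distNorm_dyadicD_le Y hp hψ
  refine ⟨fun N => (c N + 1) * C N, fun j S hS N w hw hN φ => ?_⟩
  refine (hc j N w hw hN _).trans ?_
  rw [ENNReal.coe_mul, mul_assoc]
  gcongr
  exact hS N w hw hN φ

theorem IsExtension.multiplier_left (hp : 1 < p) {ψ : ℝ → ℂ} (hψ : IsGenerator ψ) (j : ℕ)
    {S : 𝓢(ℝ, X) →ₗ[ℂ] 𝓢'(ℝ, Y)} {u : 𝓢'(ℝ, X)} {v : 𝓢'(ℝ, Y)} (h : IsExtension p S u v) :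
    IsExtension p (dyadicComp ψ j S) u (dyadicD ψ j v) := by
  obtain ⟨w, hw, φ, h1, h2⟩ := h
  refine ⟨w, hw, φ, h1, ?_⟩
  simp only [dyadicComp_apply, ← dyadicD_sub]
  exact tendsto_distNorm_dyadicD hp hψ j hw h2

end Composition

/-! ### Dyadic extensions -/

/-- A series of tempered distributions with geometrically decreasing bounds converges weakly. -/
theorem exists_hasSum_of_le {Y : Type*} [NormedAddCommGroup Y] [NormedSpace ℂ Y] [CompleteSpace Y]
    {v : ℕ → 𝓢'(ℝ, Y)} {q : Seminorm ℂ 𝓢(ℝ, ℂ)} (hq : Continuous q) {c : ℝ≥0}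
    (h : ∀ l φ, ‖v l φ‖ ≤ c * q φ * (2⁻¹ : ℝ) ^ l) :
    ∃ u : 𝓢'(ℝ, Y), ∀ φ, HasSum (fun l => v l φ) (u φ) := by
  have hg : Summable fun l : ℕ => (2⁻¹ : ℝ) ^ l :=
    summable_geometric_of_lt_one (by norm_num) (by norm_num)
  have hs : ∀ φ, Summable fun l => v l φ := fun φ =>
    Summable.of_norm_bounded (hg.mul_left _) (h · φ)
  let A : 𝓢(ℝ, ℂ) →ₗ[ℂ] Y :=
    { toFun := fun φ => ∑' l, v l φ
      map_add' := fun φ η => by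
        simp only [map_add]
        exact (hs φ).tsum_add (hs η)
      map_smul' := fun a φ => by
        simp only [map_smul, RingHom.id_apply]
        exact (hs φ).tsum_const_smul a }
  obtain ⟨u, hu⟩ := exists_temperedDistribution_of_le A (q := (c * 2) • q)
    (continuous_const.mul hq) fun φ => by
      have h1 : HasSum (fun l : ℕ => c * q φ * (2⁻¹ : ℝ) ^ l) (c * q φ * 2) := by
        have := (hasSum_geometric_of_lt_one (by norm_num : (0 : ℝ) ≤ 2⁻¹) (by norm_num)).mul_left
          (c * q φ)
        norm_num at this
        simpa using this
      refine (tsum_of_norm_bounded h1 (h · φ)).trans (le_of_eq ?_)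
      change _ = ((c * 2 : ℝ≥0) : ℝ) * q φ
      push_cast
      ring
  exact ⟨u, fun φ => (hu φ).symm ▸ (hs φ).hasSum⟩

section DyadicExtension

variable {X Y : Type*} [NormedAddCommGroup X] [NormedSpace ℂ X]
  [NormedAddCommGroup Y] [NormedSpace ℂ Y] {p : ℝ}

/-- The graph of the extension of `T`, defined frequency block by frequency block: `v` corresponds
to `u` if all `ψ_m(D) ψ_k(D) v` are obtained from `ψ_k(D) u` by the extension of `ψ_m(D) T` to the
union of the spaces `L^p_w(X)`. This does not refer to the space that `u` is taken from, which makes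
the extensions to different spaces consistent. -/
def IsDyadicExtension (p : ℝ) (ψ : ℝ → ℂ) (T : 𝓢(ℝ, X) →ₗ[ℂ] 𝓢'(ℝ, Y)) (u : 𝓢'(ℝ, X))
    (v : 𝓢'(ℝ, Y)) : Prop :=
  ∀ k m, IsExtension p (dyadicComp ψ m T) (dyadicD ψ k u) (dyadicD ψ m (dyadicD ψ k v))

variable {ψ : ℝ → ℂ} {T : 𝓢(ℝ, X) →ₗ[ℂ] 𝓢'(ℝ, Y)}

theorem IsDyadicExtension.add (hp : 1 < p) {u u' : 𝓢'(ℝ, X)} {v v' : 𝓢'(ℝ, Y)}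
    (h : IsDyadicExtension p ψ T u v) (h' : IsDyadicExtension p ψ T u' v') :
    IsDyadicExtension p ψ T (u + u') (v + v') := fun k m => by
  simp only [dyadicD_add]
  exact (h k m).add hp (h' k m)

theorem IsDyadicExtension.smul (hp : 1 < p) {u : 𝓢'(ℝ, X)} {v : 𝓢'(ℝ, Y)} (c : ℂ)
    (h : IsDyadicExtension p ψ T u v) : IsDyadicExtension p ψ T (c • u) (c • v) := fun k m => by
  simp only [dyadicD_smul]
  exact (h k m).smul hp c

theorem isDyadicExtension_coe [CompleteSpace X] (hp : 1 < p) (hψ : IsGenerator ψ)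
    (hT : ∀ (j : ℕ) (f : 𝓢(ℝ, X)), T (dyadicS ψ j f) = dyadicD ψ j (T f)) (φ : 𝓢(ℝ, X)) :
    IsDyadicExtension p ψ T (φ : 𝓢'(ℝ, X)) (T φ) := fun k m => by
  rw [← coe_dyadicS hψ, ← hT k]
  exact isExtension_coe hp (dyadicComp ψ m T) (dyadicS ψ k φ)

theorem dyadicComp_dyadicS (hψ : IsGenerator ψ)
    (hT : ∀ (j : ℕ) (f : 𝓢(ℝ, X)), T (dyadicS ψ j f) = dyadicD ψ j (T f)) (m j : ℕ)
    (φ : 𝓢(ℝ, X)) :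
    dyadicComp ψ m T (dyadicS ψ j φ) = dyadicD ψ j (dyadicComp ψ m T φ) := by
  rw [dyadicComp_apply, dyadicComp_apply, hT, dyadicD_comm hψ]

variable [CompleteSpace Y] {C : ℝ≥0 → ℝ≥0}

/-- A distribution is determined by its blocks. -/
theorem IsDyadicExtension.unique (hp : 1 < p) (hψ : IsGenerator ψ)
    (hC : ∀ m, BoundedOnWeights p (dyadicComp ψ m T) C) {u : 𝓢'(ℝ, X)} {v v' : 𝓢'(ℝ, Y)}
    (h : IsDyadicExtension p ψ T u v) (h' : IsDyadicExtension p ψ T u v') : v = v' := by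
  have h1 : ∀ k, dyadicD ψ k v = dyadicD ψ k v' := fun k => by
    rw [← sum_near_dyadicD hψ k v, ← sum_near_dyadicD hψ k v']
    exact Finset.sum_congr rfl fun m _ => (h k m).unique hp (hC m) (h' k m)
  ext φ
  refine tendsto_nhds_unique (tendsto_sum_dyadicD hψ v φ) ?_
  simp only [h1]
  exact tendsto_sum_dyadicD hψ v' φ

variable [CompleteSpace X]

/-- The extension is bounded on every frequency block, uniformly in the block and in `Φ`. -/
theorem IsDyadicExtension.distNorm_dyadicD_le (hp : 1 < p) (hψ : IsGenerator ψ)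
    (hC : ∀ m, BoundedOnWeights p (dyadicComp ψ m T) C) {Φ : BanachFunctionSpace} {A B : ℝ≥0}
    (hA0 : A ≠ 0) (hB0 : B ≠ 0) (hA : MaximalBoundedWith Φ.norm A)
    (hB : MaximalBoundedWith Φ.dualNorm B) {u : 𝓢'(ℝ, X)} {v : 𝓢'(ℝ, Y)}
    (h : IsDyadicExtension p ψ T u v) (k : ℕ) :
    distNorm Φ.norm (dyadicD ψ k v) ≤
      (3 * extrapolatedConst p C A B : ℝ≥0) * distNorm Φ.norm (dyadicD ψ k u) := by
  rcases eq_or_ne (distNorm Φ.norm (dyadicD ψ k u)) ∞ with ht | ht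
  · rw [ht, ENNReal.mul_top (by simp [extrapolatedConst])]
    exact le_top
  rw [← sum_near_dyadicD hψ k v]
  refine (distNorm_sum_le Φ _ _).trans ((Finset.sum_le_sum fun m _ =>
    (h k m).distNorm_le_extrapolatedConst hp hA0 hB0 hA hB (hC m) ht.lt_top).trans ?_)
  rw [Finset.sum_const, nsmul_eq_mul, ← mul_assoc]
  gcongr
  push_cast
  gcongr
  exact_mod_cast card_near_le k

/-- An extension of `ψ_m(D) T` has no frequencies away from those of its argument, so that at test
functions it is as small as the Littlewood–Paley blocks of these. -/
theorem IsExtension.apply_eq_sum_near (hp : 1 < p) (hψ : IsGenerator ψ)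
    {S : 𝓢(ℝ, X) →ₗ[ℂ] 𝓢'(ℝ, Y)} (hS : BoundedOnWeights p S C)
    (hSψ : ∀ j φ, S (dyadicS ψ j φ) = dyadicD ψ j (S φ)) {u : 𝓢'(ℝ, X)} {k : ℕ} {v : 𝓢'(ℝ, Y)}
    (h : IsExtension p S (dyadicD ψ k u) v) (φ : 𝓢(ℝ, ℂ)) :
    v φ = ∑ n ∈ near k, v (dyadicTranspose ψ n φ) := by
  have h0 : ∀ n, n ∉ near k → dyadicD ψ n v = 0 := fun n hn => by
    have h1 := h.multiplier_both hp hψ n (hSψ n)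
    rw [dyadicD_dyadicD_eq_zero hψ hn] at h1
    have h2 := isExtension_coe hp S 0
    rw [map_zero, map_zero] at h2
    exact h1.unique hp hS h2
  refine tendsto_nhds_unique (tendsto_sum_dyadicD hψ v φ) (tendsto_const_nhds.congr' ?_)
  filter_upwards [eventually_ge_atTop (k + 2)] with N hN
  refine Finset.sum_subset (fun n hn => ?_) fun n _ hn => ?_
  · rw [mem_near] at hn
    rw [Finset.mem_range]
    omega
  · rw [← dyadicD_apply_apply, h0 n hn]
    rfl

theorem inv_two_pow_mul_rpow_le {s : ℝ} {N n l : ℕ} (hN : 1 - s ≤ N) (hn : l ≤ n + 1) :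
    ((2⁻¹ : ℝ) ^ N) ^ n * 2 ^ (-(s * l)) ≤ 2 ^ N * (2⁻¹) ^ l := by
  have e1 : ((2⁻¹ : ℝ) ^ N) ^ n = (2 : ℝ) ^ (-(N * n : ℝ)) := by
    rw [← pow_mul, inv_pow, Real.rpow_neg (by norm_num), ← Nat.cast_mul, Real.rpow_natCast]
  have e2 : (2 : ℝ) ^ N * (2⁻¹) ^ l = (2 : ℝ) ^ ((N : ℝ) - l) := by
    rw [Real.rpow_sub (by norm_num), Real.rpow_natCast, Real.rpow_natCast, inv_pow, div_eq_mul_inv]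
  rw [e1, e2, ← Real.rpow_add (by norm_num)]
  refine Real.rpow_le_rpow_of_exponent_le (by norm_num) ?_
  have h1 : (l : ℝ) ≤ n + 1 := by exact_mod_cast hn
  have h2 : (N : ℝ) * l ≤ N * (n + 1) := by gcongr
  have h3 : (1 - s) * l ≤ N * l := by gcongr
  linarith

/-- Every distribution whose frequency blocks lie in `Φ(X)`, with norms that grow at most
exponentially, has an extension. With `w m l` the value at `ψ_l(D) u` of the extension of
`ψ_m(D) T`, it is the series `∑ l, ∑ m ∈ near l, w m l`. -/
theorem exists_isDyadicExtension (hp : 1 < p) (hψ : IsGenerator ψ)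
    (hT : ∀ (j : ℕ) (f : 𝓢(ℝ, X)), T (dyadicS ψ j f) = dyadicD ψ j (T f))
    (hC : ∀ m, BoundedOnWeights p (dyadicComp ψ m T) C) {Φ : BanachFunctionSpace} {A B : ℝ≥0}
    (hA0 : A ≠ 0) (hB0 : B ≠ 0) (hA : MaximalBoundedWith Φ.norm A)
    (hB : MaximalBoundedWith Φ.dualNorm B) {s : ℝ} {M : ℝ≥0∞} (hM : M ≠ ∞) {u : 𝓢'(ℝ, X)}
    (hu : ∀ k : ℕ, ENNReal.ofReal (2 ^ (s * k)) * distNorm Φ.norm (dyadicD ψ k u) ≤ M) :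
    ∃ v, IsDyadicExtension p ψ T u v := by
  have hΦ := Φ.isTame hA hB
  have hu' : ∀ k : ℕ, distNorm Φ.norm (dyadicD ψ k u) ≤
      M * ENNReal.ofReal (2 ^ (-(s * k))) := fun k => by
    have h1 : ENNReal.ofReal (2 ^ (-(s * k))) * ENNReal.ofReal (2 ^ (s * k)) = 1 := by
      rw [← ENNReal.ofReal_mul (by positivity), ← Real.rpow_add (by norm_num)]
      simp
    calc distNorm Φ.norm (dyadicD ψ k u) = ENNReal.ofReal (2 ^ (-(s * k))) *
          (ENNReal.ofReal (2 ^ (s * k)) * distNorm Φ.norm (dyadicD ψ k u)) := by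
          rw [← mul_assoc, h1, one_mul]
      _ ≤ ENNReal.ofReal (2 ^ (-(s * k))) * M := by gcongr; exact hu k
      _ = _ := mul_comm _ _
  have hut : ∀ k, distNorm Φ.norm (dyadicD ψ k u) < ∞ := fun k =>
    (hu' k).trans_lt (ENNReal.mul_lt_top hM.lt_top ENNReal.ofReal_lt_top)
  choose w hw using fun m k => exists_isExtension_of_distNorm_lt_top hp hA0 hB0 hA hB (hC m) (hut k)
  have hTψ : ∀ m j φ, dyadicComp ψ m T (dyadicS ψ j φ) = dyadicD ψ j (dyadicComp ψ m T φ) :=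
    dyadicComp_dyadicS hψ hT
  have I1 : ∀ m k l, dyadicD ψ k (w m l) = dyadicD ψ l (w m k) := fun m k l => by
    have h1 := (hw m l).multiplier_both hp hψ k (hTψ m k)
    rw [dyadicD_comm hψ] at h1
    exact h1.unique hp (hC m) ((hw m k).multiplier_both hp hψ l (hTψ m l))
  have I2 : ∀ j m k, dyadicD ψ j (w m k) = dyadicD ψ m (w j k) := fun j m k => by
    have h1 := (hw m k).multiplier_left hp hψ j
    have h2 := (hw j k).multiplier_left hp hψ m
    have e : dyadicComp ψ j (dyadicComp ψ m T) = dyadicComp ψ m (dyadicComp ψ j T) :=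
      LinearMap.ext fun φ => by simp only [dyadicComp_apply]; exact dyadicD_comm hψ _ _ _
    rw [e] at h1
    obtain ⟨C', hC'⟩ := exists_boundedOnWeights_dyadicComp (X := X) (Y := Y) hp hψ (C := C)
    exact h1.unique hp (hC' m _ (hC j)) h2
  have hmap : ∀ (j : ℕ) (t : Finset ℕ) (f : ℕ → 𝓢'(ℝ, Y)),
      dyadicD ψ j (∑ m ∈ t, f m) = ∑ m ∈ t, dyadicD ψ j (f m) := fun j t f => map_sum _ _ _
  -- at each frequency only one block of the series is left
  have I3 : ∀ j k l, dyadicD ψ j (dyadicD ψ k (∑ m ∈ near l, w m l)) =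
      dyadicD ψ l (w j k) := fun j k l => by
    rw [hmap, hmap, ← sum_near_dyadicD hψ l (w j k)]
    refine Finset.sum_congr rfl fun m _ => ?_
    rw [I1, dyadicD_comm hψ, I2, dyadicD_comm hψ]
  -- decay of order `N` of the test function compensates the growth `2^{-sl}` of the blocks
  obtain ⟨N, hN⟩ := exists_nat_ge (1 - s)
  obtain ⟨q, hq, hqb⟩ := exists_seminorm_dyadicTranspose_le hψ N (decaySeminorm ℂ)
    continuous_decaySeminorm
  set E := extrapolatedConst p C A B with hE
  have hKt : E * M * Φ.dualNorm decayFn ≠ ∞ := ENNReal.mul_ne_top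
    (ENNReal.mul_ne_top ENNReal.coe_ne_top hM) hΦ.dualNorm_lt_top.ne
  set K : ℝ≥0 := (E * M * Φ.dualNorm decayFn).toNNReal with hK
  have hKe : (K : ℝ≥0∞) = E * M * Φ.dualNorm decayFn := ENNReal.coe_toNNReal hKt
  have hterm : ∀ m l n φ, n ∈ near l → ‖w m l (dyadicTranspose ψ n φ)‖ ≤
      K * 2 ^ N * q φ * (2⁻¹ : ℝ) ^ l := fun m l n φ hn => by
    have hb := (hw m l).distNorm_le_extrapolatedConst hp hA0 hB0 hA hB (hC m) (hut l)
    have h1 := hΦ.enorm_apply_le (hb.trans_lt (ENNReal.mul_lt_top ENNReal.coe_lt_top (hut l)))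
      (dyadicTranspose ψ n φ)
    have h2 : ‖w m l (dyadicTranspose ψ n φ)‖ₑ ≤
        ENNReal.ofReal (((2⁻¹ : ℝ) ^ N) ^ n * q φ) * (K * ENNReal.ofReal (2 ^ (-(s * l)))) := by
      refine h1.trans (mul_le_mul' (ENNReal.ofReal_le_ofReal (hqb n φ)) ?_)
      calc distNorm Φ.norm (w m l) * Φ.dualNorm decayFn
          ≤ (E * (M * ENNReal.ofReal (2 ^ (-(s * l))))) * Φ.dualNorm decayFn := by
            gcongr
            exact hb.trans (by gcongr; exact hu' l)
        _ = _ := by rw [hKe]; ring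
    have hqn := apply_nonneg q φ
    rw [← ENNReal.ofReal_coe_nnreal, ← ENNReal.ofReal_mul (by positivity),
      ← ENNReal.ofReal_mul (by positivity), ← ofReal_norm,
      ENNReal.ofReal_le_ofReal_iff (by positivity)] at h2
    calc _ ≤ _ := h2
      _ = K * q φ * (((2⁻¹ : ℝ) ^ N) ^ n * 2 ^ (-(s * l))) := by ring
      _ ≤ K * q φ * (2 ^ N * (2⁻¹) ^ l) :=
          mul_le_mul_of_nonneg_left (inv_two_pow_mul_rpow_le hN (mem_near.1 hn).2) (by positivity)
      _ = _ := by ring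
  obtain ⟨v, hv⟩ := exists_hasSum_of_le (v := fun l => ∑ m ∈ near l, w m l) hq
    (c := 9 * (K * 2 ^ N)) fun l φ => by
      have e1 : (∑ m ∈ near l, w m l) φ = ∑ m ∈ near l, w m l φ := by simp
      have hqn := apply_nonneg q φ
      have h9 : ((near l).card : ℝ) ≤ 3 := by exact_mod_cast card_near_le l
      rw [e1]
      calc ‖∑ m ∈ near l, w m l φ‖ ≤ ∑ m ∈ near l, ‖w m l φ‖ := norm_sum_le _ _
        _ ≤ ∑ m ∈ near l, ∑ n ∈ near l, K * 2 ^ N * q φ * (2⁻¹ : ℝ) ^ l := by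
            refine Finset.sum_le_sum fun m _ => ?_
            rw [(hw m l).apply_eq_sum_near hp hψ (hC m) (hTψ m) φ]
            exact (norm_sum_le _ _).trans (Finset.sum_le_sum fun n hn => hterm m l n φ hn)
        _ = (near l).card * ((near l).card * (K * 2 ^ N * q φ * (2⁻¹ : ℝ) ^ l)) := by
            simp only [Finset.sum_const, nsmul_eq_mul]
        _ ≤ 3 * (3 * (K * 2 ^ N * q φ * (2⁻¹ : ℝ) ^ l)) := by gcongr
        _ = _ := by push_cast; ring
  refine ⟨v, fun k m => ?_⟩
  have e : dyadicD ψ m (dyadicD ψ k v) = w m k := by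
    ext φ
    have h1 := (hv (dyadicTranspose ψ k (dyadicTranspose ψ m φ))).tendsto_sum_nat
    simp only [← dyadicD_apply_apply, I3] at h1
    exact tendsto_nhds_unique h1 (tendsto_sum_dyadicD hψ (w m k) φ)
  rw [e]
  exact hw m k

end DyadicExtension

/-! ### Sequence norms -/

theorem le_lqNorm {q : ℝ≥0∞} (hq : 1 ≤ q) (a : ℕ → ℝ≥0∞) (j : ℕ) : a j ≤ lqNorm q a := by
  unfold lqNorm
  split_ifs with h
  · exact le_iSup a j
  · have h0 : 0 < q.toReal := ENNReal.toReal_pos (zero_lt_one.trans_le hq).ne' h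
    calc a j = (a j ^ q.toReal) ^ (1 / q.toReal) := by
          rw [← ENNReal.rpow_mul, mul_one_div_cancel h0.ne', ENNReal.rpow_one]
      _ ≤ _ := by
          gcongr
          exact ENNReal.le_tsum j

theorem lqNorm_inv_two_pow_lt_top {q : ℝ≥0∞} (hq : 1 ≤ q) :
    lqNorm q (fun j => 2⁻¹ ^ j) < ∞ := by
  have hle : ∀ j : ℕ, (2⁻¹ : ℝ≥0∞) ^ j ≤ 1 := fun j =>
    pow_le_one' ENNReal.one_half_lt_one.le j
  unfold lqNorm
  split_ifs with h
  · exact (iSup_le hle).trans_lt ENNReal.one_lt_top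
  · have h1 : 1 ≤ q.toReal := by simpa using ENNReal.toReal_mono h hq
    refine ENNReal.rpow_lt_top_of_nonneg (by positivity) ((ENNReal.tsum_le_tsum fun j =>
      ENNReal.rpow_le_self_of_le_one (hle j) h1).trans_lt ?_).ne
    rw [ENNReal.tsum_geometric, ENNReal.one_sub_inv_two, inv_inv]
    exact ENNReal.ofNat_lt_top

/-- The norms of `L^r_w(ℓ^r)` and `ℓ^r(L^r_w)` agree. -/
theorem weightedNorm_lqNorm {r : ℝ≥0∞} (hr : 1 < r) (hr' : r < ∞) {w : ℝ → ℝ≥0∞}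
    (hw : AEMeasurable w volume) {a : ℕ → ℝ → ℝ≥0∞} (ha : ∀ j, AEMeasurable (a j) volume) :
    weightedNorm r.toReal w (fun t => lqNorm r fun j => a j t) =
      lqNorm r fun j => weightedNorm r.toReal w (a j) := by
  have h0 : 0 < r.toReal := ENNReal.toReal_pos (zero_lt_one.trans hr).ne' hr'.ne
  have hcancel : ∀ x : ℝ≥0∞, (x ^ (1 / r.toReal)) ^ r.toReal = x := fun x => by
    rw [← ENNReal.rpow_mul, one_div_mul_cancel h0.ne', ENNReal.rpow_one]
  simp only [weightedNorm, lqNorm, if_neg hr'.ne, hcancel, ← ENNReal.tsum_mul_right]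
  rw [lintegral_tsum (f := fun j t => a j t ^ r.toReal * w t) fun j => ((ha j).pow_const _).mul hw]

/-! ### Estimates in Besov and Triebel–Lizorkin spaces -/

section Estimates

variable {X Y : Type*} [NormedAddCommGroup X] [NormedSpace ℂ X]
  [NormedAddCommGroup Y] [NormedSpace ℂ Y] {ψ : ℝ → ℂ}

theorem triebelNorm_eq [CompleteSpace X] (Φ : BanachFunctionSpace) (s : ℝ) (r : ℝ≥0∞)
    {u : 𝓢'(ℝ, X)} {g : ℕ → ℝ → X} (hg : ∀ j, Represents (dyadicD ψ j u) (g j)) :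
    triebelNorm ψ Φ s r u =
      Φ.norm fun t => lqNorm r fun j => ENNReal.ofReal ((2 : ℝ) ^ (s * j)) * ‖g j t‖ₑ := by
  refine le_antisymm (iInf₂_le g hg) (le_iInf₂ fun h hh => le_of_eq ?_)
  refine Φ.norm_congr_ae (triebel_aemeasurable _ hg) ?_
  filter_upwards [ae_all_iff.2 fun j => (hg j).ae_eq (hh j)] with t ht
  simp only [ht]

theorem weightedNorm_lqNorm_eq [CompleteSpace X] {r : ℝ≥0∞} (hr : 1 < r) (hr' : r < ∞)
    (hr1 : 1 < r.toReal) {w : ℝ → ℝ≥0∞} (hw : IsMuckenhoupt r.toReal w)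
    {c : ℕ → ℝ≥0∞} (hc : ∀ j, c j ≠ ∞)
    {u : ℕ → 𝓢'(ℝ, X)} {g : ℕ → ℝ → X} (hg : ∀ j, Represents (u j) (g j)) :
    (weightedNorm r.toReal w fun t => lqNorm r fun j => c j * ‖g j t‖ₑ) =
      lqNorm r fun j => c j * distNorm (weightedSpace hr1 hw).norm (u j) := by
  lift c to ℕ → ℝ≥0 using hc
  rw [weightedNorm_lqNorm hr hr' hw.1 fun j => (hg j).aemeasurable.const_mul _]
  congr 1
  funext j
  rw [(hg j).distNorm_eq]
  exact (weightedSpace hr1 hw).norm_const_mul _ _ (hg j).aemeasurable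

theorem exists_decaySeminorm_dyadicS_le (hψ : IsGenerator ψ) (s : ℝ) (φ : 𝓢(ℝ, X)) :
    ∃ K : ℝ≥0, ∀ j : ℕ, ENNReal.ofReal ((2 : ℝ) ^ (s * j)) *
      ENNReal.ofReal (decaySeminorm X (dyadicS ψ j φ)) ≤ K * 2⁻¹ ^ j := by
  obtain ⟨N, hN⟩ := exists_nat_ge (1 + s)
  obtain ⟨q, -, hq⟩ := exists_seminorm_dyadicS_le hψ N (decaySeminorm X) continuous_decaySeminorm
  have hqn := apply_nonneg q φ
  refine ⟨(2 ^ N * q φ).toNNReal, fun j => ?_⟩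
  have h1 := inv_two_pow_mul_rpow_le (s := -s) (N := N) (by linarith) (Nat.le_succ j)
  rw [neg_mul, neg_neg] at h1
  rw [← ENNReal.ofReal_mul (by positivity)]
  have e : (2⁻¹ : ℝ≥0∞) ^ j = ENNReal.ofReal ((2⁻¹ : ℝ) ^ j) := by
    rw [ENNReal.ofReal_pow (by norm_num), ENNReal.ofReal_inv_of_pos (by norm_num)]
    simp
  rw [e, ENNReal.ofNNReal_toNNReal, ← ENNReal.ofReal_mul (by positivity)]
  refine ENNReal.ofReal_le_ofReal ?_
  calc (2 : ℝ) ^ (s * j) * decaySeminorm X (dyadicS ψ j φ)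
      ≤ (2 : ℝ) ^ (s * j) * (((2⁻¹ : ℝ) ^ N) ^ j * q φ) := by
        gcongr
        exact hq j φ
    _ = (((2⁻¹ : ℝ) ^ N) ^ j * 2 ^ (s * j)) * q φ := by ring
    _ ≤ (2 ^ N * (2⁻¹) ^ j) * q φ := mul_le_mul_of_nonneg_right h1 hqn
    _ = _ := by ring

theorem besovNorm_schwartz_lt_top [CompleteSpace X] (hψ : IsGenerator ψ) {Φ : BanachFunctionSpace}
    (hΦ : Φ.IsTame) (s : ℝ) {q : ℝ≥0∞} (hq : 1 ≤ q) (φ : 𝓢(ℝ, X)) :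
    besovNorm ψ Φ s q (φ : 𝓢'(ℝ, X)) < ∞ := by
  obtain ⟨K, hK⟩ := exists_decaySeminorm_dyadicS_le hψ s φ
  refine (lqNorm_mono (b := fun j => K * Φ.norm decayFn * 2⁻¹ ^ j) fun j => ?_).trans_lt ?_
  · rw [← coe_dyadicS hψ]
    calc _ ≤ ENNReal.ofReal ((2 : ℝ) ^ (s * j)) *
          (ENNReal.ofReal (decaySeminorm X (dyadicS ψ j φ)) * Φ.norm decayFn) := by
          gcongr
          exact BanachFunctionSpace.IsTame.distNorm_schwartz_le _
      _ ≤ K * 2⁻¹ ^ j * Φ.norm decayFn := by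
          rw [← mul_assoc]
          exact mul_le_mul_left (hK j) _
      _ = _ := by ring
  · rw [lqNorm_const_mul hq]
    exact ENNReal.mul_lt_top (ENNReal.mul_lt_top ENNReal.coe_lt_top hΦ.norm_lt_top)
      (lqNorm_inv_two_pow_lt_top hq)

theorem triebelNorm_schwartz_lt_top [CompleteSpace X] (hψ : IsGenerator ψ)
    {Φ : BanachFunctionSpace} (hΦ : Φ.IsTame) (s : ℝ) {r : ℝ≥0∞} (hr : 1 ≤ r) (φ : 𝓢(ℝ, X)) :
    triebelNorm ψ Φ s r (φ : 𝓢'(ℝ, X)) < ∞ := by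
  obtain ⟨K, hK⟩ := exists_decaySeminorm_dyadicS_le hψ s φ
  have hrep : ∀ j, Represents (dyadicD ψ j (φ : 𝓢'(ℝ, X))) (dyadicS ψ j φ) := fun j => by
    rw [← coe_dyadicS hψ]
    exact represents_schwartz _
  rw [triebelNorm_eq Φ s r hrep]
  set L := lqNorm r fun j => 2⁻¹ ^ j with hL
  have hLt : L < ∞ := lqNorm_inv_two_pow_lt_top hr
  have hbound : ∀ t, (lqNorm r fun j => ENNReal.ofReal ((2 : ℝ) ^ (s * j)) *
      ‖dyadicS ψ j φ t‖ₑ) ≤ ((K * L.toNNReal : ℝ≥0) : ℝ≥0∞) * decayFn t := fun t => by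
    refine (lqNorm_mono (b := fun j => K * decayFn t * 2⁻¹ ^ j) fun j => ?_).trans_eq ?_
    · calc _ ≤ ENNReal.ofReal ((2 : ℝ) ^ (s * j)) *
            (ENNReal.ofReal (decaySeminorm X (dyadicS ψ j φ)) * decayFn t) := by
            gcongr
            exact enorm_le_decaySeminorm _ t
        _ ≤ K * 2⁻¹ ^ j * decayFn t := by
            rw [← mul_assoc]
            exact mul_le_mul_left (hK j) _
        _ = _ := by ring
    · rw [lqNorm_const_mul hr, ENNReal.coe_mul, ENNReal.coe_toNNReal hLt.ne]
      ring
  refine (Φ.norm_mono _ _ (triebel_aemeasurable _ hrep)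
    (measurable_decayFn.const_mul _).aemeasurable (.of_forall hbound)).trans_lt ?_
  rw [Φ.norm_const_mul _ _ measurable_decayFn.aemeasurable]
  exact ENNReal.mul_lt_top ENNReal.coe_lt_top hΦ.norm_lt_top

variable [CompleteSpace X] [CompleteSpace Y] {p : ℝ} {C : ℝ≥0 → ℝ≥0} {Φ : BanachFunctionSpace}
  {A B : ℝ≥0} {T : 𝓢(ℝ, X) →ₗ[ℂ] 𝓢'(ℝ, Y)}

theorem exists_isDyadicExtension_besovNorm_le (hp : 1 < p) (hψ : IsGenerator ψ)
    (hT : ∀ (j : ℕ) (f : 𝓢(ℝ, X)), T (dyadicS ψ j f) = dyadicD ψ j (T f))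
    (hC : ∀ m, BoundedOnWeights p (dyadicComp ψ m T) C) (hA0 : A ≠ 0) (hB0 : B ≠ 0)
    (hA : MaximalBoundedWith Φ.norm A) (hB : MaximalBoundedWith Φ.dualNorm B) (s : ℝ) {q : ℝ≥0∞}
    (hq : 1 ≤ q) {u : 𝓢'(ℝ, X)} (hu : besovNorm ψ Φ s q u < ∞) :
    ∃ v, IsDyadicExtension p ψ T u v ∧
      besovNorm ψ Φ s q v ≤ (3 * extrapolatedConst p C A B : ℝ≥0) * besovNorm ψ Φ s q u := by
  obtain ⟨v, hv⟩ := exists_isDyadicExtension hp hψ hT hC hA0 hB0 hA hB hu.ne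
    fun k => le_lqNorm hq (fun j : ℕ => ENNReal.ofReal ((2 : ℝ) ^ (s * j)) *
      distNorm Φ.norm (dyadicD ψ j u)) k
  refine ⟨v, hv, (lqNorm_mono fun j => ?_).trans_eq (lqNorm_const_mul hq _ _)⟩
  rw [mul_left_comm]
  gcongr
  exact hv.distNorm_dyadicD_le hp hψ hC hA0 hB0 hA hB j

/-- Boundedness on `L^r_w(ℓ^r) = ℓ^r(L^r_w)` is boundedness of the blocks on `L^r_w`; extrapolation
with the exponent `r` then leads to `Φ(ℓ^r)`. -/
theorem exists_isDyadicExtension_triebelNorm_le (hp : 1 < p) (hψ : IsGenerator ψ)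
    (hT : ∀ (j : ℕ) (f : 𝓢(ℝ, X)), T (dyadicS ψ j f) = dyadicD ψ j (T f))
    (hC : ∀ m, BoundedOnWeights p (dyadicComp ψ m T) C) (hA0 : A ≠ 0) (hB0 : B ≠ 0)
    (hA : MaximalBoundedWith Φ.norm A) (hB : MaximalBoundedWith Φ.dualNorm B) (s : ℝ) {r : ℝ≥0∞}
    (hr : 1 < r) (hr' : r < ∞) :
    ∃ D : ℝ≥0, ∀ u : 𝓢'(ℝ, X), triebelNorm ψ Φ s r u < ∞ → ∃ v, IsDyadicExtension p ψ T u v ∧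
      triebelNorm ψ Φ s r v ≤ D * triebelNorm ψ Φ s r u := by
  have hr1 : 1 < r.toReal := by simpa using (ENNReal.toReal_lt_toReal (by simp) hr'.ne).2 hr
  set K : ℝ≥0 := (extrapolationConst r.toReal A B).toNNReal with hK
  set A' : ℝ≥0 := (muckenhouptConst r.toReal K).toNNReal + 1
  set B' : ℝ≥0 := (muckenhouptConst r.toReal.conjExponent
    (K ^ (r.toReal.conjExponent - 1))).toNNReal + 1
  set D : ℝ≥0 := 3 * extrapolatedConst p C A' B' with hD
  refine ⟨4 * D, fun u hu => ?_⟩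
  have hu' := hu
  simp only [triebelNorm, iInf_lt_iff] at hu'
  obtain ⟨g, hg, hgt⟩ := hu'
  set c : ℕ → ℝ≥0∞ := fun j => ENNReal.ofReal ((2 : ℝ) ^ (s * j)) with hc
  have hblock : ∀ k, c k * distNorm Φ.norm (dyadicD ψ k u) ≤
      Φ.norm fun t => lqNorm r fun j => c j * ‖g j t‖ₑ := fun k => by
    rw [(hg k).distNorm_eq]
    have e : c k * Φ.norm (fun t => ‖g k t‖ₑ) = Φ.norm fun t => c k * ‖g k t‖ₑ :=
      (Φ.norm_const_mul _ _ (hg k).aemeasurable).symm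
    rw [e]
    exact Φ.norm_mono _ _ ((hg k).aemeasurable.const_mul _) (triebel_aemeasurable _ hg)
      (.of_forall fun t => le_lqNorm hr.le (fun j => c j * ‖g j t‖ₑ) k)
  obtain ⟨v, hv⟩ := exists_isDyadicExtension hp hψ hT hC hA0 hB0 hA hB hgt.ne hblock
  refine ⟨v, hv, ?_⟩
  have hut : ∀ k, distNorm Φ.norm (dyadicD ψ k u) < ∞ := fun k => by
    refine lt_top_iff_ne_top.2 fun h => ?_
    have h1 := (hblock k).trans_lt hgt
    rw [h, ENNReal.mul_top (ENNReal.ofReal_pos.2 (by positivity)).ne'] at h1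
    exact h1.ne rfl
  choose h hh using fun k => exists_represents_of_distNorm_lt_top
    ((hv.distNorm_dyadicD_le hp hψ hC hA0 hB0 hA hB k).trans_lt
      (ENNReal.mul_lt_top ENNReal.coe_lt_top (hut k)))
  rw [triebelNorm_eq Φ s r hh, triebelNorm_eq Φ s r hg, ENNReal.coe_mul]
  refine norm_le_of_weightedNorm_le hr1 Φ hA0 hB0 hA hB (triebel_aemeasurable c hh)
    (triebel_aemeasurable c hg) hgt fun w hw hwK => ?_
  have hwK' : apConst r.toReal w ≤ K := by
    rwa [ENNReal.coe_toNNReal (extrapolationConst_lt_top hr1 A B).ne]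
  have hct : ∀ j, c j ≠ ∞ := fun j => ENNReal.ofReal_ne_top
  rw [weightedNorm_lqNorm_eq hr hr' hr1 hw hct hh, weightedNorm_lqNorm_eq hr hr' hr1 hw hct hg,
    ← lqNorm_const_mul hr.le]
  refine lqNorm_mono fun j => ?_
  rw [mul_left_comm]
  gcongr
  exact hv.distNorm_dyadicD_le hp hψ hC (by positivity) (by positivity)
    ((weightedSpace_maximalBounded hr1 hw hwK').mono (by simp [A']))
    ((weightedSpace_dual_maximalBounded hr1 hw hwK').mono (by simp [B'])) j

/-- If `T` itself is bounded, then its extension is bounded on `Φ(X)`. -/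
theorem exists_isDyadicExtension_distNorm_le (hp : 1 < p) (hψ : IsGenerator ψ)
    (hT : ∀ (j : ℕ) (f : 𝓢(ℝ, X)), T (dyadicS ψ j f) = dyadicD ψ j (T f))
    (hC : BoundedOnWeights p T C) (hA0 : A ≠ 0) (hB0 : B ≠ 0)
    (hA : MaximalBoundedWith Φ.norm A) (hB : MaximalBoundedWith Φ.dualNorm B) {u : 𝓢'(ℝ, X)}
    (hu : distNorm Φ.norm u < ∞) :
    ∃ v, IsDyadicExtension p ψ T u v ∧
      distNorm Φ.norm v ≤ extrapolatedConst p C A B * distNorm Φ.norm u := by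
  obtain ⟨v, hv⟩ := exists_isExtension_of_distNorm_lt_top hp hA0 hB0 hA hB hC hu
  exact ⟨v, fun k m => (hv.multiplier_both hp hψ k (hT k)).multiplier_left hp hψ m,
    hv.distNorm_le_extrapolatedConst hp hA0 hB0 hA hB hC hu⟩

end Estimates

/-! ### Consistent extensions -/

section Consistent

theorem MaximalBounded.exists_maximalBoundedWith {ρ : (ℝ → ℝ≥0∞) → ℝ≥0∞} (h : MaximalBounded ρ) :
    ∃ A : ℝ≥0, A ≠ 0 ∧ MaximalBoundedWith ρ A := by
  obtain ⟨C, hC⟩ := h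
  exact ⟨C + 1, by positivity, MaximalBoundedWith.mono hC (by simp)⟩

theorem BanachFunctionSpace.Admissible.isTame {Φ : BanachFunctionSpace} (h : Φ.Admissible) :
    Φ.IsTame := by
  obtain ⟨A, -, hA⟩ := h.1.exists_maximalBoundedWith
  obtain ⟨B, -, hB⟩ := h.2.exists_maximalBoundedWith
  exact Φ.isTame hA hB

variable {X Y : Type*} [NormedAddCommGroup X] [NormedSpace ℂ X] [CompleteSpace X]
  [NormedAddCommGroup Y] [NormedSpace ℂ Y] {p : ℝ}

theorem distNorm_le_of_forall_le_one (hp : 1 < p) {w : ℝ → ℝ≥0∞} (hw : IsMuckenhoupt p w)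
    (S : 𝓢(ℝ, X) →ₗ[ℂ] 𝓢'(ℝ, Y)) {c : ℝ≥0∞}
    (h : ∀ f : 𝓢(ℝ, X), weightedNorm p w (fun t => ‖f t‖ₑ) ≤ 1 →
      distNorm (weightedNorm p w) (S f) ≤ c) (φ : 𝓢(ℝ, X)) :
    distNorm (weightedNorm p w) (S φ) ≤ c * distNorm (weightedNorm p w) (φ : 𝓢'(ℝ, X)) := by
  set Φ := weightedSpace hp hw
  have hφ := represents_schwartz φ
  have ha : distNorm (weightedNorm p w) (φ : 𝓢'(ℝ, X)) = weightedNorm p w fun t => ‖φ t‖ₑ :=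
    hφ.distNorm_eq Φ
  have hat := (weightedSpace_isTame hp hw).distNorm_schwartz_lt_top φ
  change distNorm (weightedNorm p w) _ < ∞ at hat
  rw [ha] at hat ⊢
  rcases eq_or_ne (weightedNorm p w fun t => ‖φ t‖ₑ) 0 with h0 | h0
  · have h1 := (Φ.norm_eq_zero_iff _ hφ.aemeasurable).1 h0
    have h2 : (φ : ℝ → X) =ᵐ[volume] fun _ => 0 := by
      filter_upwards [h1] with t ht
      simpa using ht
    have h3 : φ = 0 := DFunLike.coe_injective
      ((Continuous.ae_eq_iff_eq volume φ.continuous continuous_const).1 h2)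
    rw [h3, map_zero]
    exact (distNorm_zero Φ).trans_le zero_le
  lift weightedNorm p w (fun t => ‖φ t‖ₑ) to ℝ≥0 using hat.ne with a hae
  have ha0 : (a : ℂ) ≠ 0 := by simpa using h0
  have hn : ‖((a : ℂ)⁻¹)‖ₑ = ((a⁻¹ : ℝ≥0) : ℝ≥0∞) := by
    rw [enorm_eq_nnnorm]
    congr 1
    ext
    simp
  have h1 : weightedNorm p w (fun t => ‖((a : ℂ)⁻¹ • φ) t‖ₑ) ≤ 1 := by
    have e := Φ.norm_const_mul a⁻¹ _ hφ.aemeasurable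
    change weightedNorm p w _ = _ * weightedNorm p w _ at e
    simp only [_root_.smul_apply, enorm_smul, hn, e, ← hae]
    rw [← ENNReal.coe_mul, inv_mul_cancel₀ (by simpa using h0)]
    simp
  have h2 := h _ h1
  have e : S φ = (a : ℂ) • S ((a : ℂ)⁻¹ • φ) := by
    rw [← map_smul, smul_inv_smul₀ ha0]
  rw [e]
  refine (distNorm_smul_le Φ _ _).trans ?_
  rw [mul_comm c]
  gcongr
  · refine le_of_eq ?_
    rw [← enorm_norm]
    simp
  · exact h2

theorem exists_boundedOnWeights (hp : 1 < p) {ι : Type*} {S : ι → 𝓢(ℝ, X) →ₗ[ℂ] 𝓢'(ℝ, Y)}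
    (h : ∀ 𝒲 : Set (ℝ → ℝ≥0∞), (∀ w ∈ 𝒲, IsMuckenhoupt p w) → (⨆ w ∈ 𝒲, apConst p w) < ∞ →
      (⨆ (w ∈ 𝒲) (j : ι) (f : 𝓢(ℝ, X)) (_ : weightedNorm p w (fun t => ‖f t‖ₑ) ≤ 1),
        distNorm (weightedNorm p w) (S j f)) < ∞) :
    ∃ C : ℝ≥0 → ℝ≥0, ∀ j, BoundedOnWeights p (S j) C := by
  have key : ∀ N : ℝ≥0, ∃ c : ℝ≥0, ∀ j w, IsMuckenhoupt p w → apConst p w ≤ N →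
      ∀ φ : 𝓢(ℝ, X), distNorm (weightedNorm p w) (S j φ) ≤
        c * distNorm (weightedNorm p w) (φ : 𝓢'(ℝ, X)) := fun N => by
    have hN := h {w | IsMuckenhoupt p w ∧ apConst p w ≤ N} (fun w hw => hw.1)
      ((iSup₂_le fun w hw => hw.2).trans_lt ENNReal.coe_lt_top)
    refine ⟨ENNReal.toNNReal (⨆ (w ∈ {w | IsMuckenhoupt p w ∧ apConst p w ≤ N}) (j : ι)
      (f : 𝓢(ℝ, X)) (_ : weightedNorm p w (fun t => ‖f t‖ₑ) ≤ 1),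
      distNorm (weightedNorm p w) (S j f)), fun j w hw hwN φ =>
      distNorm_le_of_forall_le_one hp hw (S j) (fun f hf => ?_) φ⟩
    rw [ENNReal.coe_toNNReal hN.ne]
    exact le_iSup₂_of_le w ⟨hw, hwN⟩ (le_iSup_of_le j (le_iSup₂_of_le f hf le_rfl))
  choose C hC using key
  exact ⟨C, fun j N w hw hN φ => hC N j w hw hN φ⟩

variable [CompleteSpace Y] {ψ : ℝ → ℂ} {T : 𝓢(ℝ, X) →ₗ[ℂ] 𝓢'(ℝ, Y)} {C : ℝ≥0 → ℝ≥0}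

/-- By uniqueness of dyadic extensions, existence with norm estimates is all that is needed: the
extensions are then automatically linear and consistent. -/
theorem hasConsistentExtensions (hp : 1 < p) (hψ : IsGenerator ψ)
    (hT : ∀ (j : ℕ) (f : 𝓢(ℝ, X)), T (dyadicS ψ j f) = dyadicD ψ j (T f))
    (hC : ∀ m, BoundedOnWeights p (dyadicComp ψ m T) C) {𝓔 : Set Space}
    (h𝓢 : ∀ E ∈ 𝓔, ∀ φ : 𝓢(ℝ, X), E.norm ψ (φ : 𝓢'(ℝ, X)) < ∞)
    (h𝓔 : ∀ E ∈ 𝓔, ∃ D : ℝ≥0, ∀ u : 𝓢'(ℝ, X), E.norm ψ u < ∞ →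
      ∃ v, IsDyadicExtension p ψ T u v ∧ E.norm ψ v ≤ D * E.norm ψ u) :
    HasConsistentExtensions ψ T 𝓔 := by
  have key : ∀ E : Space, ∃ S : E.carrier ψ X →ₗ[ℂ] E.carrier ψ Y, E ∈ 𝓔 →
      IsBoundedOp ψ E S ∧ ∀ u : E.carrier ψ X,
        IsDyadicExtension p ψ T (u : 𝓢'(ℝ, X)) (S u : 𝓢'(ℝ, Y)) := by
    intro E
    by_cases hE : E ∈ 𝓔
    swap
    · exact ⟨0, fun h => absurd h hE⟩
    obtain ⟨D, hD⟩ := h𝓔 E hE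
    choose v hv hvD using fun u : E.carrier ψ X => hD u u.2
    refine ⟨{ toFun := fun u => ⟨v u, (hvD u).trans_lt (ENNReal.mul_lt_top ENNReal.coe_lt_top u.2)⟩
              map_add' := fun u u' => Subtype.ext
                ((hv (u + u')).unique hp hψ hC ((hv u).add hp (hv u')))
              map_smul' := fun a u => Subtype.ext
                ((hv (a • u)).unique hp hψ hC ((hv u).smul hp a)) }, fun _ => ⟨⟨D, hvD⟩, hv⟩⟩
  choose S hS using key
  refine ⟨S, fun E hE => ⟨(hS E hE).1, fun f => ⟨h𝓢 E hE f, ?_⟩⟩, fun E hE F hF u huE huF => ?_⟩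
  · exact ((hS E hE).2 ⟨_, h𝓢 E hE f⟩).unique hp hψ hC (isDyadicExtension_coe hp hψ hT f)
  · exact ((hS E hE).2 ⟨u, huE⟩).unique hp hψ hC ((hS F hF).2 ⟨u, huF⟩)

theorem Space.norm_schwartz_lt_top (hψ : IsGenerator ψ) {E : Space} (hE : E.fn.Admissible)
    (φ : 𝓢(ℝ, X)) : E.norm ψ (φ : 𝓢'(ℝ, X)) < ∞ := by
  cases E with
  | base Φ => exact hE.isTame.distNorm_schwartz_lt_top φ
  | besov Φ s q hq => exact besovNorm_schwartz_lt_top hψ hE.isTame s hq φ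
  | triebel Φ s r hr hr' => exact triebelNorm_schwartz_lt_top hψ hE.isTame s hr.le φ

end Consistent

theorem mainTheorem3 {X Y : Type*}
    [NormedAddCommGroup X] [NormedSpace ℂ X] [CompleteSpace X]
    [NormedAddCommGroup Y] [NormedSpace ℂ Y] [CompleteSpace Y]
    (p : ℝ) (hp : 1 < p) (ψ : ℝ → ℂ) (hψ : IsGenerator ψ)
    (T : 𝓢(ℝ, X) →ₗ[ℂ] 𝓢'(ℝ, Y))
    (hT : ∀ (j : ℕ) (f : 𝓢(ℝ, X)), T (dyadicS ψ j f) = dyadicD ψ j (T f)) :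
    ((∀ 𝒲 : Set (ℝ → ℝ≥0∞), (∀ w ∈ 𝒲, IsMuckenhoupt p w) → (⨆ w ∈ 𝒲, apConst p w) < ∞ →
        (⨆ (w ∈ 𝒲) (j : ℕ) (f : 𝓢(ℝ, X)) (_ : weightedNorm p w (fun t => ‖f t‖ₑ) ≤ 1),
          distNorm (weightedNorm p w) (T (dyadicS ψ j f))) < ∞) →
      (∀ (s : ℝ) (q : ℝ≥0∞) (hq : 1 ≤ q),
        HasConsistentExtensions ψ T {E | ∃ Φ, Φ.Admissible ∧ E = Space.besov Φ s q hq}) ∧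
      (∀ (s : ℝ) (r : ℝ≥0∞) (hr : 1 < r) (hr' : r < ∞),
        HasConsistentExtensions ψ T {E | ∃ Φ, Φ.Admissible ∧ E = Space.triebel Φ s r hr hr'})) ∧
    ((∀ 𝒲 : Set (ℝ → ℝ≥0∞), (∀ w ∈ 𝒲, IsMuckenhoupt p w) → (⨆ w ∈ 𝒲, apConst p w) < ∞ →
        (⨆ (w ∈ 𝒲) (f : 𝓢(ℝ, X)) (_ : weightedNorm p w (fun t => ‖f t‖ₑ) ≤ 1),
          distNorm (weightedNorm p w) (T f)) < ∞) →
      HasConsistentExtensions ψ T {E | E.fn.Admissible} ∧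
      ∀ Φ : BanachFunctionSpace, Φ.Admissible → ∀ g : ℝ → X, AEStronglyMeasurable g volume →
        Φ.norm (fun t => ‖g t‖ₑ) < ∞ → ∃ u : 𝓢'(ℝ, X), Represents u g) := by
  have hBesov : ∀ {C : ℝ≥0 → ℝ≥0}, (∀ m, BoundedOnWeights p (dyadicComp ψ m T) C) →
      ∀ Φ : BanachFunctionSpace, Φ.Admissible → ∀ (s : ℝ) (q : ℝ≥0∞) (hq : 1 ≤ q),
      ∃ D : ℝ≥0, ∀ u : 𝓢'(ℝ, X), (Space.besov Φ s q hq).norm ψ u < ∞ →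
        ∃ v, IsDyadicExtension p ψ T u v ∧
          (Space.besov Φ s q hq).norm ψ v ≤ D * (Space.besov Φ s q hq).norm ψ u := by
    intro C hC Φ hΦ s q hq
    obtain ⟨A, hA0, hA⟩ := hΦ.1.exists_maximalBoundedWith
    obtain ⟨B, hB0, hB⟩ := hΦ.2.exists_maximalBoundedWith
    exact ⟨_, fun u hu =>
      exists_isDyadicExtension_besovNorm_le hp hψ hT hC hA0 hB0 hA hB s hq hu⟩
  have hTriebel : ∀ {C : ℝ≥0 → ℝ≥0}, (∀ m, BoundedOnWeights p (dyadicComp ψ m T) C) →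
      ∀ Φ : BanachFunctionSpace, Φ.Admissible → ∀ (s : ℝ) (r : ℝ≥0∞) (hr : 1 < r) (hr' : r < ∞),
      ∃ D : ℝ≥0, ∀ u : 𝓢'(ℝ, X), (Space.triebel Φ s r hr hr').norm ψ u < ∞ →
        ∃ v, IsDyadicExtension p ψ T u v ∧
          (Space.triebel Φ s r hr hr').norm ψ v ≤ D * (Space.triebel Φ s r hr hr').norm ψ u := by
    intro C hC Φ hΦ s r hr hr'
    obtain ⟨A, hA0, hA⟩ := hΦ.1.exists_maximalBoundedWith
    obtain ⟨B, hB0, hB⟩ := hΦ.2.exists_maximalBoundedWith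
    exact exists_isDyadicExtension_triebelNorm_le hp hψ hT hC hA0 hB0 hA hB s hr hr'
  refine ⟨fun h => ?_, fun h => ⟨?_, fun Φ hΦ g hg hgt => ?_⟩⟩
  · obtain ⟨C, hC⟩ := exists_boundedOnWeights (S := fun m => dyadicComp ψ m T) hp
      (by simpa only [dyadicComp_apply, ← hT] using h)
    constructor
    · intro s q hq
      refine hasConsistentExtensions hp hψ hT hC ?_ ?_
      · rintro _ ⟨Φ, hΦ, rfl⟩ φ
        exact Space.norm_schwartz_lt_top hψ (E := .besov Φ s q hq) hΦ φ
      · rintro _ ⟨Φ, hΦ, rfl⟩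
        exact hBesov hC Φ hΦ s q hq
    · intro s r hr hr'
      refine hasConsistentExtensions hp hψ hT hC ?_ ?_
      · rintro _ ⟨Φ, hΦ, rfl⟩ φ
        exact Space.norm_schwartz_lt_top hψ (E := .triebel Φ s r hr hr') hΦ φ
      · rintro _ ⟨Φ, hΦ, rfl⟩
        exact hTriebel hC Φ hΦ s r hr hr'
  · obtain ⟨C', hC'⟩ := exists_boundedOnWeights (S := fun _ : Unit => T) hp
      (by simpa only [iSup_const] using h)
    obtain ⟨C, hC⟩ := exists_boundedOnWeights_dyadicComp (X := X) (Y := Y) hp hψ (C := C')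
    have hC : ∀ m, BoundedOnWeights p (dyadicComp ψ m T) C := fun m => hC m T (hC' ())
    refine hasConsistentExtensions hp hψ hT hC
      (fun E hE φ => Space.norm_schwartz_lt_top hψ hE φ) fun E hE => ?_
    cases E with
    | base Φ =>
      obtain ⟨A, hA0, hA⟩ := hE.1.exists_maximalBoundedWith
      obtain ⟨B, hB0, hB⟩ := hE.2.exists_maximalBoundedWith
      exact ⟨_, fun u hu =>
        exists_isDyadicExtension_distNorm_le hp hψ hT (hC' ()) hA0 hB0 hA hB hu⟩
    | besov Φ s q hq => exact hBesov hC Φ hE s q hq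
    | triebel Φ s r hr hr' => exact hTriebel hC Φ hE s r hr hr'
  · obtain ⟨u, hu, -⟩ := exists_represents hg
      (hΦ.isTame.lintegral_mul_decayFn_ne_top hg.enorm hgt.ne)
    exact ⟨u, hu⟩

end
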